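/- Let $M$ be a smooth (Hausdorff, $\sigma$-compact) manifold of dimension $2m+1$, $m\ge 0$, without boundary and not necessarily connected, and let $\eta$ be a contact form on $M$, that is, a $1$-form such that $\eta\wedge(d\eta)^m$ vanishes at no point of $M$. Write $\mathfrak X(M)$, $\Omega^k(M)$ and $\mathcal V^k(M)$ for the spaces of vector fields, $k$-forms and $k$-vectors on $M$ (with $\Omega^{-1}(M)=\mathcal V^{-1}(M)=0$). Then the following holds. 1. The map $\flat:\mathfrak X(M)\to\Omega^1(M)$, $\flat(X)=i_Xd\eta+\eta(X)\eta$, is bijective, and $\Lambda(\alpha,\beta)=d\eta(\flat^{-1}\alpha,\flat^{-1}\beta)$, $E=\flat^{-1}(\eta)$ define a Jacobi structure on $M$: $[\Lambda,\Lambda]=2E\wedge\Lambda$ and $[E,\Lambda]=0$. Here $[\cdot,\cdot]$ is the Schouten–Nijenhuis bracket, with the signs $$[X_1\wedge\dots\wedge X_p,Y_1\wedge\dots\wedge Y_q]=(-1)^{p+1}\sum_{i,j}(-1)^{i+j}[X_i,Y_j]\wedge X_1\wedge\dots\widehat{X_i}\dots\wedge X_p\wedge Y_1\wedge\dots\widehat{Y_j}\dots\wedge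 Y_q$$ and $[\Lambda,f]=\Lambda(df,\cdot)$ for functions $f$. 2. For $P\in\mathcal V^k(M)$ and $Q\in\mathcal V^{k-1}(M)$ put $$\sigma(P,Q)=\bigl(-[\Lambda,P]+kE\wedge P+\Lambda\wedge Q,\ [\Lambda,Q]-(k-1)E\wedge Q+[E,P]\bigr)\in\mathcal V^{k+1}(M)\oplus\mathcal V^{k}(M).$$ Then $\sigma^2=0$. The Lichnerowicz–Jacobi cohomology $H^*_{LJ}(M)$ is the cohomology of the complex $(\mathcal V^*(M)\oplus\mathcal V^{*-1}(M),\sigma)$. 3. Let $\#:\Omega^k(M)\to\mathcal V^k(M)$ be given by $\#f=f$ for functions, $(\#\alpha)(\beta)=\Lambda(\alpha,\beta)$ for $1$-forms, and $(\#\alpha)(\alpha_1,\dots,\alpha_k)=(-1)^k\alpha(\#\alpha_1,\dots,\#\alpha_k)$ for $k$-forms. Then the $C^\infty(M)$-linear maps $\tilde F^k:\Omega^k(M)\oplus\Omega^{k-1}(M)\to\mathcal V^k(M)\oplus\mathcal V^{k-1}(M)$, $$\tilde F^k(\alpha,\beta)=\bigl(\#\alpha+E\wedge\#\beta,\ -\#(i_E\alpha)+E\wedge\#(i_E\beta)\bigr),$$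 are bijective for all $k\ge 0$ and satisfy $\sigma(\tilde F^k(\alpha,\beta))=\tilde F^{k+1}(-d\alpha,d\beta)$; so $\tilde F$ is an isomorphism of complexes from $(\Omega^*(M),-d)\oplus(\Omega^{*-1}(M),d)$ to $(\mathcal V^*(M)\oplus\mathcal V^{*-1}(M),\sigma)$. 4. Consequently, for every $k\ge0$, the map $([\alpha],[\beta])\mapsto[\tilde F^k(\alpha,\beta)]$ is a well-defined linear isomorphism $H^k_{dR}(M)\oplus H^{k-1}_{dR}(M)\to H^k_{LJ}(M)$. Thus $H^k_{LJ}(M)\cong H^k_{dR}(M)\oplus H^{k-1}_{dR}(M)$, with $H^{-1}_{dR}(M)=0$. -/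

import Mathlib

namespace LichJac
noncomputable section

/-- The vector fields of a commutative real algebra `A`: its derivations. For `A = C^∞(M)` these
are the smooth vector fields on `M`, with `X f` the derivative of `f` along `X` and `⁅X, Y⁆` the
Lie bracket. -/
abbrev VField (A : Type*) [CommRing A] [Algebra ℝ A] := Derivation ℝ A A

/-- Differential `k`-forms: alternating `k`-fold `C^∞(M)`-multilinear maps
`𝔛(M) × ⋯ × 𝔛(M) → C^∞(M)`. -/
abbrev Form (A : Type*) [CommRing A] [Algebra ℝ A] (k : ℕ) :=
  VField A [⋀^Fin k]→ₗ[A] A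

section Koszul
variable {A : Type*} [CommRing A] [Algebra ℝ A]

instance instFormTower (k : ℕ) : IsScalarTower ℝ A (Form A k) :=
  ⟨fun c f α => by ext X; exact smul_assoc c f (α X)⟩

/-- The value `(dα)(X₀, …, X_k)` of the exterior derivative:
`∑_i (-1)^i X_i (α(X₀, …, X̂_i, …, X_k))
  + ∑_{i<l} (-1)^(i+l) α([X_i, X_l], X₀, …, X̂_i, …, X̂_l, …, X_k)`.
In the second sum the pair `(i, l)` is written as `(i, j + 1)` with `i ≤ j`, hence the minus sign. -/
def koszul : ∀ {k : ℕ}, Form A k → (Fin (k + 1) → VField A) → A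
  | 0, α, X => X 0 (α ![])
  | k + 1, α, X =>
      (∑ i : Fin (k + 2), (-1) ^ (i : ℕ) * X i (α (i.removeNth X))) -
        ∑ i : Fin (k + 1), ∑ j ≥ i, (-1) ^ (i + j : ℕ) *
          α (Matrix.vecCons ⁅X i.castSucc, X j.succ⁆ (j.removeNth (i.castSucc.removeNth X)))

/-- A form, regarded as a real multilinear alternating map. -/
def realAlt {k : ℕ} (α : Form A k) : VField A [⋀^Fin k]→ₗ[ℝ] A :=
  { α.toMultilinearMap.restrictScalars ℝ with
    map_eq_zero_of_eq' := α.map_eq_zero_of_eq' }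

@[simp] theorem realAlt_apply {k : ℕ} (α : Form A k) (X : Fin k → VField A) :
    realAlt α X = α X := rfl

/-- Auxiliary: the first sum of `koszul` as a real alternating map. -/
def koszulDeriv {k : ℕ} (α : Form A k) : VField A [⋀^Fin (k + 1)]→ₗ[ℝ] A :=
  AlternatingMap.alternatizeUncurryFin
    { toFun := fun X => X.toLinearMap.compAlternatingMap (realAlt α)
      map_add' := fun X Y => by ext v; simp
      map_smul' := fun c X => by ext v; simp }

/-- Auxiliary: minus twice the second sum of `koszul` as a real alternating map. -/
def koszulBracket {k : ℕ} (α : Form A (k + 1)) : VField A [⋀^Fin (k + 2)]→ₗ[ℝ] A :=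
  AlternatingMap.alternatizeUncurryFin
    (AlternatingMap.alternatizeUncurryFinLM ∘ₗ
      LinearMap.mk₂ ℝ (fun X Y : VField A => (realAlt α).curryLeft ⁅X, Y⁆)
        (fun X Y Z => by simp) (fun c X Y => by simp) (fun X Y Z => by simp)
        (fun c X Y => by simp))

theorem koszulDeriv_apply {k : ℕ} (α : Form A k) (X : Fin (k + 1) → VField A) :
    koszulDeriv α X = ∑ i : Fin (k + 1), (-1) ^ (i : ℕ) * X i (α (i.removeNth X)) := by
  rw [koszulDeriv, AlternatingMap.alternatizeUncurryFin_apply]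
  refine Finset.sum_congr rfl fun i _ => ?_
  rw [zsmul_eq_mul]; push_cast; rfl

theorem koszulBracket_apply {k : ℕ} (α : Form A (k + 1)) (X : Fin (k + 2) → VField A) :
    koszulBracket α X = 2 * ∑ i : Fin (k + 1), ∑ j ≥ i, (-1) ^ (i + j : ℕ) *
      α (Matrix.vecCons ⁅X i.castSucc, X j.succ⁆ (j.removeNth (i.castSucc.removeNth X))) := by
  rw [koszulBracket, AlternatingMap.alternatizeUncurryFin_alternatizeUncurryFinLM_comp_apply]
  simp only [Finset.mul_sum]
  refine Finset.sum_congr rfl fun i _ => Finset.sum_congr rfl fun j _ => ?_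
  have h : ⁅X j.succ, X i.castSucc⁆ = -⁅X i.castSucc, X j.succ⁆ := (lie_skew _ _).symm
  simp only [LinearMap.mk₂_apply, AlternatingMap.curryLeft_apply_apply, h, map_neg,
    AlternatingMap.neg_apply, realAlt_apply]
  rw [zsmul_eq_mul]; push_cast; ring

/-- Auxiliary: `koszul α` as a real alternating map. -/
def koszulAlt : ∀ {k : ℕ}, Form A k → VField A [⋀^Fin (k + 1)]→ₗ[ℝ] A
  | 0, α => koszulDeriv α
  | _ + 1, α => koszulDeriv α - (1 / 2 : ℝ) • koszulBracket α

theorem koszulAlt_apply : ∀ {k : ℕ} (α : Form A k) (X : Fin (k + 1) → VField A),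
    koszulAlt α X = koszul α X
  | 0, α, X => by
      rw [koszulAlt, koszul, koszulDeriv_apply, Fin.sum_univ_one, Fin.val_zero, pow_zero, one_mul]
      congr 2
      exact Subsingleton.elim _ _
  | k + 1, α, X => by
      simp only [koszulAlt, koszul, AlternatingMap.sub_apply, AlternatingMap.smul_apply,
        koszulDeriv_apply, koszulBracket_apply]
      congr 1
      rw [two_mul, ← two_smul ℝ, smul_smul]
      norm_num

theorem lie_smul_left (f : A) (X Y : VField A) : ⁅f • X, Y⁆ = f • ⁅X, Y⁆ - Y f • X := by
  ext g
  simp [Derivation.commutator_apply]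
  ring

theorem koszul_smul_zero {k : ℕ} (α : Form A k) (f : A) (x : VField A) (w : Fin k → VField A) :
    koszul α (Fin.cons (f • x) w : Fin (k + 1) → VField A) =
      f * koszul α (Fin.cons x w : Fin (k + 1) → VField A) := by
  match k, α, w with
  | 0, α, w => simp [koszul]
  | k + 1, α, w =>
    have hr (i : Fin (k + 1)) (y : VField A) :
        i.succ.removeNth (Fin.cons y w : Fin (k + 2) → VField A) =
          (Fin.cons y (i.removeNth w) : Fin (k + 1) → VField A) := by
      ext j : 1
      refine Fin.cases ?_ (fun j => ?_) j <;> simp [Fin.removeNth]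
    have hc (y : VField A) (u : Fin k → VField A) :
        α (Fin.cons (f • y) u : Fin (k + 1) → VField A) =
          f * α (Fin.cons y u : Fin (k + 1) → VField A) := by
      exact α.map_vecCons_smul u f y
    have hc2 (y b : VField A) (j i : Fin (k + 1)) (hij : i ≤ j) (hi : i ≠ 0) :
        α (Matrix.vecCons b (j.removeNth
          (i.castSucc.removeNth (Fin.cons (f • y) w : Fin (k + 2) → VField A)))) =
          f * α (Matrix.vecCons b (j.removeNth
          (i.castSucc.removeNth (Fin.cons y w : Fin (k + 2) → VField A)))) := by
      match k, α, w, j, i, hij, hi, hr with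
      | 0, α, w, j, i, hij, hi, hr => exact absurd (Fin.fin_one_eq_zero i) hi
      | k + 1, α, w, j, i, hij, hi, hr =>
        obtain ⟨i, rfl⟩ := Fin.exists_succ_eq.2 hi
        obtain ⟨j, rfl⟩ := Fin.exists_succ_eq.2
          (show j ≠ 0 from fun h => hi (le_antisymm (h ▸ hij) (Fin.zero_le _)))
        have hr' (y : VField A) (v : Fin (k + 1) → VField A) :
            j.succ.removeNth (Fin.cons y v : Fin (k + 2) → VField A) =
              (Fin.cons y (j.removeNth v) : Fin (k + 1) → VField A) := by
          ext l : 1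
          refine Fin.cases ?_ (fun l => ?_) l <;> simp [Fin.removeNth]
        rw [← Fin.succ_castSucc, hr, hr, hr', hr']
        generalize j.removeNth (i.castSucc.removeNth w) = u
        have h1 (z : VField A) : Matrix.vecCons b (Fin.cons z u : Fin (k + 1) → VField A) =
            Function.update (Matrix.vecCons b (Fin.cons 0 u : Fin (k + 1) → VField A)) 1 z := by
          ext l : 1
          refine Fin.cases ?_ (fun l => Fin.cases ?_ (fun l => ?_) l) l
          · rw [Function.update_of_ne (by simp)]; rfl
          · exact (Function.update_self (β := fun _ => VField A) (1 : Fin (k + 2)) z _).symm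
          · rw [Function.update_of_ne (by simp [Fin.ext_iff])]; rfl
        rw [h1 (f • y), h1 y, α.map_update_smul, smul_eq_mul]
    have h0 (y : VField A) :
        (0 : Fin (k + 2)).removeNth (Fin.cons y w : Fin (k + 2) → VField A) = w := by
      ext l : 1; simp [Fin.removeNth]
    have hD : (∑ i : Fin (k + 2), (-1) ^ (i : ℕ) * (Fin.cons (f • x) w : Fin (k + 2) → VField A) i
          (α (i.removeNth (Fin.cons (f • x) w : Fin (k + 2) → VField A)))) =
        f * (∑ i : Fin (k + 2), (-1) ^ (i : ℕ) * (Fin.cons x w : Fin (k + 2) → VField A) i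
          (α (i.removeNth (Fin.cons x w : Fin (k + 2) → VField A)))) -
        ∑ j : Fin (k + 1), (-1) ^ (j : ℕ) * (w j f *
          α (Fin.cons x (j.removeNth w) : Fin (k + 1) → VField A)) := by
      rw [Fin.sum_univ_succ, Fin.sum_univ_succ (n := k + 1), mul_add, add_sub_assoc,
        Finset.mul_sum, ← Finset.sum_sub_distrib]
      simp only [h0, hr, hc, Fin.cons_zero, Fin.cons_succ]
      congr 1
      · simp
      · refine Finset.sum_congr rfl fun i _ => ?_
        rw [Derivation.leibniz, Fin.val_succ, pow_succ]
        simp only [smul_eq_mul]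
        ring
    have hB : (∑ i : Fin (k + 1), ∑ j ≥ i, (-1) ^ (i + j : ℕ) *
          α (Matrix.vecCons ⁅(Fin.cons (f • x) w : Fin (k + 2) → VField A) i.castSucc,
            (Fin.cons (f • x) w : Fin (k + 2) → VField A) j.succ⁆ (j.removeNth
            (i.castSucc.removeNth (Fin.cons (f • x) w : Fin (k + 2) → VField A))))) =
        f * (∑ i : Fin (k + 1), ∑ j ≥ i, (-1) ^ (i + j : ℕ) *
          α (Matrix.vecCons ⁅(Fin.cons x w : Fin (k + 2) → VField A) i.castSucc,
            (Fin.cons x w : Fin (k + 2) → VField A) j.succ⁆ (j.removeNth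
            (i.castSucc.removeNth (Fin.cons x w : Fin (k + 2) → VField A))))) -
        ∑ j : Fin (k + 1), (-1) ^ (j : ℕ) * (w j f *
          α (Fin.cons x (j.removeNth w) : Fin (k + 1) → VField A)) := by
      rw [Fin.sum_univ_succ, Fin.sum_univ_succ (n := k), mul_add, add_sub_right_comm,
        Finset.mul_sum]
      congr 1
      · have hI : Finset.Ici (0 : Fin (k + 1)) = Finset.univ := by ext; simp
        rw [hI, ← Finset.sum_sub_distrib]
        refine Finset.sum_congr rfl fun j _ => ?_
        have hb : α (Matrix.vecCons (⁅f • x, w j⁆) (j.removeNth w)) =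
            f * α (Matrix.vecCons ⁅x, w j⁆ (j.removeNth w)) -
              w j f * α (Matrix.vecCons x (j.removeNth w)) := by
          rw [lie_smul_left, sub_eq_add_neg, ← neg_smul, α.map_vecCons_add,
            α.map_vecCons_smul, α.map_vecCons_smul]
          simp only [smul_eq_mul]; ring
        simp only [Fin.castSucc_zero, h0, Fin.cons_zero, Fin.cons_succ, hb, Fin.val_zero, zero_add]
        change _ = _ - (-1) ^ (j : ℕ) * (w j f * α (Matrix.vecCons x (j.removeNth w)))
        ring
      · rw [Finset.mul_sum]
        refine Finset.sum_congr rfl fun i _ => ?_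
        rw [Finset.mul_sum]
        refine Finset.sum_congr rfl fun j hj => ?_
        rw [Finset.mem_Ici] at hj
        rw [← Fin.succ_castSucc]
        simp only [Fin.cons_succ]
        rw [Fin.succ_castSucc, hc2 x _ j i.succ hj (Fin.succ_ne_zero i)]
        ring
    simp only [koszul]
    rw [hD, hB]
    ring

/-- The exterior derivative of a form, as a form. -/
def koszulForm {k : ℕ} (α : Form A k) : Form A (k + 1) where
  toFun := koszul α
  map_update_add' X i x y := by
    classical
    simp only [← koszulAlt_apply]
    convert (koszulAlt α).map_update_add X i x y
  map_update_smul' X i f x := by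
    simp only [← koszulAlt_apply]
    have key (X : Fin (k + 1) → VField A) : koszulAlt α (Function.update X 0 (f • x)) =
        f * koszulAlt α (Function.update X 0 x) := by
      have h (z : VField A) : Function.update X 0 z =
          (Fin.cons z (Fin.tail X) : Fin (k + 1) → VField A) := by
        ext l : 1
        refine Fin.cases ?_ (fun l => ?_) l
        · simp
        · simp [Fin.tail]
      rw [h, h, koszulAlt_apply, koszulAlt_apply, koszul_smul_zero]
    have key' (X : Fin (k + 1) → VField A) : koszulAlt α (Function.update X i (f • x)) =
        f * koszulAlt α (Function.update X i x) := by
      by_cases hi : i = 0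
      · rw [hi]; exact key X
      · have h (z : VField A) : koszulAlt α (Function.update X i z) =
            -koszulAlt α (Function.update (X ∘ Equiv.swap i 0) 0 z) := by
          rw [← (koszulAlt α).map_swap _ hi]
          congr 1
          ext l : 1
          simp only [Function.comp_apply, Function.update_apply]
          by_cases h1 : l = i
          · subst h1; simp
          · by_cases h2 : l = 0
            · subst h2; simp [hi, h1]
            · simp [h1, h2, Equiv.swap_apply_of_ne_of_ne h1 h2]
        rw [h, h, key]; ring
    rw [smul_eq_mul]
    convert key' X
  map_eq_zero_of_eq' X i j h hij := by
    rw [← koszulAlt_apply]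
    exact (koszulAlt α).map_eq_zero_of_eq X h hij

theorem koszul_add {k : ℕ} (α β : Form A k) (X : Fin (k + 1) → VField A) :
    koszul (α + β) X = koszul α X + koszul β X := by
  match k, α, β with
  | 0, α, β => simp [koszul]
  | k + 1, α, β =>
    simp only [koszul, AlternatingMap.add_apply, map_add, mul_add, Finset.sum_add_distrib]
    ring

theorem koszul_smul {k : ℕ} (c : ℝ) (α : Form A k) (X : Fin (k + 1) → VField A) :
    koszul (c • α) X = c • koszul α X := by
  match k, α with
  | 0, α => simp [koszul]
  | k + 1, α =>
    simp only [koszul, AlternatingMap.smul_apply, Derivation.map_smul, mul_smul_comm,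
      smul_sub, Finset.smul_sum]

/-- The exterior derivative `d : Ω^k → Ω^(k+1)`. -/
def d (k : ℕ) : Form A k →ₗ[ℝ] Form A (k + 1) where
  toFun := koszulForm
  map_add' α β := by ext X; exact koszul_add α β X
  map_smul' c α := by ext X; exact koszul_smul c α X

end Koszul

section Blocks

/-- The splitting of `{0, …, n-1}` into the first `k` and the last `l` indices, `k + l = n`. -/
def blocks {k l n : ℕ} (h : k + l = n) : Fin k ⊕ Fin l ≃ Fin n :=
  finSumFinEquiv.trans (finCongr h)

/-- The wedge product `(a ∧ b)(v) = 1/(k! l!) ∑_s sgn(s) a(v_{s 0}, …) b(v_{s k}, …)`, the sum being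
over all permutations `s` of the `n = k + l` arguments; so
`(X ∧ Y)(α, β) = α(X) β(Y) - α(Y) β(X)`. -/
def wedge {R S M : Type*} [CommRing R] [CommRing S] [Algebra R S] [Algebra ℝ S]
    [SMulCommClass R ℝ S] [AddCommGroup M] [Module R M] {k l n : ℕ} (h : k + l = n)
    (a : M [⋀^Fin k]→ₗ[R] S) (b : M [⋀^Fin l]→ₗ[R] S) : M [⋀^Fin n]→ₗ[R] S :=
  ((k.factorial * l.factorial : ℝ)⁻¹) • MultilinearMap.alternatization
    (((LinearMap.mul' R S).compMultilinearMap
      (a.toMultilinearMap.domCoprod b.toMultilinearMap)).domDomCongr (blocks h))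

theorem wedge_apply {R S M : Type*} [CommRing R] [CommRing S] [Algebra R S] [Algebra ℝ S]
    [SMulCommClass R ℝ S] [AddCommGroup M] [Module R M] {k l n : ℕ} (h : k + l = n)
    (a : M [⋀^Fin k]→ₗ[R] S) (b : M [⋀^Fin l]→ₗ[R] S) (v : Fin n → M) :
    wedge h a b v = ((k.factorial * l.factorial : ℝ)⁻¹) •
      ∑ s : Equiv.Perm (Fin n), Equiv.Perm.sign s •
        (a (fun i => v (s (blocks h (.inl i)))) * b (fun j => v (s (blocks h (.inr j))))) := by
  rw [wedge, AlternatingMap.smul_apply, MultilinearMap.alternatization_apply]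
  rfl

end Blocks

section MultiVector
variable {A : Type*} [CommRing A] [Algebra ℝ A]

/-- `1/(q! (p-1)!) ∑_s sgn(s) P(Q(f_{s 0}, …, f_{s (q-1)}), f_{s q}, …, f_{s (n-1)})`
(zero when `p = 0`); equivalently the signed sum over `(q, p-1)`-shuffles. -/
def insertFirst : ∀ {p q n : ℕ}, p + q = n + 1 → A [⋀^Fin p]→ₗ[ℝ] A → A [⋀^Fin q]→ₗ[ℝ] A →
    A [⋀^Fin n]→ₗ[ℝ] A
  | 0, _, _, _, _, _ => 0
  | p + 1, q, n, h, P, Q =>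
    ((q.factorial * p.factorial : ℝ)⁻¹) • MultilinearMap.alternatization
      ((P.toMultilinearMap.curryLeft.compMultilinearMap Q.toMultilinearMap).uncurrySum.domDomCongr
        (blocks (show q + p = n by omega)))

/-- `1/((p-1)! q!) ∑_s sgn(s) P(f_{s 0}, …, f_{s (p-2)}, Q(f_{s (p-1)}, …, f_{s (n-1)}))`
(zero when `p = 0`); equivalently the signed sum over `(p-1, q)`-shuffles. -/
def insertLast : ∀ {p q n : ℕ}, p + q = n + 1 → A [⋀^Fin p]→ₗ[ℝ] A → A [⋀^Fin q]→ₗ[ℝ] A →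
    A [⋀^Fin n]→ₗ[ℝ] A
  | 0, _, _, _, _, _ => 0
  | p + 1, q, n, h, P, Q =>
    ((p.factorial * q.factorial : ℝ)⁻¹) • MultilinearMap.alternatization
      ((LinearMap.compMultilinearMap
        { toFun := fun g : A →ₗ[ℝ] A => g.compMultilinearMap Q.toMultilinearMap
          map_add' := fun _ _ => rfl
          map_smul' := fun _ _ => rfl } P.toMultilinearMap.curryRight).uncurrySum.domDomCongr
        (blocks (show p + q = n by omega)))

theorem insertFirst_apply {p q n : ℕ} (h : p + 1 + q = n + 1) (h' : q + p = n)
    (P : A [⋀^Fin (p + 1)]→ₗ[ℝ] A) (Q : A [⋀^Fin q]→ₗ[ℝ] A) (v : Fin n → A) :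
    insertFirst h P Q v = ((q.factorial * p.factorial : ℝ)⁻¹) •
      ∑ s : Equiv.Perm (Fin n), Equiv.Perm.sign s •
        P (Fin.cons (Q fun i => v (s (blocks h' (.inl i))))
          fun j => v (s (blocks h' (.inr j)))) := by
  rw [insertFirst, AlternatingMap.smul_apply, MultilinearMap.alternatization_apply]
  rfl

theorem insertLast_apply {p q n : ℕ} (h : p + 1 + q = n + 1) (h' : p + q = n)
    (P : A [⋀^Fin (p + 1)]→ₗ[ℝ] A) (Q : A [⋀^Fin q]→ₗ[ℝ] A) (v : Fin n → A) :
    insertLast h P Q v = ((p.factorial * q.factorial : ℝ)⁻¹) •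
      ∑ s : Equiv.Perm (Fin n), Equiv.Perm.sign s •
        P (Fin.snoc (fun i => v (s (blocks h' (.inl i))))
          (Q fun j => v (s (blocks h' (.inr j))))) := by
  rw [insertLast, AlternatingMap.smul_apply, MultilinearMap.alternatization_apply]
  rfl

/-- Auxiliary: the failure of the Leibniz rule in the argument `i`. -/
def defect {n : ℕ} (F : (Fin n → A) → A) (v : Fin n → A) (i : Fin n) (f g : A) : A :=
  F (Function.update v i (f * g)) -
    (f * F (Function.update v i g) + g * F (Function.update v i f))

/-- The alternating `k`-derivations of `A`, a module over `A`. -/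
def multiDer (A : Type*) [CommRing A] [Algebra ℝ A] (k : ℕ) :
    Submodule A (A [⋀^Fin k]→ₗ[ℝ] A) where
  carrier := {P | ∀ (v : Fin k → A) (i : Fin k) (f g : A),
    P (Function.update v i (f * g)) =
      f * P (Function.update v i g) + g * P (Function.update v i f)}
  add_mem' := by
    intro P Q hP hQ v i f g
    simp only [AlternatingMap.add_apply, hP v i f g, hQ v i f g]
    ring
  zero_mem' := by intro v i f g; simp
  smul_mem' := by
    intro c P hP v i f g
    simp only [AlternatingMap.smul_apply, hP v i f g, smul_eq_mul]
    ring

/-- `k`-vectors: skew-symmetric `k`-derivations of `C^∞(M)`. A `k`-vector `P` is given through its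
values `P(f₁, …, f_k) = P(df₁, …, df_k)` on exact `1`-forms, which determine it. -/
def MultiVector (A : Type*) [CommRing A] [Algebra ℝ A] (k : ℕ) : Type _ := multiDer A k

/-- The `k`-vector given by an alternating `k`-derivation. -/
def mkMV {k : ℕ} (P : A [⋀^Fin k]→ₗ[ℝ] A) (hP : P ∈ multiDer A k) : MultiVector A k :=
  ⟨P, hP⟩

instance instTower (k : ℕ) : IsScalarTower ℝ A (A [⋀^Fin k]→ₗ[ℝ] A) :=
  ⟨fun c f P => by ext v; exact smul_assoc c f (P v)⟩

instance instMVAdd (k : ℕ) : AddCommGroup (MultiVector A k) :=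
  (inferInstance : AddCommGroup (multiDer A k))

instance instMVMod (k : ℕ) : Module A (MultiVector A k) :=
  (inferInstance : Module A (multiDer A k))

instance instMVModReal (k : ℕ) : Module ℝ (MultiVector A k) :=
  (inferInstance : Module ℝ (multiDer A k))

instance instMVTower (k : ℕ) : IsScalarTower ℝ A (MultiVector A k) :=
  ⟨fun c f P => Subtype.ext (smul_assoc c f P.1)⟩

theorem mem_iff_defect {k : ℕ} {P : A [⋀^Fin k]→ₗ[ℝ] A} :
    P ∈ multiDer A k ↔ ∀ v i f g, defect P v i f g = 0 := by
  simp only [defect, sub_eq_zero]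
  rfl

theorem update_block_inl {A : Type*} {k l n : ℕ} (σ : Fin k ⊕ Fin l ≃ Fin n) (v : Fin n → A) (x : A)
    (a : Fin k) :
    (fun i => Function.update v (σ (.inl a)) x (σ (.inl i))) =
      Function.update (fun i => v (σ (.inl i))) a x ∧
    (fun j => Function.update v (σ (.inl a)) x (σ (.inr j))) = fun j => v (σ (.inr j)) := by
  constructor <;> ext i <;> simp [Function.update_apply]

theorem update_block_inr {A : Type*} {k l n : ℕ} (σ : Fin k ⊕ Fin l ≃ Fin n) (v : Fin n → A) (x : A)
    (a : Fin l) :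
    (fun i => Function.update v (σ (.inr a)) x (σ (.inl i))) = (fun i => v (σ (.inl i))) ∧
    (fun j => Function.update v (σ (.inr a)) x (σ (.inr j))) =
      Function.update (fun j => v (σ (.inr j))) a x := by
  constructor <;> ext i <;> simp [Function.update_apply]

theorem wedge_mem {k l n : ℕ} (h : k + l = n) {P : A [⋀^Fin k]→ₗ[ℝ] A} {Q : A [⋀^Fin l]→ₗ[ℝ] A}
    (hP : P ∈ multiDer A k) (hQ : Q ∈ multiDer A l) : wedge h P Q ∈ multiDer A n := by
  intro v i f g
  simp only [wedge_apply, mul_smul_comm, Finset.mul_sum, ← smul_add, ← Finset.sum_add_distrib]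
  congr 1
  refine Finset.sum_congr rfl fun s _ => ?_
  congr 1
  obtain ⟨c, rfl⟩ := ((blocks h).trans s).surjective i
  have h1 (x : Fin k ⊕ Fin l) : s (blocks h x) = ((blocks h).trans s) x := rfl
  simp only [h1]
  rcases c with a | b
  · simp only [(update_block_inl ((blocks h).trans s) v _ a).1,
      (update_block_inl ((blocks h).trans s) v _ a).2]
    rw [hP _ a f g]; ring
  · simp only [(update_block_inr ((blocks h).trans s) v _ b).1,
      (update_block_inr ((blocks h).trans s) v _ b).2]
    rw [hQ _ b f g]; ring

/-- Auxiliary: in a signed sum over permutations, an argument fixed in one position of an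
alternating block may be moved to any other position of that block. -/
theorem sum_block {r t n : ℕ} (E : Fin r ⊕ Fin t ≃ Fin n) (K : A [⋀^Fin r]→ₗ[ℝ] A)
    (H : (Fin t → A) → A) (w : Fin n → A) (i : Fin n) (x : A) (a b : Fin r) :
    (∑ s : Equiv.Perm (Fin n), if s (E (.inl a)) = i then Equiv.Perm.sign s •
      (K (Function.update (fun l => w (s (E (.inl l)))) a x) * H fun j => w (s (E (.inr j))))
      else 0) =
    ∑ s : Equiv.Perm (Fin n), if s (E (.inl b)) = i then Equiv.Perm.sign s •
      (K (Function.update (fun l => w (s (E (.inl l)))) b x) * H fun j => w (s (E (.inr j))))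
      else 0 := by
  by_cases hab : a = b
  · rw [hab]
  rw [← Equiv.sum_comp (Equiv.mulRight (Equiv.swap (E (.inl a)) (E (.inl b))))]
  refine Finset.sum_congr rfl fun s _ => ?_
  have hE : E (.inl a) ≠ E (.inl b) := by simpa using hab
  simp only [Equiv.coe_mulRight, Equiv.Perm.coe_mul, Function.comp_apply, Equiv.swap_apply_left]
  by_cases hs : s (E (.inl b)) = i
  · rw [if_pos hs, if_pos hs, Equiv.Perm.sign_mul, Equiv.Perm.sign_swap hE]
    have h1 : (fun j => w (s (Equiv.swap (E (.inl a)) (E (.inl b)) (E (.inr j))))) =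
        fun j => w (s (E (.inr j))) := by
      ext j; rw [Equiv.swap_apply_of_ne_of_ne (by simp) (by simp)]
    have h2 : Function.update
        (fun l => w (s (Equiv.swap (E (.inl a)) (E (.inl b)) (E (.inl l))))) a x =
        Function.update (fun l => w (s (E (.inl l)))) b x ∘ Equiv.swap a b := by
      ext l
      simp only [Function.comp_apply, Function.update_apply]
      by_cases h1 : l = a
      · subst h1; simp
      · by_cases h2 : l = b
        · subst h2; simp [hab, Ne.symm hab]
        · rw [Equiv.swap_apply_of_ne_of_ne (by simpa using h1) (by simpa using h2),
            Equiv.swap_apply_of_ne_of_ne h1 h2]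
          simp [h1, h2]
    rw [h1, h2, K.map_swap _ hab]
    simp
  · rw [if_neg hs, if_neg hs]

theorem defect_smul_sum {n : ℕ} {ι : Type*} [Fintype ι] (c : ℝ) (ε : ι → ℤˣ)
    (F : ι → (Fin n → A) → A) (v : Fin n → A) (i : Fin n) (f g : A) :
    defect (fun v => c • ∑ s, ε s • F s v) v i f g = c • ∑ s, ε s • defect (F s) v i f g := by
  simp only [defect, mul_smul_comm, Finset.mul_sum, ← smul_add, ← Finset.sum_add_distrib,
    ← smul_sub, ← Finset.sum_sub_distrib]


/-- Auxiliary: the cross terms in the Leibniz rule for `insertFirst` and `insertLast`. -/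
def crossSum {p q n : ℕ} (h : q + 1 + p = n) (P : A [⋀^Fin (p + 1)]→ₗ[ℝ] A)
    (Q : A [⋀^Fin (q + 1)]→ₗ[ℝ] A) (v : Fin n → A) (i : Fin n) (f g : A) : A :=
  ∑ s : Equiv.Perm (Fin n), if s (blocks h (.inl (Fin.last q))) = i then Equiv.Perm.sign s •
    (Q (Function.update (fun l => v (s (blocks h (.inl l)))) (Fin.last q) g) *
      P (Fin.cons f fun j => v (s (blocks h (.inr j))))) else 0

theorem defect_insertFirst {p q n : ℕ} (h : p + 1 + (q + 1) = n + 1) (h' : q + 1 + p = n)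
    {P : A [⋀^Fin (p + 1)]→ₗ[ℝ] A} {Q : A [⋀^Fin (q + 1)]→ₗ[ℝ] A}
    (hP : P ∈ multiDer A (p + 1)) (hQ : Q ∈ multiDer A (q + 1))
    (v : Fin n → A) (i : Fin n) (f g : A) :
    defect (insertFirst h P Q) v i f g = ((q.factorial * p.factorial : ℝ)⁻¹) •
      (crossSum h' P Q v i f g + crossSum h' P Q v i g f) := by
  have e : (⇑(insertFirst h P Q) : (Fin n → A) → A) = fun v =>
      (((q + 1).factorial * p.factorial : ℝ)⁻¹) •
      ∑ s : Equiv.Perm (Fin n), Equiv.Perm.sign s •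
        P (Fin.cons (Q fun i => v (s (blocks h' (.inl i))))
          fun j => v (s (blocks h' (.inr j)))) := by
    ext v; exact insertFirst_apply h h' P Q v
  have hd (s : Equiv.Perm (Fin n)) : Equiv.Perm.sign s •
      defect (fun v : Fin n → A => P (Fin.cons (Q fun i => v (s (blocks h' (.inl i))))
          fun j => v (s (blocks h' (.inr j))))) v i f g =
      ∑ a : Fin (q + 1), ((if s (blocks h' (.inl a)) = i then Equiv.Perm.sign s •
        (Q (Function.update (fun l => v (s (blocks h' (.inl l)))) a g) *
          P (Fin.cons f fun j => v (s (blocks h' (.inr j))))) else 0) +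
        (if s (blocks h' (.inl a)) = i then Equiv.Perm.sign s •
        (Q (Function.update (fun l => v (s (blocks h' (.inl l)))) a f) *
          P (Fin.cons g fun j => v (s (blocks h' (.inr j))))) else 0)) := by
    obtain ⟨c, rfl⟩ := ((blocks h').trans s).surjective i
    have h1 (x : Fin (q + 1) ⊕ Fin p) : s (blocks h' x) = ((blocks h').trans s) x := rfl
    have hP0 (y : Fin p → A) (a b : A) : P (Fin.cons (a * b) y : Fin (p + 1) → A) =
        a * P (Fin.cons b y : Fin (p + 1) → A) + b * P (Fin.cons a y : Fin (p + 1) → A) := by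
      simpa using hP (Fin.cons 0 y) 0 a b
    have hPadd (y : Fin p → A) (a b : A) : P (Fin.cons (a + b) y : Fin (p + 1) → A) =
        P (Fin.cons a y : Fin (p + 1) → A) + P (Fin.cons b y : Fin (p + 1) → A) :=
      P.map_vecCons_add y a b
    simp only [defect, h1]
    rcases c with a | b
    · simp only [(update_block_inl ((blocks h').trans s) v _ a).1,
        (update_block_inl ((blocks h').trans s) v _ a).2]
      simp only [EmbeddingLike.apply_eq_iff_eq, Sum.inl.injEq, Finset.sum_add_distrib,
        Finset.sum_ite_eq', Finset.mem_univ, if_true, ← smul_add]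
      rw [hQ _ a f g, hPadd, hP0, hP0]
      congr 1
      ring
    · simp only [(update_block_inr ((blocks h').trans s) v _ b).1,
        (update_block_inr ((blocks h').trans s) v _ b).2]
      have hb (x : A) (y : Fin p → A) (z : A) :
          (Fin.cons z (Function.update y b x) : Fin (p + 1) → A) =
            Function.update (Fin.cons z y : Fin (p + 1) → A) b.succ x := by
        rw [Fin.cons_update]
      simp only [hb]
      rw [hP _ b.succ f g]
      simp
  rw [e, defect_smul_sum]
  simp only [hd]
  rw [Finset.sum_comm]
  simp only [Finset.sum_add_distrib]
  have hs (x y : A) : (∑ a : Fin (q + 1), ∑ s : Equiv.Perm (Fin n),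
      if s (blocks h' (.inl a)) = i then Equiv.Perm.sign s •
        (Q (Function.update (fun l => v (s (blocks h' (.inl l)))) a x) *
          P (Fin.cons y fun j => v (s (blocks h' (.inr j))))) else 0) =
      ((q + 1 : ℕ) : ℝ) • crossSum h' P Q v i y x := by
    rw [Finset.sum_congr rfl fun a _ => sum_block (blocks h') Q
      (fun u => P (Fin.cons y u)) v i x a (Fin.last q)]
    rw [Finset.sum_const, Finset.card_univ, Fintype.card_fin, Nat.cast_smul_eq_nsmul]
    rfl
  rw [hs, hs, ← smul_add, smul_smul, Nat.factorial_succ]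
  congr 1
  have : ((q + 1 : ℕ) : ℝ) ≠ 0 := by positivity
  push_cast at this ⊢
  field_simp

theorem defect_insertLast {p q n : ℕ} (h : q + 1 + (p + 1) = n + 1) (h' : q + 1 + p = n)
    {P : A [⋀^Fin (p + 1)]→ₗ[ℝ] A} {Q : A [⋀^Fin (q + 1)]→ₗ[ℝ] A}
    (hP : P ∈ multiDer A (p + 1)) (hQ : Q ∈ multiDer A (q + 1))
    (v : Fin n → A) (i : Fin n) (f g : A) :
    defect (insertLast h Q P) v i f g = ((q.factorial * p.factorial : ℝ)⁻¹) •
      (crossSum h' P Q v i f g + crossSum h' P Q v i g f) := by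
  have h2 : q + (p + 1) = n := by omega
  have e : (⇑(insertLast h Q P) : (Fin n → A) → A) = fun v =>
      ((q.factorial * (p + 1).factorial : ℝ)⁻¹) •
      ∑ s : Equiv.Perm (Fin n), Equiv.Perm.sign s •
        Q (Fin.snoc (fun i => v (s (blocks h2 (.inl i))))
          (P fun j => v (s (blocks h2 (.inr j))))) := by
    ext v; exact insertLast_apply h h2 Q P v
  let E := (Equiv.sumComm _ _).trans (blocks h2)
  have hd (s : Equiv.Perm (Fin n)) : Equiv.Perm.sign s •
      defect (fun v : Fin n → A => Q (Fin.snoc (fun i => v (s (blocks h2 (.inl i))))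
          (P fun j => v (s (blocks h2 (.inr j)))))) v i f g =
      ∑ a : Fin (p + 1), ((if s (E (.inl a)) = i then Equiv.Perm.sign s •
        (P (Function.update (fun l => v (s (E (.inl l)))) a f) *
          Q (Fin.snoc (fun j => v (s (E (.inr j)))) g)) else 0) +
        (if s (E (.inl a)) = i then Equiv.Perm.sign s •
        (P (Function.update (fun l => v (s (E (.inl l)))) a g) *
          Q (Fin.snoc (fun j => v (s (E (.inr j)))) f)) else 0)) := by
    obtain ⟨c, rfl⟩ := (E.trans s).surjective i
    have h1 (x : Fin (p + 1) ⊕ Fin q) : s (E x) = (E.trans s) x := rfl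
    have h3 (x : Fin (p + 1)) : s (blocks h2 (.inr x)) = (E.trans s) (.inl x) := rfl
    have h4 (x : Fin q) : s (blocks h2 (.inl x)) = (E.trans s) (.inr x) := rfl
    have hsn (y : Fin q → A) (a : A) : (Fin.snoc y a : Fin (q + 1) → A) =
        Function.update (Fin.snoc y 0 : Fin (q + 1) → A) (Fin.last q) a := by
      rw [Fin.update_snoc_last]
    have hQ0 (y : Fin q → A) (a b : A) : Q (Fin.snoc y (a * b) : Fin (q + 1) → A) =
        a * Q (Fin.snoc y b : Fin (q + 1) → A) + b * Q (Fin.snoc y a : Fin (q + 1) → A) := by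
      rw [hsn y (a * b), hsn y a, hsn y b]
      exact hQ (Fin.snoc y 0) (Fin.last q) a b
    have hQadd (y : Fin q → A) (a b : A) : Q (Fin.snoc y (a + b) : Fin (q + 1) → A) =
        Q (Fin.snoc y a : Fin (q + 1) → A) + Q (Fin.snoc y b : Fin (q + 1) → A) := by
      rw [hsn y (a + b), hsn y a, hsn y b, Q.map_update_add]
    simp only [defect, h1, h3, h4]
    rcases c with a | b
    · simp only [(update_block_inl (E.trans s) v _ a).1,
        (update_block_inl (E.trans s) v _ a).2]
      simp only [EmbeddingLike.apply_eq_iff_eq, Sum.inl.injEq, Finset.sum_add_distrib,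
        Finset.sum_ite_eq', Finset.mem_univ, if_true, ← smul_add]
      rw [hP _ a f g, hQadd, hQ0, hQ0]
      congr 1
      ring
    · simp only [(update_block_inr (E.trans s) v _ b).1,
        (update_block_inr (E.trans s) v _ b).2]
      have hb (x : A) (y : Fin q → A) (z : A) :
          (Fin.snoc (Function.update y b x) z : Fin (q + 1) → A) =
            Function.update (Fin.snoc y z : Fin (q + 1) → A) b.castSucc x := by
        rw [Fin.snoc_update]
      simp only [hb]
      rw [hQ _ b.castSucc f g]
      simp
  rw [e, defect_smul_sum]
  simp only [hd]
  rw [Finset.sum_comm]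
  simp only [Finset.sum_add_distrib]
  have hs (x y : A) : (∑ a : Fin (p + 1), ∑ s : Equiv.Perm (Fin n),
      if s (E (.inl a)) = i then Equiv.Perm.sign s •
        (P (Function.update (fun l => v (s (E (.inl l)))) a x) *
          Q (Fin.snoc (fun j => v (s (E (.inr j)))) y)) else 0) =
      ((p + 1 : ℕ) : ℝ) • crossSum h' P Q v i x y := by
    rw [Finset.sum_congr rfl fun a _ => sum_block E P
      (fun u => Q (Fin.snoc u y)) v i x a 0]
    rw [Finset.sum_const, Finset.card_univ, Fintype.card_fin, Nat.cast_smul_eq_nsmul]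
    congr 1
    refine Finset.sum_congr rfl fun s _ => ?_
    have c0 : E (.inl 0) = blocks h' (.inl (Fin.last q)) := by
      ext; simp [E, blocks]
    have c1 (j : Fin q) : E (.inr j) = blocks h' (.inl j.castSucc) := by
      ext; simp [E, blocks]
    have c2 (j : Fin p) : E (.inl j.succ) = blocks h' (.inr j) := by
      ext; simp [E, blocks]; omega
    have u1 : Function.update (fun l => v (s (E (.inl l)))) 0 x =
        (Fin.cons x fun j => v (s (blocks h' (.inr j))) : Fin (p + 1) → A) := by
      ext l
      refine Fin.cases ?_ (fun l => ?_) l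
      · simp
      · simp [c2]
    have u2 : (Fin.snoc (fun j => v (s (E (.inr j)))) y : Fin (q + 1) → A) =
        Function.update (fun l => v (s (blocks h' (.inl l)))) (Fin.last q) y := by
      ext l
      refine Fin.lastCases ?_ (fun l => ?_) l
      · simp
      · simp [c1]
    rw [c0, u1, u2, mul_comm]
  rw [hs, hs, ← smul_add, smul_smul, Nat.factorial_succ]
  congr 1
  have : ((p + 1 : ℕ) : ℝ) ≠ 0 := by positivity
  push_cast at this ⊢
  field_simp

theorem insertFirst_mem_zero {p n : ℕ} (h : p + 0 = n + 1)
    {P : A [⋀^Fin p]→ₗ[ℝ] A} {Q : A [⋀^Fin 0]→ₗ[ℝ] A} (hP : P ∈ multiDer A p) :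
    insertFirst h P Q ∈ multiDer A n := by
  match p, h, P, hP with
  | p + 1, h, P, hP =>
    have h' : 0 + p = n := by omega
    intro v i f g
    simp only [insertFirst_apply h h', mul_smul_comm, Finset.mul_sum, ← smul_add,
      ← Finset.sum_add_distrib]
    congr 1
    refine Finset.sum_congr rfl fun s _ => ?_
    congr 1
    obtain ⟨c, rfl⟩ := ((blocks h').trans s).surjective i
    have h1 (x : Fin 0 ⊕ Fin p) : s (blocks h' x) = ((blocks h').trans s) x := rfl
    simp only [h1]
    rcases c with a | b
    · exact a.elim0
    · simp only [(update_block_inr ((blocks h').trans s) v _ b).1,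
        (update_block_inr ((blocks h').trans s) v _ b).2, Fin.cons_update]
      exact hP _ b.succ f g

theorem insertLast_mem_zero {q n : ℕ} (h : q + 0 = n + 1)
    {P : A [⋀^Fin 0]→ₗ[ℝ] A} {Q : A [⋀^Fin q]→ₗ[ℝ] A} (hQ : Q ∈ multiDer A q) :
    insertLast h Q P ∈ multiDer A n := by
  match q, h, Q, hQ with
  | q + 1, h, Q, hQ =>
    have h' : q + 0 = n := by omega
    intro v i f g
    simp only [insertLast_apply h h', mul_smul_comm, Finset.mul_sum, ← smul_add,
      ← Finset.sum_add_distrib]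
    congr 1
    refine Finset.sum_congr rfl fun s _ => ?_
    congr 1
    obtain ⟨c, rfl⟩ := ((blocks h').trans s).surjective i
    have h1 (x : Fin q ⊕ Fin 0) : s (blocks h' x) = ((blocks h').trans s) x := rfl
    simp only [h1]
    rcases c with a | b
    · simp only [(update_block_inl ((blocks h').trans s) v _ a).1,
        (update_block_inl ((blocks h').trans s) v _ a).2, Fin.snoc_update]
      exact hQ _ a.castSucc f g
    · exact b.elim0

/-- The Schouten-Nijenhuis bracket of a `p`-vector and a `q`-vector as an alternating map,
`[P, Q] = (-1)^((p-1)q) (P ∘ Q - (-1)^((p-1)(q-1)) Q ∘ P)`, where `P ∘ Q` is the insertion of `Q`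
in the first argument of `P` (moving the inserted argument of `Q` from the first to the last place,
as is done here, absorbs the inner sign). The sign convention is the one with `[X, Q] = L_X Q`,
`[P, Q] = (-1)^(pq) [Q, P]` and `[P, Q ∧ R] = [P, Q] ∧ R + (-1)^(pq+q) Q ∧ [P, R]`; on
decomposable multivectors it is
`[X₁ ∧ ⋯ ∧ X_p, Y₁ ∧ ⋯ ∧ Y_q] = (-1)^(p+1) ∑ (-1)^(i+j) [X_i, Y_j] ∧ X₁ ∧ ⋯ X̂_i ⋯ ∧ Y₁ ∧ ⋯ Ŷ_j ⋯`.
For a `2`-vector `P` and a function `f`, `[P, f] = P(df, ·)`. -/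
def schoutenAlt {p q n : ℕ} (h : p + q = n + 1) (P : A [⋀^Fin p]→ₗ[ℝ] A)
    (Q : A [⋀^Fin q]→ₗ[ℝ] A) : A [⋀^Fin n]→ₗ[ℝ] A :=
  ((-1) ^ ((p + 1) * q) : ℝ) •
    (insertFirst h P Q - insertLast (show q + p = n + 1 by omega) Q P)

theorem schoutenAlt_mem {p q n : ℕ} (h : p + q = n + 1) {P : A [⋀^Fin p]→ₗ[ℝ] A}
    {Q : A [⋀^Fin q]→ₗ[ℝ] A} (hP : P ∈ multiDer A p) (hQ : Q ∈ multiDer A q) :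
    schoutenAlt h P Q ∈ multiDer A n := by
  have key : insertFirst h P Q - insertLast (show q + p = n + 1 by omega) Q P ∈
      multiDer A n := by
    match p, q, h, P, Q, hP, hQ with
    | 0, 0, h, P, Q, hP, hQ => omega
    | 0, q + 1, h, P, Q, hP, hQ =>
      exact Submodule.sub_mem _ (Submodule.zero_mem _) (insertLast_mem_zero _ hQ)
    | p + 1, 0, h, P, Q, hP, hQ =>
      exact Submodule.sub_mem _ (insertFirst_mem_zero _ hP) (Submodule.zero_mem _)
    | p + 1, q + 1, h, P, Q, hP, hQ =>
      have h' : q + 1 + p = n := by omega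
      rw [mem_iff_defect]
      intro v i f g
      have e := (defect_insertFirst h h' hP hQ v i f g).trans
        (defect_insertLast (by omega) h' hP hQ v i f g).symm
      simp only [defect, AlternatingMap.sub_apply] at e ⊢
      linear_combination e
  intro v i f g
  simp only [schoutenAlt, AlternatingMap.smul_apply, key v i f g, smul_add, mul_smul_comm]

theorem insertFirst_add {p q n : ℕ} (h : p + q = n + 1) (P : A [⋀^Fin p]→ₗ[ℝ] A)
    (Q Q' : A [⋀^Fin q]→ₗ[ℝ] A) :
    insertFirst h P (Q + Q') = insertFirst h P Q + insertFirst h P Q' := by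
  match p, h, P with
  | 0, h, P => simp [insertFirst]
  | p + 1, h, P =>
    ext v
    have hP (y : Fin p → A) (a b : A) : P (Fin.cons (a + b) y : Fin (p + 1) → A) =
        P (Fin.cons a y : Fin (p + 1) → A) + P (Fin.cons b y : Fin (p + 1) → A) :=
      P.map_vecCons_add y a b
    simp only [insertFirst_apply h (show q + p = n by omega), AlternatingMap.add_apply, hP,
      smul_add, Finset.sum_add_distrib]

theorem insertFirst_smul {p q n : ℕ} (h : p + q = n + 1) (P : A [⋀^Fin p]→ₗ[ℝ] A)
    (c : ℝ) (Q : A [⋀^Fin q]→ₗ[ℝ] A) :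
    insertFirst h P (c • Q) = c • insertFirst h P Q := by
  match p, h, P with
  | 0, h, P => simp [insertFirst]
  | p + 1, h, P =>
    ext v
    have hP (y : Fin p → A) (a : A) : P (Fin.cons (c • a) y : Fin (p + 1) → A) =
        c • P (Fin.cons a y : Fin (p + 1) → A) := P.map_vecCons_smul y c a
    simp only [insertFirst_apply h (show q + p = n by omega), AlternatingMap.smul_apply, hP,
      smul_comm _ c, ← Finset.smul_sum]

theorem insertLast_add {p q n : ℕ} (h : q + p = n + 1) (P : A [⋀^Fin p]→ₗ[ℝ] A)
    (Q Q' : A [⋀^Fin q]→ₗ[ℝ] A) :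
    insertLast h (Q + Q') P = insertLast h Q P + insertLast h Q' P := by
  match q, h, Q, Q' with
  | 0, h, Q, Q' => simp [insertLast]
  | q + 1, h, Q, Q' =>
    ext v
    simp only [insertLast_apply h (show q + p = n by omega), AlternatingMap.add_apply,
      smul_add, Finset.sum_add_distrib]

theorem insertLast_smul {p q n : ℕ} (h : q + p = n + 1) (P : A [⋀^Fin p]→ₗ[ℝ] A)
    (c : ℝ) (Q : A [⋀^Fin q]→ₗ[ℝ] A) :
    insertLast h (c • Q) P = c • insertLast h Q P := by
  match q, h, Q with
  | 0, h, Q => simp [insertLast]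
  | q + 1, h, Q =>
    ext v
    simp only [insertLast_apply h (show q + p = n by omega), AlternatingMap.smul_apply,
      smul_comm _ c, ← Finset.smul_sum]

/-- The Schouten-Nijenhuis bracket `[P, Q]` of a `p`-vector `P` and a `q`-vector `Q`, a
`(p + q - 1)`-vector. -/
def schouten {p q n : ℕ} (h : p + q = n + 1) (P : MultiVector A p) :
    MultiVector A q →ₗ[ℝ] MultiVector A n where
  toFun Q := mkMV (schoutenAlt h P.1 Q.1) (schoutenAlt_mem h P.2 Q.2)
  map_add' Q Q' := by
    refine Subtype.ext ?_
    change schoutenAlt h P.1 (Q.1 + Q'.1) = schoutenAlt h P.1 Q.1 + schoutenAlt h P.1 Q'.1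
    simp only [schoutenAlt, insertFirst_add, insertLast_add]
    module
  map_smul' c Q := by
    refine Subtype.ext ?_
    change schoutenAlt h P.1 (c • Q.1) = c • schoutenAlt h P.1 Q.1
    simp only [schoutenAlt, insertFirst_smul, insertLast_smul]
    module

/-- The wedge product `P ∧ Q` of multivectors. -/
def wedgeMV {k l n : ℕ} (h : k + l = n) (P : MultiVector A k) :
    MultiVector A l →ₗ[A] MultiVector A n where
  toFun Q := mkMV (wedge h P.1 Q.1) (wedge_mem h P.2 Q.2)
  map_add' Q Q' := by
    refine Subtype.ext ?_
    change wedge h P.1 (Q.1 + Q'.1) = wedge h P.1 Q.1 + wedge h P.1 Q'.1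
    ext v
    simp only [wedge_apply, AlternatingMap.add_apply, mul_add, smul_add, Finset.sum_add_distrib]
  map_smul' c Q := by
    refine Subtype.ext ?_
    change wedge h P.1 (c • Q.1) = c • wedge h P.1 Q.1
    ext v
    simp only [wedge_apply, AlternatingMap.smul_apply, smul_eq_mul,
      mul_smul_comm, Finset.mul_sum, mul_left_comm _ c]

/-- A vector field as a `1`-vector, `X(df) = X f`. -/
def ofVField (X : VField A) : MultiVector A 1 :=
  mkMV (AlternatingMap.ofSubsingleton ℝ A A (0 : Fin 1) X.toLinearMap) (by
    intro v i f g
    obtain rfl := Fin.fin_one_eq_zero i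
    simp [AlternatingMap.ofSubsingleton])

/-- `f ↦ #(df)`, where `(#(df))(dg) = P(df, dg)`. -/
def sharpFun (P : MultiVector A 2) : A →ₗ[ℝ] VField A where
  toFun f :=
    have h1 (z : A) : Function.update ![f, 0] 1 z = ![f, z] := by
      ext i; fin_cases i <;> rfl
    Derivation.mk'
    { toFun := fun g => P.1 ![f, g]
      map_add' := fun g g' => by
        have := P.1.map_update_add ![f, 0] 1 g g'
        simpa only [h1] using this
      map_smul' := fun c g => by
        have := P.1.map_update_smul ![f, 0] 1 c g
        simpa only [h1, RingHom.id_apply] using this }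
    (fun g g' => by
      have := P.2 ![f, 0] 1 g g'
      simp only [h1] at this
      exact this)
  map_add' f f' := by
    ext g
    exact P.1.map_vecCons_add ![g] f f'
  map_smul' c f := by
    ext g
    exact P.1.map_vecCons_smul ![g] c f

theorem sharpFun_mul (P : MultiVector A 2) (f g : A) :
    sharpFun P (f * g) = f • sharpFun P g + g • sharpFun P f := by
  ext x
  have := P.2 ![0, x] 0 f g
  have h1 (z : A) : Function.update ![0, x] 0 z = ![z, x] := by
    ext i; fin_cases i <;> rfl
  simp only [h1] at this
  exact this

theorem compLinearMap_mem {k : ℕ} (α : Form A k) (T : A →ₗ[ℝ] VField A)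
    (hT : ∀ f g, T (f * g) = f • T g + g • T f) :
    (realAlt α).compLinearMap T ∈ multiDer A k := by
  intro v i f g
  have h (x : A) : (fun j => T (Function.update v i x j)) =
      Function.update (fun j => T (v j)) i (T x) := by
    ext1 j
    exact Function.apply_update (fun _ => T) v i x j
  simp only [AlternatingMap.compLinearMap_apply, realAlt_apply, h, hT, α.map_update_add,
    α.map_update_smul, smul_eq_mul]

/-- The homomorphism `# : Ω^k → 𝒱^k` of a `2`-vector `P`:
`(#α)(df₁, …, df_k) = (-1)^k α(#(df₁), …, #(df_k))` (so `# f = f` for functions). -/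
def sharp (P : MultiVector A 2) (k : ℕ) : Form A k →ₗ[A] MultiVector A k where
  toFun α := ((-1) ^ k : ℝ) •
    mkMV ((realAlt α).compLinearMap (sharpFun P)) (compLinearMap_mem α _ (sharpFun_mul P))
  map_add' α β := by rw [← smul_add]; rfl
  map_smul' f α := by rw [RingHom.id_apply, smul_comm]; rfl

/-- The interior product `i_X : Ω^(k+1) → Ω^k`. -/
def interior (X : VField A) (k : ℕ) : Form A (k + 1) →ₗ[A] Form A k where
  toFun α := α.curryLeft X
  map_add' _ _ := rfl
  map_smul' _ _ := rfl

end MultiVector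

section Shift

universe u

/-- The sequence `C^(k-1)`, with `C^(-1) = 0`. -/
def Prev (C : ℕ → Type u) : ℕ → Type u
  | 0 => PUnit
  | k + 1 => C k

instance instPrevAdd (C : ℕ → Type u) [∀ k, AddCommGroup (C k)] : ∀ k, AddCommGroup (Prev C k)
  | 0 => (inferInstance : AddCommGroup PUnit.{u + 1})
  | k + 1 => (inferInstance : AddCommGroup (C k))

instance instPrevMod (R : Type*) [Ring R] (C : ℕ → Type u) [∀ k, AddCommGroup (C k)] [∀ k, Module R (C k)] :
    ∀ k, Module R (Prev C k)
  | 0 => (inferInstance : Module R PUnit.{u + 1})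
  | k + 1 => (inferInstance : Module R (C k))

variable {R : Type*} [Ring R] {B C : ℕ → Type u} [∀ k, AddCommGroup (B k)] [∀ k, Module R (B k)]
  [∀ k, AddCommGroup (C k)] [∀ k, Module R (C k)]

/-- A family of maps `B^k → C^k`, shifted to `B^(k-1) → C^(k-1)`. -/
def prevMap (T : ∀ k, B k →ₗ[R] C k) : ∀ k, Prev B k →ₗ[R] Prev C k
  | 0 => 0
  | k + 1 => T k

/-- A family of maps `B^k → C^(k+1)`, written as `B^(k-1) → C^k`. -/
def raise (T : ∀ k, B k →ₗ[R] C (k + 1)) : ∀ k, Prev B k →ₗ[R] C k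
  | 0 => 0
  | k + 1 => T k

/-- A family of maps `B^(k+1) → C^k`, written as `B^k → C^(k-1)`. -/
def lower (T : ∀ k, B (k + 1) →ₗ[R] C k) : ∀ k, B k →ₗ[R] Prev C k
  | 0 => 0
  | k + 1 => T k

end Shift

section Complexes

universe u
variable {A : Type u} [CommRing A] [Algebra ℝ A]

/-- `Ω^k ⊕ Ω^(k-1)`. -/
abbrev PairForm (A : Type u) [CommRing A] [Algebra ℝ A] (k : ℕ) : Type u :=
  Form A k × Prev (Form A) k

/-- `𝒱^k ⊕ 𝒱^(k-1)`. -/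
abbrev PairMV (A : Type u) [CommRing A] [Algebra ℝ A] (k : ℕ) : Type u :=
  MultiVector A k × Prev (MultiVector A) k

/-- The exterior derivative of the shifted complex `Ω^(*-1)`, `d : Ω^(k-1) → Ω^k`. -/
def prevD (k : ℕ) : Prev (Form A) k →ₗ[ℝ] Prev (Form A) (k + 1) :=
  raise (R := ℝ) (B := Form A) (C := Form A) d k

/-- The differential `(α, β) ↦ (-dα, dβ)` of `(Ω^*, -d) ⊕ (Ω^(*-1), d)`. -/
def pairD (k : ℕ) : PairForm A k →ₗ[ℝ] PairForm A (k + 1) :=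
  LinearMap.prodMap (-d k) (prevD k)

/-- `P ↦ E ∧ P`. -/
def wedgeE (E : VField A) (k : ℕ) : MultiVector A k →ₗ[A] MultiVector A (k + 1) :=
  wedgeMV (Nat.add_comm 1 k) (ofVField E)

/-- The Lichnerowicz-Jacobi operator of `(P, E)` (with `P` the `2`-vector):
`σ(R, Q) = (-[P, R] + k E ∧ R + P ∧ Q, [P, Q] - (k-1) E ∧ Q + [E, R])`
for `R ∈ 𝒱^k` and `Q ∈ 𝒱^(k-1)`. -/
def sigma (P : MultiVector A 2) (E : VField A) (k : ℕ) :
    PairMV A k →ₗ[ℝ] PairMV A (k + 1) :=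
  LinearMap.prod
    ((-schouten (show 2 + k = k + 1 + 1 by omega) P +
        (k : ℝ) • (wedgeE E k).restrictScalars ℝ) ∘ₗ LinearMap.fst ℝ _ _ +
      raise (R := ℝ) (B := MultiVector A) (C := fun j => MultiVector A (j + 1))
        (fun j => (wedgeMV (show 2 + j = j + 1 + 1 by omega) P).restrictScalars ℝ) k ∘ₗ
          LinearMap.snd ℝ _ _)
    (raise (R := ℝ) (B := MultiVector A) (C := MultiVector A)
        (fun j => schouten (show 2 + j = j + 1 + 1 by omega) P -
          (j : ℝ) • (wedgeE E j).restrictScalars ℝ) k ∘ₗ LinearMap.snd ℝ _ _ +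
      schouten (show 1 + k = k + 1 by omega) (ofVField E) ∘ₗ LinearMap.fst ℝ _ _)

/-- `F̃^k(α, β) = (#α + E ∧ #β, -#(i_E α) + E ∧ #(i_E β))` for `α ∈ Ω^k`, `β ∈ Ω^(k-1)`. -/
def tildeF (P : MultiVector A 2) (E : VField A) (k : ℕ) : PairForm A k →ₗ[A] PairMV A k :=
  let V : ℕ → Type u := fun j => MultiVector A j
  let sharpInt (j : ℕ) : Form A j →ₗ[A] Prev V j :=
    prevMap (R := A) (B := Form A) (C := V) (sharp P) j ∘ₗ
      lower (R := A) (B := Form A) (C := Form A) (interior E) j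
  LinearMap.prod
    (sharp P k ∘ₗ LinearMap.fst A _ _ +
      raise (R := A) (B := Form A) (C := V) (fun j => wedgeE E j ∘ₗ sharp P j) k ∘ₗ
        LinearMap.snd A _ _)
    (-sharpInt k ∘ₗ LinearMap.fst A _ _ +
      prevMap (R := A) (B := Form A) (C := V)
        (fun j => raise (R := A) (B := V) (C := V) (wedgeE E) j ∘ₗ sharpInt j) k ∘ₗ
          LinearMap.snd A _ _)

end Complexes

section Cohomology

universe u
variable {C : ℕ → Type u} [∀ k, AddCommGroup (C k)] [∀ k, Module ℝ (C k)]

/-- The image in degree `k` of a sequence of maps `C^0 → C^1 → ⋯`, zero in degree `0`. -/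
def coboundaries (δ : ∀ k, C k →ₗ[ℝ] C (k + 1)) : ∀ k, Submodule ℝ (C k)
  | 0 => ⊥
  | k + 1 => LinearMap.range (δ k)

/-- The cohomology in degree `k` of a complex `C^0 → C^1 → ⋯`: cocycles modulo coboundaries. -/
abbrev Cohomology (δ : ∀ k, C k →ₗ[ℝ] C (k + 1)) (k : ℕ) : Type u :=
  LinearMap.ker (δ k) ⧸ (coboundaries δ k).comap (LinearMap.ker (δ k)).subtype

/-- The cohomology class of a cocycle. -/
def cohClass (δ : ∀ k, C k →ₗ[ℝ] C (k + 1)) {k : ℕ} (c : C k) (hc : δ k c = 0) :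
    Cohomology δ k :=
  Submodule.Quotient.mk ⟨c, LinearMap.mem_ker.2 hc⟩

/-- The de Rham cohomology `H_dR^k`. -/
abbrev DeRham (A : Type u) [CommRing A] [Algebra ℝ A] (k : ℕ) : Type u :=
  Cohomology (C := Form A) d k

/-- The cohomology in degree `k` of the shifted de Rham complex `(Ω^(*-1), d)`, that is
`H_dR^(k-1)` (zero for `k = 0`). -/
abbrev DeRhamPrev (A : Type u) [CommRing A] [Algebra ℝ A] (k : ℕ) : Type u :=
  Cohomology (C := Prev (Form A)) prevD k

/-- The Lichnerowicz-Jacobi cohomology `H_LJ^k` of `(P, E)`. -/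
abbrev LJ {A : Type u} [CommRing A] [Algebra ℝ A] (P : MultiVector A 2) (E : VField A)
    (k : ℕ) : Type u :=
  Cohomology (C := PairMV A) (sigma P E) k

end Cohomology

section Contact
variable {A : Type*} [CommRing A] [Algebra ℝ A]

/-- A function as a `0`-form. -/
def func (f : A) : Form A 0 := AlternatingMap.constOfIsEmpty A (VField A) (Fin 0) f

/-- The power `β ∧ ⋯ ∧ β` (`m` factors) of a `2`-form, the constant `1` for `m = 0`. -/
def wedgePow (β : Form A 2) : ∀ m : ℕ, Form A (2 * m)
  | 0 => func 1
  | m + 1 => wedge (show 2 * m + 2 = 2 * (m + 1) by omega) (wedgePow β m) β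

/-- `♭(X) = i_X dη + η(X) η`. -/
def flat (η : Form A 1) : VField A →ₗ[A] Form A 1 where
  toFun X := (d 1 η).curryLeft X + η ![X] • η
  map_add' X Y := by
    have h : η ![X + Y] = η ![X] + η ![Y] := η.map_vecCons_add ![] X Y
    rw [map_add, h, add_smul]
    abel
  map_smul' f X := by
    have h : η ![f • X] = f * η ![X] := η.map_vecCons_smul ![] f X
    rw [map_smul, h, mul_smul, RingHom.id_apply, smul_add]

open Classical in
/-- The inverse `♭⁻¹ : Ω^1 → 𝔛` (zero should `♭` not be bijective). -/
def flatInv (η : Form A 1) : Form A 1 →ₗ[A] VField A :=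
  if h : Function.Bijective (flat η) then (LinearEquiv.ofBijective (flat η) h).symm.toLinearMap
  else 0

/-- The vector field `E = ♭⁻¹(η)`. -/
def reeb (η : Form A 1) : VField A := flatInv η η

/-- `f ↦ ♭⁻¹(df)`. -/
def flatInvD (η : Form A 1) : A →ₗ[ℝ] VField A where
  toFun f := flatInv η (d 0 (func f))
  map_add' f g := by
    rw [← map_add, ← map_add]; rfl
  map_smul' c f := by
    have h : d 0 (func (c • f)) = c • d 0 (func f) := by rw [← map_smul]; rfl
    rw [h, LinearMap.map_smul_of_tower]; rfl

theorem flatInvD_mul (η : Form A 1) (f g : A) :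
    flatInvD η (f * g) = f • flatInvD η g + g • flatInvD η f := by
  have h : d 0 (func (f * g)) = f • d 0 (func g) + g • d 0 (func f) := by
    ext X
    exact (X 0).leibniz f g
  change flatInv η _ = f • flatInv η _ + g • flatInv η _
  rw [h, map_add, map_smul, map_smul]

/-- The `2`-vector `Λ(α, β) = dη(♭⁻¹ α, ♭⁻¹ β)`. -/
def contactBivector (η : Form A 1) : MultiVector A 2 :=
  mkMV ((realAlt (d 1 η)).compLinearMap (flatInvD η)) (compLinearMap_mem _ _ (flatInvD_mul η))

/-- `(P, E)` is a Jacobi structure: `[P, P] = 2 E ∧ P` and `[E, P] = 0`. -/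
def IsJacobi (P : MultiVector A 2) (E : VField A) : Prop :=
  schouten (show 2 + 2 = 3 + 1 by rfl) P P =
      (2 : ℝ) • wedgeMV (show 1 + 2 = 3 by rfl) (ofVField E) P ∧
    schouten (show 1 + 2 = 2 + 1 by rfl) (ofVField E) P = 0

end Contact

section Manifold
open scoped Manifold ContDiff

/-- The algebra `C^∞(M, ℝ)` of a manifold of dimension `n`. -/
abbrev Smooth (n : ℕ) (M : Type*) [TopologicalSpace M]
    [ChartedSpace (EuclideanSpace ℝ (Fin n)) M] :=
  C^∞⟮𝓡 n, M; ℝ⟯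

/-- `η` is a contact form on `M`, of dimension `2m + 1`: the `(2m+1)`-form `η ∧ (dη)^m` does not
vanish at any point. -/
def IsContactForm {m : ℕ} {M : Type*} [TopologicalSpace M]
    [ChartedSpace (EuclideanSpace ℝ (Fin (2 * m + 1))) M]
    (η : Form (Smooth (2 * m + 1) M) 1) : Prop :=
  ∀ p : M, ∃ X : Fin (2 * m + 1) → VField (Smooth (2 * m + 1) M),
    wedge (show 1 + 2 * m = 2 * m + 1 by omega) η (wedgePow (d 1 η) m) X p ≠ 0

end Manifold
end
end LichJac

open scoped Manifold ContDiff

/-! A contact form turns multivectors into forms. With `X_f = ♭⁻¹(df)`, the map `theta`, given by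
`(θγ)(f₁, …, f_k) = γ(X_{f₁}, …, X_{f_k})`, is bijective in every degree, so all of the Jacobi
geometry can be computed on forms, where Cartan's calculus is available. There `E = θη`, `Λ =
θ(dη)`, wedge products correspond to wedge products, `[E, ·]` becomes `L_E` and, which is the heart
of the matter, `[Λ, ·]` becomes `δγ = dγ - η ∧ L_E γ + k η ∧ γ - dη ∧ i_E γ`
(`schouten_bivector_theta`). As `dη` is closed and killed by `i_E` and `L_E`, `δ(dη) = 2 η ∧ dη`;
this gives `[Λ, Λ] = 2 E ∧ Λ`.

The formula for `[Λ, ·]` is proved by induction on the degree. A multivector is determined by its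
contractions with differentials `df`, and such a contraction reduces `[Λ, Q]` to `[Λ, i_{df} Q]` and
`[#df, Q]`, and the latter to brackets of lower degree. On forms, `δ` and `i_X δ + δ i_X` (`hamOp`)
obey the same recursions; they match by the formula `ham_bracket` for the field `X_{Λ(df, dg)}`. The
contraction rules come from expanding signed sums over permutations by the position of the first
argument (`shuffleSum_cons`).

On forms, `#` is the projection `γ ↦ γ - η ∧ i_E γ` onto horizontal forms (`sharp_eq`). If `α = α₀ +
η ∧ α₁` and `β = β₀ + η ∧ β₁` with horizontal `αᵢ`, `βᵢ`, then `F̃(α, β)` corresponds to `(α₀ + η ∧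
β₀, -α₁ + η ∧ β₁)`, which is visibly bijective. In `σ` the multiples of `E ∧ ·` cancel the term `k η
∧ γ` of `δ`, and Cartan's formula identifies what remains with `(-d, d)` (`sigma_tildeF`). Then `σ²
= 0` follows from `d² = 0`, and the statement on cohomology is formal.

Since vector fields are derivations of `C^∞(M)` and forms are multilinear maps on them, geometry
enters only through `IsContactAlg`. By Hadamard's lemma a derivation is locally a combination of
coordinate fields (`exists_frame`). Nondegeneracy of `η ∧ (dη)^m` makes the matrix of `♭` in such a
frame invertible at each point, Cramer's rule inverts `♭` locally, and the local inverses glue.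
Finally `η(E) = 1` because in odd dimension `dη` has a kernel at every point, on which `η` cannot
vanish. -/

namespace LichJac

/-! ### Expansion of signed permutation sums along the first argument. -/

section PermSplit

/-- The permutations of `Fin (n + 1)` sending `i` to `0` are those `t` of `Fin n`. -/
def permAt {n : ℕ} (i : Fin (n + 1)) (t : Equiv.Perm (Fin n)) : Equiv.Perm (Fin (n + 1)) :=
  Equiv.Perm.decomposeFin.symm (0, t) * (Fin.cycleRange i)

theorem sign_permAt {n : ℕ} (i : Fin (n + 1)) (t : Equiv.Perm (Fin n)) :
    Equiv.Perm.sign (permAt i t) = (-1) ^ (i : ℕ) * Equiv.Perm.sign t := by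
  rw [permAt, Equiv.Perm.sign_mul, Fin.sign_cycleRange, Equiv.Perm.decomposeFin.symm_sign]
  simp [mul_comm]

theorem permAt_self {n : ℕ} (i : Fin (n + 1)) (t : Equiv.Perm (Fin n)) : permAt i t i = 0 := by
  simp [permAt]

theorem permAt_succAbove {n : ℕ} (i : Fin (n + 1)) (t : Equiv.Perm (Fin n)) (j : Fin n) :
    permAt i t (i.succAbove j) = (t j).succ := by
  simp [permAt]

theorem permAt_bijective (n : ℕ) : Function.Bijective
    (fun x : Fin (n + 1) × Equiv.Perm (Fin n) => permAt x.1 x.2) := by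
  rw [Fintype.bijective_iff_injective_and_card]
  refine ⟨?_, by simp [Fintype.card_perm, Nat.factorial_succ]⟩
  rintro ⟨i, t⟩ ⟨j, u⟩ h
  simp only at h
  have hij : i = j := by
    apply (permAt i t).injective
    rw [permAt_self, h, permAt_self]
  subst hij
  congr
  ext1 l
  have := congrArg (fun s => s (i.succAbove l)) h
  simpa [permAt_succAbove] using this

/-- The signed sum over all rearrangements of the arguments. -/
def altSum {V S : Type*} [AddCommGroup S] {n : ℕ} (G : (Fin n → V) → S) (v : Fin n → V) : S :=
  ∑ s : Equiv.Perm (Fin n), Equiv.Perm.sign s • G (fun i => v (s i))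

/-- Permutations are grouped by the position `i` that receives the first argument; what is left is a
permutation of the other arguments, whose sign differs by `(-1)^i`. -/
theorem altSum_cons {V S : Type*} [AddCommGroup S] {n : ℕ} (G : (Fin (n + 1) → V) → S) (x : V)
    (w : Fin n → V) :
    altSum G (Fin.cons x w) =
      ∑ i : Fin (n + 1), (-1 : ℤ) ^ (i : ℕ) • altSum (fun u => G (i.insertNth x u)) w := by
  simp only [altSum, Finset.smul_sum]
  rw [← Fintype.sum_prod_type', ← (permAt_bijective n).sum_comp]
  refine Finset.sum_congr rfl fun ⟨i, t⟩ _ => ?_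
  have h : (fun j => (Fin.cons x w : Fin (n + 1) → V) (permAt i t j)) =
      i.insertNth x (fun j => w (t j)) := by
    rw [Fin.eq_insertNth_iff]
    constructor
    · rw [permAt_self]; rfl
    · ext1 j
      rw [Fin.removeNth, permAt_succAbove]; rfl
  simp only [h, sign_permAt]
  rw [mul_smul]
  rcases Nat.even_or_odd i with hi | hi <;> simp [hi.neg_one_pow]

theorem altSum_zero {V S : Type*} [AddCommGroup S] (G : (Fin 0 → V) → S) (v : Fin 0 → V) :
    altSum G v = G v := by
  simp only [altSum, Fintype.sum_unique]
  have : (fun i => v ((default : Equiv.Perm (Fin 0)) i)) = v := Subsingleton.elim _ _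
  rw [this]; simp

end PermSplit

/-! ### Inserting an argument into one of two blocks of arguments. -/

section BlockInsert
variable {V : Type*}

theorem insertNth_inl {k l n : ℕ} (h : k + l = n) (h' : k + 1 + l = n + 1) (a : Fin (k + 1)) (x : V)
    (u : Fin n → V) :
    (fun i => (blocks h' (.inl a)).insertNth (α := fun _ => V) x u (blocks h' (.inl i))) =
        a.insertNth (α := fun _ => V) x (fun i => u (blocks h (.inl i))) ∧
    (fun j => (blocks h' (.inl a)).insertNth (α := fun _ => V) x u (blocks h' (.inr j))) =
        fun j => u (blocks h (.inr j)) := by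
  constructor
  · rw [Fin.eq_insertNth_iff]
    constructor
    · simp
    · ext1 i
      have : blocks h' (.inl (a.succAbove i)) =
          (blocks h' (.inl a)).succAbove (blocks h (.inl i)) := by
        ext; simp only [blocks, Fin.succAbove, Fin.lt_def]
        simp; split_ifs <;> simp
      rw [Fin.removeNth, this, Fin.insertNth_apply_succAbove]
  · ext1 j
    have : blocks h' (.inr j) =
          (blocks h' (.inl a)).succAbove (blocks h (.inr j)) := by
        ext; simp only [blocks, Fin.succAbove, Fin.lt_def]
        have := a.2
        simp; split_ifs <;> (simp; try omega)
    rw [this, Fin.insertNth_apply_succAbove]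

theorem insertNth_inr {k l n : ℕ} (h : k + l = n) (h' : k + (l + 1) = n + 1) (b : Fin (l + 1)) (x : V)
    (u : Fin n → V) :
    (fun i => (blocks h' (.inr b)).insertNth (α := fun _ => V) x u (blocks h' (.inl i))) =
        (fun i => u (blocks h (.inl i))) ∧
    (fun j => (blocks h' (.inr b)).insertNth (α := fun _ => V) x u (blocks h' (.inr j))) =
        b.insertNth (α := fun _ => V) x fun j => u (blocks h (.inr j)) := by
  constructor
  · ext1 i
    have : blocks h' (.inl i) =
          (blocks h' (.inr b)).succAbove (blocks h (.inl i)) := by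
        ext; simp only [blocks, Fin.succAbove, Fin.lt_def]
        have := i.2
        simp; split_ifs <;> (simp; try omega)
    rw [this, Fin.insertNth_apply_succAbove]
  · rw [Fin.eq_insertNth_iff]
    constructor
    · simp
    · ext1 i
      have : blocks h' (.inr (b.succAbove i)) =
          (blocks h' (.inr b)).succAbove (blocks h (.inr i)) := by
        ext; simp only [blocks, Fin.succAbove, Fin.lt_def]
        simp; split_ifs <;> (simp; try omega)
      rw [Fin.removeNth, this, Fin.insertNth_apply_succAbove]

/-- Splitting of a sum over the arguments into the two blocks. -/
theorem sum_blocks {S : Type*} [AddCommMonoid S] {k l n : ℕ} (h : k + l = n) (F : Fin n → S) :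
    ∑ i, F i = ∑ a : Fin k, F (blocks h (.inl a)) + ∑ b : Fin l, F (blocks h (.inr b)) := by
  rw [← (blocks h).sum_comp, Fintype.sum_sum_type]

@[simp] theorem blocks_inl_val {k l n : ℕ} (h : k + l = n) (a : Fin k) :
    ((blocks h (.inl a) : Fin n) : ℕ) = a := by simp [blocks]

@[simp] theorem blocks_inr_val {k l n : ℕ} (h : k + l = n) (b : Fin l) :
    ((blocks h (.inr b) : Fin n) : ℕ) = k + b := by simp [blocks]

end BlockInsert

/-! ### Shuffle sums and their recursion in the first argument. -/

section ShuffleSum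
theorem altSum_zsmul {V S : Type*} [AddCommGroup S] {n : ℕ} (c : ℤ) (G : (Fin n → V) → S)
    (w : Fin n → V) : altSum (fun u => c • G u) w = c • altSum G w := by
  simp only [altSum, Finset.smul_sum]
  exact Finset.sum_congr rfl fun s _ => smul_comm _ _ _

variable {V S : Type*} [AddCommGroup S] [Module ℝ S]

/-- The signed sum of `K` over the `(k, l)`-shuffles of the arguments, written as a normalised sum
over all permutations. -/
noncomputable def shuffleSum {k l n : ℕ} (h : k + l = n) (K : (Fin k → V) → (Fin l → V) → S)
    (w : Fin n → V) : S :=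
  ((k.factorial * l.factorial : ℝ)⁻¹) • altSum
    (fun u => K (fun i => u (blocks h (.inl i))) (fun j => u (blocks h (.inr j)))) w

theorem altSum_smul {n : ℕ} (c : ℝ) (G : (Fin n → V) → S) (w : Fin n → V) :
    altSum (fun u => c • G u) w = c • altSum G w := by
  simp only [altSum, Finset.smul_sum]
  exact Finset.sum_congr rfl fun s _ => smul_comm _ _ _

theorem shuffleSum_smul {k l n : ℕ} (h : k + l = n) (c : ℝ) (K : (Fin k → V) → (Fin l → V) → S)
    (w : Fin n → V) : shuffleSum h (fun y z => c • K y z) w = c • shuffleSum h K w := by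
  rw [shuffleSum, altSum_smul, smul_comm]; rfl

/-- The sign of the position cancels the sign from alternation in the first block, so all `k + 1`
positions contribute equally, and `(k + 1) / (k + 1)! = 1 / k!`. -/
theorem shuffleSum_left {k l n : ℕ} (h : k + l = n) (h' : k + 1 + l = n + 1)
    (K : (Fin (k + 1) → V) → (Fin l → V) → S)
    (hK : ∀ (a : Fin (k + 1)) x y z, K (a.insertNth (α := fun _ => V) x y) z =
      (-1 : ℤ) ^ (a : ℕ) • K (Fin.cons x y) z) (x : V) (w : Fin n → V) :
    (((k + 1).factorial * l.factorial : ℝ)⁻¹) •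
      ∑ a : Fin (k + 1), (-1 : ℤ) ^ ((blocks h' (.inl a) : Fin (n + 1)) : ℕ) • altSum (fun u =>
        (fun u : Fin (n + 1) → V => K (fun i => u (blocks h' (.inl i))) (fun j => u (blocks h' (.inr j))))
        ((blocks h' (.inl a)).insertNth (α := fun _ => V) x u)) w =
    shuffleSum h (fun y z => K (Fin.cons x y) z) w := by
  simp only [insertNth_inl h h', hK, altSum_zsmul, blocks_inl_val, smul_smul, ← pow_add]
  simp only [(Even.add_self _).neg_one_pow, one_smul, Finset.sum_const, Finset.card_univ,
    Fintype.card_fin]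
  rw [shuffleSum, ← Nat.cast_smul_eq_nsmul ℝ, smul_smul]
  congr 1
  rw [Nat.factorial_succ]
  have : ((k + 1 : ℕ) : ℝ) ≠ 0 := by positivity
  push_cast at this ⊢
  field_simp

/-- The same count for the second block; the sign `(-1)^k` is the price of moving the argument past
the first block. -/
theorem shuffleSum_right {k l n : ℕ} (h : k + l = n) (h' : k + (l + 1) = n + 1)
    (K : (Fin k → V) → (Fin (l + 1) → V) → S)
    (hK : ∀ (a : Fin (l + 1)) x y z, K y (a.insertNth (α := fun _ => V) x z) =
      (-1 : ℤ) ^ (a : ℕ) • K y (Fin.cons x z)) (x : V) (w : Fin n → V) :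
    ((k.factorial * (l + 1).factorial : ℝ)⁻¹) •
      ∑ a : Fin (l + 1), (-1 : ℤ) ^ ((blocks h' (.inr a) : Fin (n + 1)) : ℕ) • altSum (fun u =>
        (fun u : Fin (n + 1) → V => K (fun i => u (blocks h' (.inl i))) (fun j => u (blocks h' (.inr j))))
        ((blocks h' (.inr a)).insertNth (α := fun _ => V) x u)) w =
    (-1 : ℝ) ^ k • shuffleSum h (fun y z => K y (Fin.cons x z)) w := by
  simp only [insertNth_inr h h', hK, altSum_zsmul, blocks_inr_val, smul_smul, pow_add, mul_assoc]
  simp only [← pow_add, (Even.add_self _).neg_one_pow, mul_one, Finset.sum_const, Finset.card_univ,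
    Fintype.card_fin]
  rw [shuffleSum, ← Nat.cast_smul_eq_nsmul ℝ, smul_smul, ← Int.cast_smul_eq_zsmul ℝ, smul_smul,
    smul_smul]
  congr 1
  rw [Nat.factorial_succ]
  have : ((l + 1 : ℕ) : ℝ) ≠ 0 := by positivity
  push_cast at this ⊢
  field_simp

/-- Source of all contraction rules below: the first argument lands either in the first block or in
the second. Only alternation in each block separately is needed. Empty blocks, which cannot receive
the argument, have their own versions. -/
theorem shuffleSum_cons {k l n : ℕ} (h : k + (l + 1) = n) (g : k + 1 + l = n)
    (h' : k + 1 + (l + 1) = n + 1) (K : (Fin (k + 1) → V) → (Fin (l + 1) → V) → S)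
    (hK : ∀ (a : Fin (k + 1)) x y z, K (a.insertNth (α := fun _ => V) x y) z =
      (-1 : ℤ) ^ (a : ℕ) • K (Fin.cons x y) z)
    (hK' : ∀ (a : Fin (l + 1)) x y z, K y (a.insertNth (α := fun _ => V) x z) =
      (-1 : ℤ) ^ (a : ℕ) • K y (Fin.cons x z)) (x : V) (w : Fin n → V) :
    shuffleSum h' K (Fin.cons x w) = shuffleSum h (fun y z => K (Fin.cons x y) z) w +
      (-1 : ℝ) ^ (k + 1) • shuffleSum g (fun y z => K y (Fin.cons x z)) w := by
  rw [← shuffleSum_left h h' K hK, ← shuffleSum_right g h' K hK', ← smul_add, shuffleSum,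
    altSum_cons, sum_blocks h']

theorem shuffleSum_cons_left {k n : ℕ} (h : k + 0 = n)
    (h' : k + 1 + 0 = n + 1) (K : (Fin (k + 1) → V) → (Fin 0 → V) → S)
    (hK : ∀ (a : Fin (k + 1)) x y z, K (a.insertNth (α := fun _ => V) x y) z =
      (-1 : ℤ) ^ (a : ℕ) • K (Fin.cons x y) z) (x : V) (w : Fin n → V) :
    shuffleSum h' K (Fin.cons x w) = shuffleSum h (fun y z => K (Fin.cons x y) z) w := by
  rw [← shuffleSum_left h h' K hK, shuffleSum, altSum_cons, sum_blocks h',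
    Finset.sum_of_isEmpty (ι := Fin 0), add_zero]

theorem shuffleSum_cons_right {l n : ℕ} (h : 0 + l = n)
    (h' : 0 + (l + 1) = n + 1) (K : (Fin 0 → V) → (Fin (l + 1) → V) → S)
    (hK : ∀ (a : Fin (l + 1)) x y z, K y (a.insertNth (α := fun _ => V) x z) =
      (-1 : ℤ) ^ (a : ℕ) • K y (Fin.cons x z)) (x : V) (w : Fin n → V) :
    shuffleSum h' K (Fin.cons x w) = shuffleSum h (fun y z => K y (Fin.cons x z)) w := by
  have := shuffleSum_right h h' K hK x w
  rw [pow_zero, one_smul] at this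
  rw [← this, shuffleSum, altSum_cons, sum_blocks h',
    Finset.sum_of_isEmpty (ι := Fin 0), zero_add]

theorem shuffleSum_zero (h : 0 + 0 = 0) (K : (Fin 0 → V) → (Fin 0 → V) → S) (w : Fin 0 → V) :
    shuffleSum h K w = K ![] ![] := by
  rw [shuffleSum, altSum_zero]
  simp only [Nat.factorial_zero, Nat.cast_one, mul_one, inv_one, one_smul]
  congr 1 <;> exact Subsingleton.elim _ _

end ShuffleSum

/-! ### Contraction as an antiderivation of the wedge product. -/

section Wedge
variable {R S M : Type*} [CommRing R] [CommRing S] [Algebra R S] [Algebra ℝ S]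
    [SMulCommClass R ℝ S] [AddCommGroup M] [Module R M]

theorem alt_insertNth {R M N : Type*} [CommRing R] [AddCommGroup M] [Module R M] [AddCommGroup N]
    [Module R N] {k : ℕ} (f : M [⋀^Fin (k + 1)]→ₗ[R] N) (a : Fin (k + 1)) (x : M) (y : Fin k → M) :
    f (a.insertNth (α := fun _ => M) x y) = (-1 : ℤ) ^ (a : ℕ) • f (Fin.cons x y) :=
  f.map_insertNth a x y

theorem wedge_eq_shuffleSum {k l n : ℕ} (h : k + l = n)
    (a : M [⋀^Fin k]→ₗ[R] S) (b : M [⋀^Fin l]→ₗ[R] S) (v : Fin n → M) :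
    wedge h a b v = shuffleSum h (fun y z => a y * b z) v := wedge_apply h a b v

theorem curryLeft_wedge {k l n : ℕ} (h : k + (l + 1) = n) (g : k + 1 + l = n)
    (h' : k + 1 + (l + 1) = n + 1)
    (a : M [⋀^Fin (k + 1)]→ₗ[R] S) (b : M [⋀^Fin (l + 1)]→ₗ[R] S) (x : M) :
    (wedge h' a b).curryLeft x = wedge h (a.curryLeft x) b +
      (-1 : ℝ) ^ (k + 1) • wedge g a (b.curryLeft x) := by
  ext w
  simp only [AlternatingMap.add_apply, AlternatingMap.smul_apply]
  rw [AlternatingMap.curryLeft_apply_apply]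
  simp only [wedge_eq_shuffleSum]
  exact shuffleSum_cons h g h' (fun y z => a y * b z)
    (fun i x y z => by rw [alt_insertNth, smul_mul_assoc])
    (fun i x y z => by rw [alt_insertNth, mul_smul_comm]) x w

theorem curryLeft_wedge_zero_right {k n : ℕ} (h : k + 0 = n) (h' : k + 1 + 0 = n + 1)
    (a : M [⋀^Fin (k + 1)]→ₗ[R] S) (b : M [⋀^Fin 0]→ₗ[R] S) (x : M) :
    (wedge h' a b).curryLeft x = wedge h (a.curryLeft x) b := by
  ext w
  rw [AlternatingMap.curryLeft_apply_apply]
  simp only [wedge_eq_shuffleSum]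
  exact shuffleSum_cons_left h h' (fun y z => a y * b z)
    (fun i x y z => by rw [alt_insertNth, smul_mul_assoc]) x w

theorem curryLeft_wedge_zero_left {l n : ℕ} (h : 0 + l = n) (h' : 0 + (l + 1) = n + 1)
    (a : M [⋀^Fin 0]→ₗ[R] S) (b : M [⋀^Fin (l + 1)]→ₗ[R] S) (x : M) :
    (wedge h' a b).curryLeft x = wedge h a (b.curryLeft x) := by
  ext w
  rw [AlternatingMap.curryLeft_apply_apply]
  simp only [wedge_eq_shuffleSum]
  exact shuffleSum_cons_right h h' (fun y z => a y * b z)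
    (fun i x y z => by rw [alt_insertNth, mul_smul_comm]) x w

theorem wedge_zero_left {l : ℕ} (h : 0 + l = l) (a : M [⋀^Fin 0]→ₗ[R] S) (b : M [⋀^Fin l]→ₗ[R] S)
    (v : Fin l → M) : wedge h a b v = a ![] * b v := by
  induction l with
  | zero =>
    rw [wedge_eq_shuffleSum, shuffleSum_zero, Subsingleton.elim v ![]]
  | succ l ih =>
    have := DFunLike.congr_fun (curryLeft_wedge_zero_left (Nat.zero_add l) h a b (v 0)) (Fin.tail v)
    rw [ih] at this
    have hv : Matrix.vecCons (v 0) (Fin.tail v) = v := Fin.cons_self_tail v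
    simpa only [AlternatingMap.curryLeft_apply_apply, hv] using this

end Wedge

/-! ### Contraction of the Schouten–Nijenhuis bracket. -/

section Insert
variable {A : Type*} [CommRing A] [Algebra ℝ A]

theorem insertFirst_eq_shuffleSum {p q n : ℕ} (h : p + 1 + q = n + 1) (h' : q + p = n)
    (P : A [⋀^Fin (p + 1)]→ₗ[ℝ] A) (Q : A [⋀^Fin q]→ₗ[ℝ] A) (v : Fin n → A) :
    insertFirst h P Q v = shuffleSum h' (fun y z => P (Fin.cons (Q y) z)) v :=
  insertFirst_apply h h' P Q v

theorem insertLast_eq_shuffleSum {p q n : ℕ} (h : p + 1 + q = n + 1) (h' : p + q = n)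
    (P : A [⋀^Fin (p + 1)]→ₗ[ℝ] A) (Q : A [⋀^Fin q]→ₗ[ℝ] A) (v : Fin n → A) :
    insertLast h P Q v = shuffleSum h' (fun y z => P (Fin.snoc y (Q z))) v :=
  insertLast_apply h h' P Q v

theorem map_cons_zsmul {k : ℕ} (P : A [⋀^Fin (k + 1)]→ₗ[ℝ] A) (c : ℤ) (x : A) (y : Fin k → A) :
    P (Fin.cons (c • x) y : Fin (k + 1) → A) = c • P (Fin.cons x y : Fin (k + 1) → A) := by
  rw [← Int.cast_smul_eq_zsmul ℝ, ← Int.cast_smul_eq_zsmul ℝ]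
  exact P.map_vecCons_smul y _ x

theorem map_cons_insertNth {k : ℕ} (P : A [⋀^Fin (k + 2)]→ₗ[ℝ] A) (a : Fin (k + 1)) (g x : A)
    (y : Fin k → A) :
    P (Fin.cons g (a.insertNth (α := fun _ => A) x y) : Fin (k + 2) → A) =
      (-1 : ℤ) ^ (a : ℕ) • P (Fin.cons g (Fin.cons x y : Fin (k + 1) → A) : Fin (k + 2) → A) :=
  alt_insertNth (P.curryLeft g) a x y

theorem map_cons_cons_swap {R M N : Type*} [CommRing R] [AddCommGroup M] [Module R M]
    [AddCommGroup N] [Module R N] {k : ℕ} (P : M [⋀^Fin (k + 2)]→ₗ[R] N) (x y : M)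
    (z : Fin k → M) :
    P (Fin.cons x (Fin.cons y z : Fin (k + 1) → M) : Fin (k + 2) → M) =
      -P (Fin.cons y (Fin.cons x z : Fin (k + 1) → M) : Fin (k + 2) → M) := by
  have := P.map_swap (Fin.cons y (Fin.cons x z : Fin (k + 1) → M) : Fin (k + 2) → M)
    (show (0 : Fin (k + 2)) ≠ 1 by simp)
  rw [← this]
  congr 1
  ext i
  refine Fin.cases ?_ (fun i => Fin.cases ?_ (fun i => ?_) i) i
  · simp
  · change _ = (Fin.cons y (Fin.cons x z : Fin (k + 1) → M) : Fin (k + 2) → M) (Equiv.swap 0 1 1)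
    rw [Equiv.swap_apply_right]; rfl
  · rw [Function.comp_apply, Equiv.swap_apply_of_ne_of_ne (by simp) (by simp [Fin.ext_iff])]; rfl

/-- Moving `x` past the `q + 1` arguments of `Q` costs `(-1)^(q + 1)`, and exchanging it inside `P`
with the value of `Q` costs one more sign. -/
theorem curryLeft_insertFirst {p q n : ℕ} (h : p + 1 + (q + 1) = n + 1 + 1)
    (g : p + 1 + q = n + 1) (g' : p + (q + 1) = n + 1)
    (P : A [⋀^Fin (p + 1)]→ₗ[ℝ] A) (Q : A [⋀^Fin (q + 1)]→ₗ[ℝ] A) (x : A) :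
    (insertFirst h P Q).curryLeft x = insertFirst g P (Q.curryLeft x) +
      (-1 : ℝ) ^ q • insertFirst g' (P.curryLeft x) Q := by
  match p, P with
  | 0, P =>
    ext w
    simp only [AlternatingMap.add_apply, AlternatingMap.smul_apply]
    rw [AlternatingMap.curryLeft_apply_apply, insertFirst_eq_shuffleSum h (by omega),
      insertFirst_eq_shuffleSum g (by omega)]
    refine (shuffleSum_cons_left (by omega) _ _ (fun i x y z => by
      simp only [alt_insertNth, map_cons_zsmul]) x w).trans ?_
    -- After contraction `P` has degree zero and nothing can be inserted in it; its insertion is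
    -- zero by convention.
    simp only [insertFirst, AlternatingMap.zero_apply, smul_zero, add_zero]; rfl
  | p + 1, P =>
    ext w
    simp only [AlternatingMap.add_apply, AlternatingMap.smul_apply]
    rw [AlternatingMap.curryLeft_apply_apply, insertFirst_eq_shuffleSum h (by omega),
      insertFirst_eq_shuffleSum g (by omega), insertFirst_eq_shuffleSum g' (by omega)]
    refine (shuffleSum_cons (by omega) (by omega) _ _ (fun i x y z => by
      simp only [alt_insertNth, map_cons_zsmul]) (fun i x y z => by
      simp only [map_cons_insertNth]) x w).trans ?_
    congr 1
    rw [pow_succ, mul_smul, ← shuffleSum_smul]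
    congr 2
    ext y z
    rw [map_cons_cons_swap, neg_smul, one_smul, neg_neg]; rfl

theorem curryLeft_insertFirst_zero {p n : ℕ} (h : p + 2 + 0 = n + 1 + 1) (g : p + 1 + 0 = n + 1)
    (P : A [⋀^Fin (p + 2)]→ₗ[ℝ] A) (Q : A [⋀^Fin 0]→ₗ[ℝ] A) (x : A) :
    (insertFirst h P Q).curryLeft x = -insertFirst g (P.curryLeft x) Q := by
  ext w
  rw [AlternatingMap.curryLeft_apply_apply, AlternatingMap.neg_apply,
    insertFirst_eq_shuffleSum h (by omega), insertFirst_eq_shuffleSum g (by omega)]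
  refine (shuffleSum_cons_right (by omega) _ _ (fun i x y z => by
      simp only [map_cons_insertNth]) x w).trans ?_
  rw [← neg_one_smul ℝ, ← shuffleSum_smul]
  congr 1
  ext y z
  rw [map_cons_cons_swap, neg_smul, one_smul]; rfl

theorem snoc_eq_insertNth {V : Type*} {k : ℕ} (y : Fin k → V) (x : V) :
    (Fin.snoc y x : Fin (k + 1) → V) = (Fin.last k).insertNth (α := fun _ => V) x y := by
  rw [Fin.insertNth_last']

theorem map_snoc {k : ℕ} (P : A [⋀^Fin (k + 1)]→ₗ[ℝ] A) (x : A) (y : Fin k → A) :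
    P (Fin.snoc y x : Fin (k + 1) → A) = (-1 : ℤ) ^ k • P (Fin.cons x y : Fin (k + 1) → A) := by
  rw [snoc_eq_insertNth, alt_insertNth, Fin.val_last]

/-- With the inserted value in the last place there is no further exchange; the sign only records
the `q` free arguments of `Q`. -/
theorem curryLeft_insertLast {p q n : ℕ} (h : q + 1 + (p + 1) = n + 1 + 1)
    (g : q + (p + 1) = n + 1) (g' : q + 1 + p = n + 1)
    (P : A [⋀^Fin (p + 1)]→ₗ[ℝ] A) (Q : A [⋀^Fin (q + 1)]→ₗ[ℝ] A) (x : A) :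
    (insertLast h Q P).curryLeft x = insertLast g (Q.curryLeft x) P +
      (-1 : ℝ) ^ q • insertLast g' Q (P.curryLeft x) := by
  match q, Q with
  | 0, Q =>
    ext w
    simp only [AlternatingMap.add_apply, AlternatingMap.smul_apply]
    rw [AlternatingMap.curryLeft_apply_apply, insertLast_eq_shuffleSum h (by omega),
      insertLast_eq_shuffleSum g' (by omega)]
    refine (shuffleSum_cons_right (by omega) _ _ (fun i x y z => by
      simp only [alt_insertNth, map_snoc, map_cons_zsmul]; rw [smul_comm]) x w).trans ?_
    simp only [insertLast, AlternatingMap.zero_apply, pow_zero, one_smul, zero_add]; rfl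
  | q + 1, Q =>
    ext w
    simp only [AlternatingMap.add_apply, AlternatingMap.smul_apply]
    rw [AlternatingMap.curryLeft_apply_apply, insertLast_eq_shuffleSum h (by omega),
      insertLast_eq_shuffleSum g (by omega), insertLast_eq_shuffleSum g' (by omega)]
    refine (shuffleSum_cons (by omega) (by omega) _ _ (fun i x y z => by
      simp only [map_snoc, map_cons_insertNth]; rw [smul_comm]) (fun i x y z => by
      simp only [map_snoc, alt_insertNth, map_cons_zsmul]; rw [smul_comm]) x w).trans ?_
    congr 1
    congr 2
    ext y z
    rw [← Fin.cons_snoc_eq_snoc_cons]; rfl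

theorem curryLeft_insertLast_zero {q n : ℕ} (h : q + 2 + 0 = n + 1 + 1)
    (g : q + 1 + 0 = n + 1)
    (P : A [⋀^Fin 0]→ₗ[ℝ] A) (Q : A [⋀^Fin (q + 2)]→ₗ[ℝ] A) (x : A) :
    (insertLast h Q P).curryLeft x = insertLast g (Q.curryLeft x) P := by
  ext w
  rw [AlternatingMap.curryLeft_apply_apply, insertLast_eq_shuffleSum h (by omega),
    insertLast_eq_shuffleSum g (by omega)]
  refine (shuffleSum_cons_left (by omega) _ _ (fun i x y z => by
      simp only [map_snoc, map_cons_insertNth]; rw [smul_comm]) x w).trans ?_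
  congr 1
  ext y z
  rw [← Fin.cons_snoc_eq_snoc_cons]; rfl

theorem curryLeft_curryLeft_swap {q : ℕ} (Q : A [⋀^Fin (q + 2)]→ₗ[ℝ] A) (x y : A) :
    (Q.curryLeft x).curryLeft y = -(Q.curryLeft y).curryLeft x := by
  ext w
  exact map_cons_cons_swap Q x y w

theorem insertLast_zero {q : ℕ} (h : q + 1 + 0 = q + 1)
    (P : A [⋀^Fin 0]→ₗ[ℝ] A) (Q : A [⋀^Fin (q + 1)]→ₗ[ℝ] A) :
    insertLast h Q P = (-1 : ℝ) ^ q • Q.curryLeft (P ![]) := by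
  induction q with
  | zero =>
    ext v
    rw [insertLast_eq_shuffleSum h rfl, shuffleSum_zero]
    simp only [map_snoc, pow_zero, one_smul, AlternatingMap.curryLeft_apply_apply]
    rw [Subsingleton.elim v ![]]; rfl
  | succ q ih =>
    ext v
    have := DFunLike.congr_fun (curryLeft_insertLast_zero h rfl P Q (v 0)) (Fin.tail v)
    rw [ih] at this
    have hv : Matrix.vecCons (v 0) (Fin.tail v) = v := Fin.cons_self_tail v
    rw [AlternatingMap.curryLeft_apply_apply, hv] at this
    rw [this, curryLeft_curryLeft_swap, smul_neg, AlternatingMap.neg_apply,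
      AlternatingMap.smul_apply, AlternatingMap.smul_apply, AlternatingMap.curryLeft_apply_apply,
      hv, pow_succ, mul_smul, neg_smul, one_smul, smul_neg]

/-- The normalising sign of the bracket is what makes the two insertions combine into brackets
again. The rule determines the bracket recursively, and afterwards its definition is used only in
degrees where one factor is a function. -/
theorem curryLeft_schoutenAlt {p q n : ℕ} (h : p + 1 + (q + 1) = n + 1 + 1)
    (g : p + 1 + q = n + 1) (g' : p + (q + 1) = n + 1)
    (P : A [⋀^Fin (p + 1)]→ₗ[ℝ] A) (Q : A [⋀^Fin (q + 1)]→ₗ[ℝ] A) (x : A) :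
    (schoutenAlt h P Q).curryLeft x = (-1 : ℝ) ^ p • schoutenAlt g P (Q.curryLeft x) -
      schoutenAlt g' (P.curryLeft x) Q := by
  have e (s : ℝ) (U W : A [⋀^Fin (n + 1)]→ₗ[ℝ] A) :
    (s • (U - W)).curryLeft x = s • (U.curryLeft x - W.curryLeft x) := rfl
  simp only [schoutenAlt]
  rw [e, curryLeft_insertFirst h g g', curryLeft_insertLast _ (by omega) (by omega)]
  simp only [smul_sub, smul_add, smul_smul]
  -- All signs depend only on the parities of `p` and `q`.
  rcases Nat.even_or_odd p with hp | hp <;> rcases Nat.even_or_odd q with hq | hq <;>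
  · have e1 : ∀ m : ℕ, Even m → (-1 : ℝ) ^ m = 1 := fun m h => h.neg_one_pow
    have e2 : ∀ m : ℕ, ¬ Even m → (-1 : ℝ) ^ m = -1 := fun m h =>
      (Nat.not_even_iff_odd.1 h).neg_one_pow
    simp [Nat.even_add_one, Nat.even_mul, hp, hq, e1, e2, Nat.not_even_iff_odd.2]
    try abel

theorem curryLeft_schoutenAlt_zero {p n : ℕ} (h : p + 2 + 0 = n + 1 + 1) (g : p + 1 + 0 = n + 1)
    (P : A [⋀^Fin (p + 2)]→ₗ[ℝ] A) (Q : A [⋀^Fin 0]→ₗ[ℝ] A) (x : A) :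
    (schoutenAlt h P Q).curryLeft x = -schoutenAlt g (P.curryLeft x) Q := by
  have e (s : ℝ) (U W : A [⋀^Fin (n + 1)]→ₗ[ℝ] A) :
    (s • (U - W)).curryLeft x = s • (U.curryLeft x - W.curryLeft x) := rfl
  simp only [schoutenAlt]
  rw [e, curryLeft_insertFirst_zero h g]
  simp [insertLast]

/-- The bracket of a function with a multivector is a contraction. -/
theorem schoutenAlt_zero_left {q : ℕ} (h : 0 + (q + 1) = q + 1) (P : A [⋀^Fin 0]→ₗ[ℝ] A)
    (Q : A [⋀^Fin (q + 1)]→ₗ[ℝ] A) : schoutenAlt h P Q = Q.curryLeft (P ![]) := by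
  rw [schoutenAlt, insertLast_zero]
  simp only [insertFirst, zero_sub, smul_neg, smul_smul, ← pow_add, ← neg_smul]
  have : (-1 : ℝ) ^ ((0 + 1) * (q + 1) + q) = -1 := Odd.neg_one_pow ⟨q, by ring⟩
  rw [this, neg_neg, one_smul]

/-- The bracket of a vector field with a function is the derivative. -/
theorem schoutenAlt_one_zero (h : 1 + 0 = 0 + 1) (P : A [⋀^Fin 1]→ₗ[ℝ] A)
    (Q : A [⋀^Fin 0]→ₗ[ℝ] A) : schoutenAlt h P Q ![] = P ![Q ![]] := by
  rw [schoutenAlt, AlternatingMap.smul_apply, AlternatingMap.sub_apply,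
    insertFirst_eq_shuffleSum h rfl, shuffleSum_zero]
  simp only [insertLast, AlternatingMap.zero_apply, sub_zero, mul_zero, pow_zero, one_smul]
  rfl

end Insert

/-! ### Cartan calculus for forms on derivations. -/

section FormCalculus
variable {A : Type*} [CommRing A] [Algebra ℝ A]

theorem removeNth_succ_cons {V : Type*} {k : ℕ} (i : Fin (k + 1)) (y : V) (w : Fin (k + 1) → V) :
    i.succ.removeNth (Fin.cons y w : Fin (k + 2) → V) =
      (Fin.cons y (i.removeNth w) : Fin (k + 1) → V) := by
  ext j : 1
  refine Fin.cases ?_ (fun j => ?_) j <;> simp [Fin.removeNth]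

theorem removeNth_zero_cons {V : Type*} {k : ℕ} (y : V) (w : Fin k → V) :
    (0 : Fin (k + 1)).removeNth (Fin.cons y w : Fin (k + 1) → V) = w := by
  ext l : 1; simp [Fin.removeNth]

theorem sum_Ici_succ {S : Type*} [AddCommMonoid S] {k : ℕ} (i : Fin k) (F : Fin (k + 1) → S) :
    ∑ j ≥ i.succ, F j = ∑ j ≥ i, F j.succ := by
  have h : Finset.Ici i.succ = (Finset.Ici i).map (Fin.succEmb k) := by
    ext j
    refine Fin.cases ?_ (fun j => ?_) j <;> simp
  rw [h, Finset.sum_map]; rfl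

/-- Cartan's formula in disguise: the terms of the Koszul formula in which `X` is differentiated
along or bracketed form the Lie derivative, and in the others `X` is a mere argument, which gives
minus the Koszul formula of `i_X α`. -/
theorem koszul_cons {k : ℕ} (α : Form A (k + 1)) (X : VField A) (w : Fin (k + 1) → VField A) :
    koszul α (Fin.cons X w) = X (α w) -
      (∑ j : Fin (k + 1), (-1) ^ (j : ℕ) * α (Fin.cons ⁅X, w j⁆ (j.removeNth w))) -
        koszul (α.curryLeft X) w := by
  have hI : Finset.Ici (0 : Fin (k + 1)) = Finset.univ := by ext; simp
  rw [koszul, Fin.sum_univ_succ (n := k + 1),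
    Fin.sum_univ_succ (fun i : Fin (k + 1) => ∑ j ≥ i, (-1) ^ (i + j : ℕ) * α (Matrix.vecCons
      ⁅(Fin.cons X w : Fin (k + 2) → VField A) i.castSucc,
        (Fin.cons X w : Fin (k + 2) → VField A) j.succ⁆
      (j.removeNth (i.castSucc.removeNth (Fin.cons X w : Fin (k + 2) → VField A))))), hI]
  simp only [removeNth_succ_cons, Fin.castSucc_zero, removeNth_zero_cons, Fin.cons_zero,
    Fin.cons_succ, Fin.val_zero, pow_zero, one_mul, zero_add, Fin.val_succ]
  have h1 : ∑ j : Fin (k + 1), (-1 : A) ^ (j : ℕ) * α (Matrix.vecCons ⁅X, w j⁆ (j.removeNth w)) =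
    ∑ j : Fin (k + 1), (-1) ^ (j : ℕ) * α (Fin.cons ⁅X, w j⁆ (j.removeNth w)) := rfl
  rw [h1]
  match k, α, w with
  | 0, α, w =>
    have s0 (F : Fin (0 + 1) → A) : ∑ i, F i = F 0 := Fin.sum_univ_one F
    have : (Fin.cons X ((0 : Fin (0 + 1)).removeNth w) : Fin (0 + 1) → VField A) =
        Matrix.vecCons X ![] := by
      congr 1; exact Subsingleton.elim _ _
    simp only [koszul, Fin.sum_univ_zero, s0, Fin.val_zero, zero_add, pow_one, this,
      AlternatingMap.curryLeft_apply_apply]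
    ring
  | k + 1, α, w =>
    simp only [koszul, sum_Ici_succ, ← Fin.succ_castSucc, removeNth_succ_cons, Fin.cons_succ,
      AlternatingMap.curryLeft_apply_apply]
    have h2 (i : Fin (k + 1)) (j : Fin (k + 1)) (u : Fin k → VField A) :
        α (Matrix.vecCons ⁅w i.castSucc, w j.succ⁆ (Fin.cons X u : Fin (k + 1) → VField A)) =
          -α (Matrix.vecCons X (Matrix.vecCons ⁅w i.castSucc, w j.succ⁆ u)) :=
      map_cons_cons_swap α _ _ _
    have h3 (i : Fin (k + 2)) : α (Fin.cons X (i.removeNth w)) =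
      α (Matrix.vecCons X (i.removeNth w)) := rfl
    simp only [h2, h3, pow_succ, mul_neg, mul_one, neg_mul, Finset.sum_neg_distrib, neg_neg,
      pow_add, Fin.val_succ]
    ring

theorem map_update_eq_cons {R M N : Type*} [CommRing R] [AddCommGroup M] [Module R M]
    [AddCommGroup N] [Module R N] {k : ℕ} (f : M [⋀^Fin (k + 1)]→ₗ[R] N) (w : Fin (k + 1) → M)
    (j : Fin (k + 1)) (x : M) :
    f (Function.update w j x) = (-1 : ℤ) ^ (j : ℕ) • f (Fin.cons x (j.removeNth w)) := by
  rw [← alt_insertNth, Fin.insertNth_removeNth]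

/-- Basis of the inductions on the degree: an identity in positive degree is checked after
contraction with an arbitrary field. -/
theorem form_ext {k : ℕ} {α β : Form A (k + 1)}
    (h : ∀ X : VField A, interior X k α = interior X k β) : α = β := by
  ext w
  have := DFunLike.congr_fun (h (w 0)) (Fin.tail w)
  change α (Fin.cons (w 0) (Fin.tail w)) = β (Fin.cons (w 0) (Fin.tail w)) at this
  rwa [Fin.cons_self_tail] at this

theorem form_zero_ext {α β : Form A 0} (h : α ![] = β ![]) : α = β := by
  ext w
  rw [Subsingleton.elim w ![], h]

theorem form_sub_smul {k : ℕ} (a b : A) (γ : Form A k) : (a - b) • γ = a • γ - b • γ :=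
  sub_smul a b γ

theorem interior_apply (X : VField A) {k : ℕ} (α : Form A (k + 1)) (w : Fin k → VField A) :
    interior X k α w = α (Fin.cons X w) := rfl

theorem interior_interior (X Y : VField A) {k : ℕ} (α : Form A (k + 2)) :
    interior X k (interior Y (k + 1) α) = -interior Y k (interior X (k + 1) α) := by
  ext w
  exact map_cons_cons_swap α Y X w

theorem interior_self (X : VField A) {k : ℕ} (α : Form A (k + 2)) :
    interior X k (interior X (k + 1) α) = 0 := by
  ext w
  refine α.map_eq_zero_of_eq _ (i := 0) (j := 1) rfl (by simp)

theorem interior_add (X Y : VField A) {k : ℕ} (α : Form A (k + 1)) :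
    interior (X + Y) k α = interior X k α + interior Y k α :=
  α.curryLeft.map_add X Y

theorem interior_sub (X Y : VField A) {k : ℕ} (α : Form A (k + 1)) :
    interior (X - Y) k α = interior X k α - interior Y k α :=
  α.curryLeft.map_sub X Y

theorem interior_neg (X : VField A) {k : ℕ} (α : Form A (k + 1)) :
    interior (-X) k α = -interior X k α :=
  α.curryLeft.map_neg X

theorem interior_smul (f : A) (X : VField A) {k : ℕ} (α : Form A (k + 1)) :
    interior (f • X) k α = f • interior X k α :=
  α.curryLeft.map_smul f X

/-- The Lie derivative of forms, given by Cartan's formula `L_X = i_X d + d i_X`. -/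
noncomputable def lieD (X : VField A) : ∀ k, Form A k →ₗ[ℝ] Form A k
  | 0 => (interior X 0).restrictScalars ℝ ∘ₗ d 0
  | k + 1 => (interior X (k + 1)).restrictScalars ℝ ∘ₗ d (k + 1) +
      d k ∘ₗ (interior X k).restrictScalars ℝ

theorem interior_d_zero (X : VField A) (f : Form A 0) : interior X 0 (d 0 f) = lieD X 0 f := rfl

theorem interior_d (X : VField A) {k : ℕ} (α : Form A (k + 1)) :
    interior X (k + 1) (d (k + 1) α) = lieD X (k + 1) α - d k (interior X k α) :=
  (add_sub_cancel_right _ _).symm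

theorem lieD_zero_apply (X : VField A) (f : Form A 0) : lieD X 0 f ![] = X (f ![]) := rfl

/-- In `i_X d + d i_X` the last term of `koszul_cons` cancels, and the bracket terms are the
classical ones. -/
theorem lieD_apply (X : VField A) {k : ℕ} (α : Form A k) (w : Fin k → VField A) :
    lieD X k α w = X (α w) - ∑ j, α (Function.update w j ⁅X, w j⁆) := by
  match k, α, w with
  | 0, α, w =>
    rw [Subsingleton.elim w ![]]; simp [lieD_zero_apply]
  | k + 1, α, w =>
    have h : lieD X (k + 1) α w = koszul α (Fin.cons X w) + koszul (α.curryLeft X) w := rfl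
    rw [h, koszul_cons, sub_add_cancel]
    congr 1
    refine Finset.sum_congr rfl fun j _ => ?_
    rw [map_update_eq_cons, zsmul_eq_mul]; push_cast; rfl

theorem interior_lieD (X Y : VField A) {k : ℕ} (α : Form A (k + 1)) :
    interior Y k (lieD X (k + 1) α) = lieD X k (interior Y k α) - interior ⁅X, Y⁆ k α := by
  ext w
  rw [AlternatingMap.sub_apply, interior_apply, interior_apply, lieD_apply, lieD_apply,
    Fin.sum_univ_succ]
  simp only [Fin.update_cons_zero, Fin.cons_zero, Fin.cons_succ, interior_apply, Fin.cons_update]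
  ring

theorem lieD_one_apply (X Y : VField A) (μ : Form A 1) :
    lieD X 1 μ ![Y] = X (μ ![Y]) - μ ![⁅X, Y⁆] := by
  have := DFunLike.congr_fun (interior_lieD X Y μ) ![]
  exact this

theorem lieD_smul (X : VField A) {k : ℕ} (f : A) (α : Form A k) :
    lieD X k (f • α) = X f • α + f • lieD X k α := by
  ext w
  simp only [lieD_apply, AlternatingMap.add_apply, AlternatingMap.smul_apply, smul_eq_mul,
    Derivation.leibniz, mul_sub, Finset.mul_sum]
  ring

/-- By induction after contraction; the additional terms agree by the Jacobi identity for vector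
fields. -/
theorem lieD_lieD (X Y : VField A) {k : ℕ} (α : Form A k) :
    lieD X k (lieD Y k α) = lieD Y k (lieD X k α) + lieD ⁅X, Y⁆ k α := by
  induction k with
  | zero =>
    refine form_zero_ext ?_
    simp [lieD_zero_apply, Derivation.commutator_apply]
  | succ k ih =>
    refine form_ext fun Z => ?_
    have hJ : ⁅X, ⁅Y, Z⁆⁆ = ⁅Y, ⁅X, Z⁆⁆ + ⁅⁅X, Y⁆, Z⁆ := by
      rw [leibniz_lie]; abel
    simp only [map_add, interior_lieD, map_sub, ih, hJ, interior_add]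
    abel

theorem lieD_d (X : VField A) {k : ℕ} (α : Form A k) :
    lieD X (k + 1) (d k α) = d k (lieD X k α) := by
  induction k with
  | zero =>
    refine form_ext fun Y => ?_
    simp only [interior_lieD, interior_d_zero]
    rw [lieD_lieD]; abel
  | succ k ih =>
    refine form_ext fun Y => ?_
    simp only [interior_lieD, interior_d, map_sub, ih]
    rw [lieD_lieD]; abel

/-- Cartan's formula twice gives `i_X d d α = L_X d α - d L_X α + d d i_X α`; the first two terms
cancel, and the last is the induction hypothesis. -/
theorem d_d {k : ℕ} (α : Form A k) : d (k + 1) (d k α) = 0 := by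
  induction k with
  | zero =>
    refine form_ext fun X => ?_
    rw [interior_d, interior_d_zero, lieD_d, sub_self, map_zero]
  | succ k ih =>
    refine form_ext fun X => ?_
    rw [interior_d, interior_d, lieD_d, map_sub, ih, map_zero]
    abel

/-- The wedge product with a `1`-form. -/
noncomputable def wedgeOne (μ : Form A 1) (k : ℕ) : Form A k →ₗ[A] Form A (k + 1) where
  toFun γ := wedge (Nat.add_comm 1 k) μ γ
  map_add' γ γ' := by
    ext v
    simp only [wedge_apply, AlternatingMap.add_apply, mul_add, smul_add, Finset.sum_add_distrib]
  map_smul' c γ := by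
    ext v
    simp only [wedge_apply, AlternatingMap.smul_apply, smul_eq_mul, RingHom.id_apply,
      mul_smul_comm, Finset.mul_sum, mul_left_comm _ c]

/-- The wedge product with a `2`-form. -/
noncomputable def wedgeTwo (ψ : Form A 2) (k : ℕ) : Form A k →ₗ[A] Form A (k + 2) where
  toFun γ := wedge (show 2 + k = k + 1 + 1 by omega) ψ γ
  map_add' γ γ' := by
    ext v
    simp only [wedge_apply, AlternatingMap.add_apply, mul_add, smul_add, Finset.sum_add_distrib]
  map_smul' c γ := by
    ext v
    simp only [wedge_apply, AlternatingMap.smul_apply, smul_eq_mul, RingHom.id_apply,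
      mul_smul_comm, Finset.mul_sum, mul_left_comm _ c]

theorem wedgeOne_add (μ ν : Form A 1) {k : ℕ} (γ : Form A k) :
    wedgeOne (μ + ν) k γ = wedgeOne μ k γ + wedgeOne ν k γ := by
  ext v
  simp only [wedgeOne, LinearMap.coe_mk, AddHom.coe_mk, wedge_apply, AlternatingMap.add_apply,
    add_mul, smul_add, Finset.sum_add_distrib]

theorem curry_zero_eq_func (μ : Form A 1) (X : VField A) : interior X 0 μ = func (μ ![X]) :=
  form_zero_ext rfl

theorem interior_wedgeOne_zero (X : VField A) (μ : Form A 1) (f : Form A 0) :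
    interior X 0 (wedgeOne μ 0 f) = μ ![X] • f := by
  refine (curryLeft_wedge_zero_right rfl _ μ f X).trans ?_
  ext w
  rw [wedge_zero_left]; rfl

theorem interior_wedgeOne (X : VField A) (μ : Form A 1) {k : ℕ} (γ : Form A (k + 1)) :
    interior X (k + 1) (wedgeOne μ (k + 1) γ) = μ ![X] • γ - wedgeOne μ k (interior X k γ) := by
  refine (curryLeft_wedge (Nat.zero_add _) (Nat.add_comm _ _) _ μ γ X).trans ?_
  ext w
  rw [show (-1 : ℝ) ^ (0 + 1) = -1 by norm_num, AlternatingMap.add_apply, AlternatingMap.smul_apply,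
    AlternatingMap.sub_apply, wedge_zero_left, neg_smul, one_smul, ← sub_eq_add_neg]; rfl

theorem interior_wedgeTwo_zero (X : VField A) (ψ : Form A 2) (f : Form A 0) :
    interior X 1 (wedgeTwo ψ 0 f) = wedgeOne (interior X 1 ψ) 0 f :=
  curryLeft_wedge_zero_right rfl _ ψ f X

theorem interior_wedgeTwo (X : VField A) (ψ : Form A 2) {k : ℕ} (γ : Form A (k + 1)) :
    interior X (k + 2) (wedgeTwo ψ (k + 1) γ) =
      wedgeOne (interior X 1 ψ) (k + 1) γ + wedgeTwo ψ k (interior X k γ) := by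
  refine (curryLeft_wedge (by omega) (by omega) _ ψ γ X).trans ?_
  rw [show (-1 : ℝ) ^ (1 + 1) = 1 by norm_num, one_smul]
  rfl

theorem wedgeOne_self (μ : Form A 1) {k : ℕ} (γ : Form A k) :
    wedgeOne μ (k + 1) (wedgeOne μ k γ) = 0 := by
  induction k with
  | zero =>
    refine form_ext fun X => ?_
    rw [interior_wedgeOne, interior_wedgeOne_zero, map_smul, sub_self, map_zero]
  | succ k ih =>
    refine form_ext fun X => ?_
    rw [interior_wedgeOne, interior_wedgeOne, map_sub, map_smul, ih, map_zero]
    abel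

theorem d_smul {k : ℕ} (f : A) (γ : Form A k) :
    d k (f • γ) = wedgeOne (d 0 (func f)) k γ + f • d k γ := by
  have hf (X : VField A) : d 0 (func f) ![X] = X f := rfl
  induction k with
  | zero =>
    refine form_ext fun X => ?_
    rw [map_add, (interior X 0).map_smul, interior_wedgeOne_zero, interior_d_zero, interior_d_zero, lieD_smul, hf]
  | succ k ih =>
    refine form_ext fun X => ?_
    rw [map_add, (interior X (k + 1)).map_smul, interior_wedgeOne, interior_d, interior_d, lieD_smul, hf, (interior X k).map_smul, ih,
      smul_sub]
    abel

theorem lieD_wedgeOne (X : VField A) (μ : Form A 1) {k : ℕ} (γ : Form A k) :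
    lieD X (k + 1) (wedgeOne μ k γ) = wedgeOne (lieD X 1 μ) k γ + wedgeOne μ k (lieD X k γ) := by
  induction k with
  | zero =>
    refine form_ext fun Y => ?_
    rw [interior_lieD, map_add]
    simp only [interior_wedgeOne_zero, lieD_smul, lieD_one_apply, form_sub_smul]
    abel
  | succ k ih =>
    refine form_ext fun Y => ?_
    rw [interior_lieD, map_add]
    simp only [interior_wedgeOne, interior_lieD, map_sub, lieD_smul, lieD_one_apply, form_sub_smul, ih]
    abel

theorem lieD_one_eq (X : VField A) (μ : Form A 1) :
    lieD X 1 μ = interior X 1 (d 1 μ) + d 0 (func (μ ![X])) := by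
  rw [interior_d, curry_zero_eq_func, sub_add_cancel]

theorem d_wedgeOne (μ : Form A 1) {k : ℕ} (γ : Form A k) :
    d (k + 1) (wedgeOne μ k γ) = wedgeTwo (d 1 μ) k γ - wedgeOne μ (k + 1) (d k γ) := by
  induction k with
  | zero =>
    refine form_ext fun X => ?_
    rw [interior_d, lieD_wedgeOne, interior_wedgeOne_zero, d_smul, map_sub,
      interior_wedgeTwo_zero, interior_wedgeOne, interior_d_zero, lieD_one_eq, wedgeOne_add]
    abel
  | succ k ih =>
    refine form_ext fun X => ?_
    rw [interior_d, lieD_wedgeOne, interior_wedgeOne, map_sub, d_smul, ih, map_sub,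
      interior_wedgeTwo, interior_wedgeOne, interior_d X γ, map_sub, lieD_one_eq, wedgeOne_add]
    abel

end FormCalculus

/-! ### Contraction of multivectors with differentials. -/

section MVCalculus
variable {A : Type*} [CommRing A] [Algebra ℝ A]

theorem mv_ext {k : ℕ} {P Q : MultiVector A k} (h : ∀ v, P.1 v = Q.1 v) : P = Q :=
  Subtype.ext (AlternatingMap.ext h)

/-- The contraction of a multivector with the differential of a function. -/
noncomputable def contr (f : A) {k : ℕ} (P : MultiVector A (k + 1)) : MultiVector A k :=
  mkMV (P.1.curryLeft f) (by
    intro v i g h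
    have := P.2 (Fin.cons f v) i.succ g h
    simp only [← Fin.cons_update] at this
    exact this)

theorem contr_apply (f : A) {k : ℕ} (P : MultiVector A (k + 1)) (v : Fin k → A) :
    (contr f P).1 v = P.1 (Fin.cons f v) := rfl

theorem mv_ext_contr {k : ℕ} {P Q : MultiVector A (k + 1)} (h : ∀ f, contr f P = contr f Q) :
    P = Q := by
  refine mv_ext fun v => ?_
  have := congrArg (fun R : MultiVector A k => R.1 (Fin.tail v)) (h (v 0))
  simpa only [contr_apply, Fin.cons_self_tail] using this

theorem contr_schouten {p q n : ℕ} (h : p + 1 + (q + 1) = n + 1 + 1)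
    (g : p + 1 + q = n + 1) (g' : p + (q + 1) = n + 1)
    (P : MultiVector A (p + 1)) (Q : MultiVector A (q + 1)) (f : A) :
    contr f (schouten h P Q) = (-1 : ℝ) ^ p • schouten g P (contr f Q) -
      schouten g' (contr f P) Q :=
  Subtype.ext (curryLeft_schoutenAlt h g g' P.1 Q.1 f)

theorem contr_schouten_zero {p n : ℕ} (h : p + 2 + 0 = n + 1 + 1) (g : p + 1 + 0 = n + 1)
    (P : MultiVector A (p + 2)) (Q : MultiVector A 0) (f : A) :
    contr f (schouten h P Q) = -schouten g (contr f P) Q :=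
  Subtype.ext (curryLeft_schoutenAlt_zero h g P.1 Q.1 f)

/-- Contracting `X` with `df` leaves the function `X f`, whose bracket with `Q` is again a
contraction. -/
theorem contr_schouten_vector {k : ℕ} (h : 1 + (k + 1) = k + 1 + 1) (g : 1 + k = k + 1)
    (X : VField A) (Q : MultiVector A (k + 1)) (f : A) :
    contr f (schouten h (ofVField X) Q) = schouten g (ofVField X) (contr f Q) - contr (X f) Q := by
  have e := contr_schouten (p := 0) (by omega) (by omega) (by omega) (ofVField X) Q f
  rw [pow_zero, one_smul] at e
  refine e.trans ?_
  congr 1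
  exact Subtype.ext (schoutenAlt_zero_left _ _ Q.1)

theorem schouten_vector_zero (h : 1 + 0 = 0 + 1) (X : VField A) (Q : MultiVector A 0) :
    (schouten h (ofVField X) Q).1 ![] = X (Q.1 ![]) :=
  schoutenAlt_one_zero h _ _

theorem contr_bivector (P : MultiVector A 2) (f : A) : contr f P = ofVField (sharpFun P f) := by
  refine mv_ext fun v => ?_
  have : v = ![v 0] := by ext i; fin_cases i; rfl
  rw [this]; rfl

/-- The contraction of a bivector with `df` is the field `#(df)`, so brackets with a bivector are
reduced to brackets with vector fields. -/
theorem contr_schouten_bivector {k : ℕ} (h : 2 + (k + 1) = k + 1 + 1 + 1) (g : 2 + k = k + 1 + 1)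
    (g' : 1 + (k + 1) = k + 1 + 1)
    (P : MultiVector A 2) (Q : MultiVector A (k + 1)) (f : A) :
    contr f (schouten h P Q) = -schouten g P (contr f Q) -
      schouten g' (ofVField (sharpFun P f)) Q := by
  have e := contr_schouten (p := 1) (by omega) (by omega) (by omega) P Q f
  rw [contr_bivector] at e
  refine e.trans ?_
  congr 1
  rw [pow_one]
  refine mv_ext fun v => ?_
  exact (neg_one_smul ℝ _)

theorem contr_schouten_bivector_zero (h : 2 + 0 = 0 + 1 + 1) (g : 1 + 0 = 0 + 1)
    (P : MultiVector A 2) (Q : MultiVector A 0) (f : A) :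
    contr f (schouten h P Q) = -schouten g (ofVField (sharpFun P f)) Q := by
  rw [← contr_bivector]
  exact contr_schouten_zero (p := 0) h g P Q f

end MVCalculus

/-! ### The operators `μ ∧ i_Z` and `ψ ∧ i_Z`. -/

section RankOne
variable {A : Type*} [CommRing A] [Algebra ℝ A]

/-- The operator `γ ↦ μ ∧ i_Z γ`, zero on functions. -/
noncomputable def wedgeInt (μ : Form A 1) (Z : VField A) : ∀ k, Form A k →ₗ[A] Form A k
  | 0 => 0
  | k + 1 => wedgeOne μ k ∘ₗ interior Z k

/-- The operator `γ ↦ ψ ∧ i_Z γ` for a `2`-form `ψ`, zero on functions. -/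
noncomputable def wedgeTwoInt (ψ : Form A 2) (Z : VField A) : ∀ k, Form A k →ₗ[A] Form A (k + 1)
  | 0 => 0
  | k + 1 => wedgeTwo ψ k ∘ₗ interior Z k

theorem wedgeInt_succ (μ : Form A 1) (Z : VField A) {k : ℕ} (γ : Form A (k + 1)) :
    wedgeInt μ Z (k + 1) γ = wedgeOne μ k (interior Z k γ) := rfl

theorem wedgeTwoInt_succ (ψ : Form A 2) (Z : VField A) {k : ℕ} (γ : Form A (k + 1)) :
    wedgeTwoInt ψ Z (k + 1) γ = wedgeTwo ψ k (interior Z k γ) := rfl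

theorem wedgeInt_zero (μ : Form A 1) (Z : VField A) (γ : Form A 0) :
    wedgeInt μ Z 0 γ = 0 := rfl

theorem wedgeTwoInt_zero (ψ : Form A 2) (Z : VField A) (γ : Form A 0) :
    wedgeTwoInt ψ Z 0 γ = 0 := rfl

/-- `i_Y` changes sign both when passing `μ` and when passing `i_Z`, so the operator commutes with
it up to `μ(Y) i_Z`. -/
theorem interior_wedgeInt (μ : Form A 1) (Y Z : VField A) {k : ℕ} (γ : Form A (k + 1)) :
    interior Y k (wedgeInt μ Z (k + 1) γ) =
      μ ![Y] • interior Z k γ + wedgeInt μ Z k (interior Y k γ) := by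
  match k, γ with
  | 0, γ => rw [wedgeInt_succ, interior_wedgeOne_zero, wedgeInt_zero, add_zero]
  | k + 1, γ =>
    rw [wedgeInt_succ, interior_wedgeOne, interior_interior, wedgeInt_succ, map_neg, sub_neg_eq_add]

theorem interior_wedgeTwoInt (ψ : Form A 2) (Y Z : VField A) {k : ℕ} (γ : Form A (k + 1)) :
    interior Y (k + 1) (wedgeTwoInt ψ Z (k + 1) γ) =
      wedgeInt (interior Y 1 ψ) Z (k + 1) γ - wedgeTwoInt ψ Z k (interior Y k γ) := by
  match k, γ with
  | 0, γ => rw [wedgeTwoInt_succ, interior_wedgeTwo_zero, wedgeTwoInt_zero, sub_zero]; rfl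
  | k + 1, γ =>
    rw [wedgeTwoInt_succ, interior_wedgeTwo, interior_interior, wedgeTwoInt_succ, map_neg,
      ← sub_eq_add_neg]
    rfl

end RankOne

/-! ### The Reeb field, the fields `X_f = ♭⁻¹(df)` and their brackets. -/

section ContactAlgebra
variable {A : Type*} [CommRing A] [Algebra ℝ A] {η : Form A 1}

/-- The algebraic properties of a contact form from which its Jacobi structure is computed. -/
structure IsContactAlg (η : Form A 1) : Prop where
  flat_bijective : Function.Bijective (flat η)
  eta_reeb : η ![reeb η] = 1
  form_eq_zero : ∀ {k : ℕ} (γ : Form A k),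
    (∀ f : Fin k → A, γ (fun i => flatInvD η (f i)) = 0) → γ = 0

/-- The `k`-vector corresponding to a `k`-form under `♭`. -/
noncomputable def theta (η : Form A 1) (k : ℕ) : Form A k →ₗ[A] MultiVector A k where
  toFun γ := mkMV ((realAlt γ).compLinearMap (flatInvD η))
    (compLinearMap_mem γ _ (flatInvD_mul η))
  map_add' _ _ := rfl
  map_smul' _ _ := rfl

theorem theta_apply {k : ℕ} (γ : Form A k) (v : Fin k → A) :
    (theta η k γ).1 v = γ (fun i => flatInvD η (v i)) := rfl

theorem theta_smul_real {k : ℕ} (c : ℝ) (γ : Form A k) :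
    theta η k (c • γ) = c • theta η k γ := rfl

theorem contr_theta (f : A) {k : ℕ} (γ : Form A (k + 1)) :
    contr f (theta η (k + 1) γ) = theta η k (interior (flatInvD η f) k γ) := by
  refine mv_ext fun v => ?_
  rw [contr_apply, theta_apply, theta_apply, interior_apply]
  congr 1
  ext1 i
  refine Fin.cases ?_ (fun i => ?_) i <;> rfl

theorem contactBivector_eq : contactBivector η = theta η 2 (d 1 η) := rfl

theorem wedge_theta {k l n : ℕ} (h : k + l = n) (a : Form A k) (b : Form A l) :
    wedgeMV h (theta η k a) (theta η l b) = theta η n (wedge h a b) := by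
  refine mv_ext fun v => ?_
  rw [theta_apply, wedge_apply]
  exact wedge_apply h _ _ v

theorem flat_apply (X Y : VField A) : flat η X ![Y] = d 1 η ![X, Y] + η ![X] * η ![Y] := rfl

theorem flat_eq (X : VField A) : flat η X = interior X 1 (d 1 η) + η ![X] • η := rfl

theorem two_form_swap (ψ : Form A 2) (X Y : VField A) : ψ ![Y, X] = -ψ ![X, Y] :=
  map_cons_cons_swap ψ Y X ![]

theorem two_form_self (ψ : Form A 2) (X : VField A) : ψ ![X, X] = 0 :=
  ψ.map_eq_zero_of_eq _ (i := 0) (j := 1) rfl (by simp)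

theorem bivector_apply (f g : A) :
    sharpFun (contactBivector η) f g = d 1 η ![flatInvD η f, flatInvD η g] := by
  change d 1 η (fun i => flatInvD η (![f, g] i)) = _
  congr 1
  ext1 i
  fin_cases i <;> rfl

theorem d_func_mul (f g : A) : d 0 (func (f * g)) = f • d 0 (func g) + g • d 0 (func f) := by
  ext X
  exact (X 0).leibniz f g

theorem wedgeOne_func (μ : Form A 1) (b : A) : wedgeOne μ 0 (func b) = b • μ := by
  refine form_ext fun X => form_zero_ext ?_
  rw [interior_wedgeOne_zero]
  exact mul_comm _ _

namespace IsContactAlg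
variable (hc : IsContactAlg η)
include hc

theorem flat_flatInv (α : Form A 1) : flat η (flatInv η α) = α := by
  rw [flatInv, dif_pos hc.flat_bijective]
  exact (LinearEquiv.ofBijective (flat η) hc.flat_bijective).apply_symm_apply α

theorem flat_reeb : flat η (reeb η) = η := hc.flat_flatInv η

theorem flat_ham (f : A) : flat η (flatInvD η f) = d 0 (func f) := hc.flat_flatInv _

/-- Since `η(E) = 1`, the equation `♭(E) = η` reads `i_E dη + η = η`. -/
theorem interior_reeb_d : interior (reeb η) 1 (d 1 η) = 0 := by
  have h := hc.flat_reeb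
  rw [flat_eq, hc.eta_reeb, one_smul] at h
  simpa using h

theorem d_reeb_left (Y : VField A) : d 1 η ![reeb η, Y] = 0 :=
  DFunLike.congr_fun hc.interior_reeb_d ![Y]

theorem d_reeb_right (Y : VField A) : d 1 η ![Y, reeb η] = 0 := by
  rw [two_form_swap, hc.d_reeb_left, neg_zero]

theorem flat_ham_apply (f : A) (Y : VField A) :
    d 1 η ![flatInvD η f, Y] + η ![flatInvD η f] * η ![Y] = Y f :=
  DFunLike.congr_fun (hc.flat_ham f) ![Y]

theorem eta_ham (f : A) : η ![flatInvD η f] = reeb η f := by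
  have := hc.flat_ham_apply f (reeb η)
  rwa [hc.d_reeb_right, hc.eta_reeb, zero_add, mul_one] at this

theorem lieD_reeb_eta : lieD (reeb η) 1 η = 0 := by
  rw [lieD_one_eq, hc.interior_reeb_d, hc.eta_reeb, zero_add]
  refine form_ext fun X => form_zero_ext ?_
  exact X.map_one_eq_zero

theorem lieD_reeb_d_eta : lieD (reeb η) 2 (d 1 η) = 0 := by
  rw [lieD_d, hc.lieD_reeb_eta, map_zero]

theorem interior_ham_d (f : A) :
    interior (flatInvD η f) 1 (d 1 η) = d 0 (func f) - η ![flatInvD η f] • η := by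
  rw [← hc.flat_ham, flat_eq, add_sub_cancel_right]

theorem flat_injective {X Y : VField A} (h : flat η X = flat η Y) : X = Y :=
  hc.flat_bijective.1 h

/-- The Reeb field preserves `η` and `dη`, hence `♭`, and so commutes with `f ↦ ♭⁻¹(df)`. -/
theorem lie_reeb_ham (f : A) : ⁅reeb η, flatInvD η f⁆ = flatInvD η (reeb η f) := by
  refine hc.flat_injective ?_
  have h1 := interior_lieD (reeb η) (flatInvD η f) (d 1 η)
  rw [hc.lieD_reeb_d_eta, map_zero, eq_comm, sub_eq_zero, hc.interior_ham_d, map_sub, lieD_d,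
    lieD_smul, hc.lieD_reeb_eta] at h1
  have h2 := lieD_one_apply (reeb η) (flatInvD η f) η
  rw [hc.lieD_reeb_eta, AlternatingMap.zero_apply, eq_comm, sub_eq_zero] at h2
  rw [hc.flat_ham, flat_eq, ← h1, ← h2, smul_zero, add_zero, sub_add_cancel]
  congr 1

/-- By skew-symmetry `Λ(df, dg) = -dη(X_g, X_f)`, and `♭(X_g) = dg` evaluated on `X_f` gives this
value. Thus `-#(df)` is the part of `X_f` in the kernel of `η`. -/
theorem sharpFun_eq (f : A) :
    sharpFun (contactBivector η) f = η ![flatInvD η f] • reeb η - flatInvD η f := by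
  ext g
  rw [bivector_apply, two_form_swap]
  have := hc.flat_ham_apply g (flatInvD η f)
  rw [hc.eta_ham g] at this
  simp only [Derivation.coe_sub, Derivation.coe_smul, Pi.sub_apply, Pi.smul_apply, smul_eq_mul]
  linear_combination -this

/-- The Hamiltonian-type field of the bracket `Λ(df, dg)`. -/
theorem ham_bracket (f g : A) :
    flatInvD η (sharpFun (contactBivector η) f g) =
      -⁅flatInvD η f, flatInvD η g⁆ + η ![flatInvD η f] • ⁅reeb η, flatInvD η g⁆ -
        η ![flatInvD η g] • ⁅reeb η, flatInvD η f⁆ -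
        d 1 η ![flatInvD η f, flatInvD η g] • reeb η + η ![flatInvD η f] • flatInvD η g -
        η ![flatInvD η g] • flatInvD η f := by
  -- Under `♭` every term except the one with `[X_f, X_g]` becomes an explicit `1`-form.
  refine hc.flat_injective ?_
  rw [hc.flat_ham, bivector_apply]
  simp only [map_add, map_sub, map_neg, map_smul, hc.lie_reeb_ham, hc.flat_ham, hc.flat_reeb,
    ← hc.eta_ham]
  have hXg := hc.flat_ham_apply g (flatInvD η f)
  rw [two_form_swap] at hXg
  have hLX := lieD_one_eq (flatInvD η f) η
  have hbr := lieD_one_apply (flatInvD η f) (flatInvD η g) η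
  have hbr' := DFunLike.congr_fun hLX ![flatInvD η g]
  rw [hbr] at hbr'
  have hi := hc.interior_ham_d f
  have hj := hc.interior_ham_d g
  -- With `X = X_f`, `Y = X_g`, the commutator of `L_X` and `i_Y` on `dη` yields `i_[X,Y] dη`. Since
  -- `i_X dη = df - η(X) η`, `L_X dη = -d(η(X) η)`, so all other terms are known.
  have key := interior_lieD (flatInvD η f) (flatInvD η g) (d 1 η)
  rw [lieD_d, hLX, map_add, d_d, add_zero, hi, map_sub, d_d, zero_sub, d_smul, hj, map_sub,
    lieD_d, lieD_smul, hLX, hi, map_neg, map_add, (interior (flatInvD η g) 1).map_smul, hj,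
    interior_wedgeOne, curry_zero_eq_func, wedgeOne_func] at key
  have hX : lieD (flatInvD η f) 0 (func g) = func (flatInvD η f g) := rfl
  rw [hX, ← hXg] at key
  have hd (a b c : A) : d 0 (func (-c + a * b)) =
      -d 0 (func c) + (a • d 0 (func b) + b • d 0 (func a)) := by
    rw [← d_func_mul, ← map_neg, ← map_add]; rfl
  rw [hd] at key
  have hYa (a : A) (Y : VField A) : d 0 (func a) ![Y] = Y a := rfl
  rw [hYa] at key
  rw [AlternatingMap.add_apply, hYa] at hbr'
  change _ = d 1 η ![flatInvD η f, flatInvD η g] + _ at hbr'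
  rw [flat_eq]
  generalize flatInvD η f = X at *
  generalize flatInvD η g = Y at *
  -- The other half of `♭[X, Y]`, from the two expressions for `(L_X η)(Y)`.
  have hn : η ![⁅X, Y⁆] = X (η ![Y]) - Y (η ![X]) - d 1 η ![X, Y] := by
    linear_combination -hbr'
  rw [hn]
  generalize interior ⁅X, Y⁆ 1 (d 1 η) = W at *
  have key' := eq_sub_of_add_eq' (eq_sub_iff_add_eq.1 key)
  rw [key']
  module

end IsContactAlg
end ContactAlgebra

/-! ### Transport of brackets, `#` and multivectors to forms. -/

section Transport
variable {A : Type*} [CommRing A] [Algebra ℝ A] {η : Form A 1}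

/-- The operator on forms which corresponds to the bracket with `Λ`:
`γ ↦ dγ - η ∧ L_E γ + k η ∧ γ - dη ∧ i_E γ`. -/
noncomputable def delta (η : Form A 1) (k : ℕ) (γ : Form A k) : Form A (k + 1) :=
  d k γ - wedgeOne η k (lieD (reeb η) k γ) + (k : ℝ) • wedgeOne η k γ -
    wedgeTwoInt (d 1 η) (reeb η) k γ

/-- The operator on forms which corresponds to minus the Lie derivative along `#(df)`, where
`X = ♭⁻¹(df)`. -/
noncomputable def hamOp (η : Form A 1) (X : VField A) (k : ℕ) (γ : Form A k) : Form A k :=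
  lieD X k γ - η ![X] • lieD (reeb η) k γ - wedgeInt η ⁅reeb η, X⁆ k γ -
    wedgeInt (interior X 1 (d 1 η)) (reeb η) k γ + (k : ℝ) • η ![X] • γ - wedgeInt η X k γ

theorem theta_zero_apply (γ : Form A 0) (v : Fin 0 → A) : (theta η 0 γ).1 v = γ ![] := by
  rw [theta_apply]; congr 1; exact Subsingleton.elim _ _

theorem theta_wedgeOne {k : ℕ} (γ : Form A k) (h : 1 + k = k + 1) :
    theta η (k + 1) (wedgeOne η k γ) = wedgeMV h (theta η 1 η) (theta η k γ) :=
  (wedge_theta h η γ).symm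

theorem theta_wedgeTwo {k : ℕ} (γ : Form A k) (h : 2 + k = k + 1 + 1) :
    theta η (k + 2) (wedgeTwo (d 1 η) k γ) = wedgeMV h (contactBivector η) (theta η k γ) :=
  (wedge_theta h (d 1 η) γ).symm

/-- Mirror image of `contr_schouten_bivector`, valid for any field `X`. -/
theorem interior_delta (X : VField A) {k : ℕ} (γ : Form A (k + 1)) :
    interior X (k + 1) (delta η (k + 1) γ) =
      hamOp η X (k + 1) γ - delta η k (interior X k γ) := by
  have hs (c : ℝ) (α : Form A (k + 2)) : interior X (k + 1) (c • α) = c • interior X (k + 1) α :=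
    rfl
  simp only [delta, hamOp, map_sub, map_add, hs, interior_d, interior_wedgeOne, interior_lieD,
    interior_wedgeTwoInt, wedgeInt_succ]
  push_cast
  module

theorem interior_delta_zero (X : VField A) (γ : Form A 0) :
    interior X 0 (delta η 0 γ) = hamOp η X 0 γ := by
  have hs (c : ℝ) (α : Form A 1) : interior X 0 (c • α) = c • interior X 0 α := rfl
  simp only [delta, hamOp, map_sub, map_add, hs, interior_d_zero, interior_wedgeOne_zero,
    wedgeInt_zero, wedgeTwoInt_zero, map_zero]
  module

/-- Mirror image of `contr_schouten_vector`: for `X = X_f` and `Y = X_g` the field contracted in the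
last term is `X_{Λ(df, dg)}` by `ham_bracket`. -/
theorem interior_hamOp (X Y : VField A) {k : ℕ} (γ : Form A (k + 1)) :
    interior Y k (hamOp η X (k + 1) γ) = hamOp η X k (interior Y k γ) +
      interior (-⁅X, Y⁆ + η ![X] • ⁅reeb η, Y⁆ - η ![Y] • ⁅reeb η, X⁆ -
        d 1 η ![X, Y] • reeb η + η ![X] • Y - η ![Y] • X) k γ := by
  have hs (c : ℝ) (α : Form A (k + 1)) : interior Y k (c • α) = c • interior Y k α := rfl
  have hd : interior X 1 (d 1 η) ![Y] = d 1 η ![X, Y] := rfl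
  have hm (f : A) (α : Form A (k + 1)) : interior Y k (f • α) = f • interior Y k α := rfl
  simp only [hamOp, map_sub, map_add, hs, hm, interior_lieD, interior_wedgeInt, interior_add,
    interior_sub, interior_neg, interior_smul, hd]
  push_cast
  module

namespace IsContactAlg
variable (hc : IsContactAlg η)
include hc

theorem ofVField_reeb : ofVField (reeb η) = theta η 1 η := by
  refine mv_ext fun v => ?_
  have : v = ![v 0] := by ext i; fin_cases i; rfl
  rw [this]
  refine (hc.eta_ham (v 0)).symm.trans ?_
  rw [theta_apply]
  congr 1
  ext1 i
  fin_cases i; rfl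

theorem wedgeE_theta {k : ℕ} (γ : Form A k) :
    wedgeE (reeb η) k (theta η k γ) = theta η (k + 1) (wedgeOne η k γ) := by
  rw [theta_wedgeOne γ (Nat.add_comm 1 k), wedgeE, hc.ofVField_reeb]

/-- Both sides satisfy the same recursion under contraction with `df`, because `[E, X_f] = X_{E f}`.
-/
theorem schouten_reeb_theta {k : ℕ} (h : 1 + k = k + 1) (γ : Form A k) :
    schouten h (ofVField (reeb η)) (theta η k γ) = theta η k (lieD (reeb η) k γ) := by
  induction k with
  | zero =>
    refine mv_ext fun v => ?_
    rw [Subsingleton.elim v ![]]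
    refine (schouten_vector_zero h (reeb η) (theta η 0 γ)).trans ?_
    exact (congrArg (reeb η) (theta_zero_apply γ _)).trans
      (theta_zero_apply (η := η) (lieD (reeb η) 0 γ) ![]).symm
  | succ k ih =>
    refine mv_ext_contr fun f => ?_
    rw [contr_schouten_vector h (Nat.add_comm 1 k), contr_theta, contr_theta, contr_theta, ih,
      interior_lieD, map_sub, hc.lie_reeb_ham]

theorem schouten_sharpFun_theta {k : ℕ} (h : 1 + k = k + 1) (f : A) (γ : Form A k) :
    -schouten h (ofVField (sharpFun (contactBivector η) f)) (theta η k γ) =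
      theta η k (hamOp η (flatInvD η f) k γ) := by
  induction k with
  | zero =>
    refine mv_ext fun v => ?_
    rw [Subsingleton.elim v ![]]
    refine (congrArg Neg.neg (schouten_vector_zero h _ _)).trans ?_
    rw [hc.sharpFun_eq]
    have h0 : hamOp η (flatInvD η f) 0 γ =
        lieD (flatInvD η f) 0 γ - η ![flatInvD η f] • lieD (reeb η) 0 γ := by
      simp only [hamOp, wedgeInt_zero]
      module
    rw [h0]
    refine (congrArg (fun x => -(η ![flatInvD η f] • reeb η - flatInvD η f) x)
      (theta_zero_apply γ ![])).trans
      (Eq.trans ?_ (theta_zero_apply (η := η) _ ![]).symm)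
    rw [AlternatingMap.sub_apply, AlternatingMap.smul_apply, lieD_zero_apply, lieD_zero_apply]
    exact neg_sub _ _
  | succ k ih =>
    refine mv_ext_contr fun g => ?_
    have hn (P : MultiVector A (k + 1)) : contr g (-P) = -contr g P := rfl
    rw [hn, contr_schouten_vector h (Nat.add_comm 1 k), contr_theta, contr_theta, contr_theta,
      interior_hamOp, map_add, ← ih (Nat.add_comm 1 k), ← hc.ham_bracket, neg_sub, sub_eq_neg_add]

/-- Key formula. Contraction with `df` on the left is contraction with `X_f` on the right; the
recursions agree by `schouten_sharpFun_theta`, and in degree zero only that lemma is left. -/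
theorem schouten_bivector_theta {k : ℕ} (h : 2 + k = k + 1 + 1) (γ : Form A k) :
    schouten h (contactBivector η) (theta η k γ) = theta η (k + 1) (delta η k γ) := by
  induction k with
  | zero =>
    refine mv_ext_contr fun f => ?_
    rw [contr_schouten_bivector_zero h rfl, contr_theta, interior_delta_zero,
      hc.schouten_sharpFun_theta]
  | succ k ih =>
    refine mv_ext_contr fun f => ?_
    rw [contr_schouten_bivector h (by omega) (by omega), contr_theta, contr_theta, ih,
      interior_delta, map_sub, ← hc.schouten_sharpFun_theta (by omega)]
    abel

/-- The sign `(-1)^k` turns each `#(df) = η(X_f) E - X_f` into the horizontal part of `X_f`;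
evaluating `γ` on horizontal parts is evaluating its horizontal part. -/
theorem sharp_eq {k : ℕ} (γ : Form A k) :
    sharp (contactBivector η) k γ = theta η k (γ - wedgeInt η (reeb η) k γ) := by
  induction k with
  | zero =>
    refine mv_ext fun v => ?_
    rw [wedgeInt_zero, sub_zero, theta_apply]
    refine (one_smul ℝ _).trans ?_
    change γ _ = γ _
    congr 1
    exact Subsingleton.elim _ _
  | succ k ih =>
    refine mv_ext_contr fun f => ?_
    have h1 : contr f (sharp (contactBivector η) (k + 1) γ) =
        -sharp (contactBivector η) k
          (interior (sharpFun (contactBivector η) f) k γ) := by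
      refine mv_ext fun v => ?_
      have e : (fun i => sharpFun (contactBivector η) ((Fin.cons f v : Fin (k + 1) → A) i)) =
          (Fin.cons (sharpFun (contactBivector η) f)
            (fun i => sharpFun (contactBivector η) (v i)) : Fin (k + 1) → VField A) := by
        ext1 i
        refine Fin.cases ?_ (fun i => ?_) i <;> rfl
      change ((-1) ^ (k + 1) : ℝ) • γ (fun i =>
        sharpFun (contactBivector η) ((Fin.cons f v : Fin (k + 1) → A) i)) =
        -(((-1) ^ k : ℝ) • γ (Fin.cons (sharpFun (contactBivector η) f)
            (fun i => sharpFun (contactBivector η) (v i))))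
      rw [e, pow_succ, mul_neg_one, neg_smul]
    have h2 : wedgeInt η (reeb η) k (interior (reeb η) k γ) = 0 := by
      match k, γ with
      | 0, γ => rfl
      | k + 1, γ => rw [wedgeInt_succ, interior_self, map_zero]
    rw [h1, ih, contr_theta, hc.sharpFun_eq, ← map_neg, map_sub, interior_wedgeInt]
    simp only [interior_sub, interior_smul, map_sub, map_smul, h2]
    simp only [← map_sub, ← map_smul, smul_zero]
    congr 1
    module

/-- On `dη`, which is closed and annihilated by `L_E` and `i_E`, only the degree term of `delta`
survives, with the factor `k = 2`. -/
theorem isJacobi : IsJacobi (contactBivector η) (reeb η) := by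
  constructor
  · refine (hc.schouten_bivector_theta (k := 2) rfl (d 1 η)).trans ?_
    rw [hc.ofVField_reeb, contactBivector_eq, ← theta_wedgeOne]
    have : delta η 2 (d 1 η) = (2 : ℝ) • wedgeOne η 2 (d 1 η) := by
      rw [delta, d_d, hc.lieD_reeb_d_eta, map_zero, wedgeTwoInt_succ, hc.interior_reeb_d, map_zero,
        Nat.cast_ofNat]
      module
    rw [this]; rfl
  · rw [contactBivector_eq, hc.schouten_reeb_theta, hc.lieD_reeb_d_eta, map_zero]

theorem theta_injective (k : ℕ) : Function.Injective (theta η k) := by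
  rw [← LinearMap.ker_eq_bot, LinearMap.ker_eq_bot']
  intro γ h
  refine hc.form_eq_zero γ fun f => ?_
  have := congrArg (fun P : MultiVector A k => P.1 f) h
  exact this

end IsContactAlg

/-- The contraction of a multivector with a `1`-form. -/
noncomputable def contrForm {k : ℕ} (P : MultiVector A (k + 1)) :
    Form A 1 →ₗ[A] MultiVector A k :=
  have hm (v : Fin k → A) (i : Fin k) (f x : A) :
      (Fin.cons f (Function.update v i x) : Fin (k + 1) → A) =
        Function.update (Fin.cons f v : Fin (k + 1) → A) i.succ x := by rw [Fin.cons_update]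
  let D (v : Fin k → A) : VField A := Derivation.mk'
    { toFun := fun f => P.1 (Fin.cons f v)
      map_add' := fun f g => P.1.map_vecCons_add v f g
      map_smul' := fun c f => P.1.map_vecCons_smul v c f }
    (fun f g => by
      have := P.2 (Fin.cons 0 v) 0 f g
      simp only [Fin.update_cons_zero] at this
      exact this)
  let DD : A [⋀^Fin k]→ₗ[ℝ] VField A :=
    { toFun := D
      map_update_add' := fun v i x y => by
        ext f
        have := (P.1.curryLeft f).map_update_add v i x y
        exact this
      map_update_smul' := fun v i c x => by
        ext f
        have := (P.1.curryLeft f).map_update_smul v i c x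
        exact this
      map_eq_zero_of_eq' := fun v i j h hij => by
        ext f
        exact (P.1.curryLeft f).map_eq_zero_of_eq v h hij }
  let ev (α : Form A 1) : VField A →ₗ[A] A :=
    { toFun := fun X => α ![X]
      map_add' := fun X Y => α.map_vecCons_add ![] X Y
      map_smul' := fun f X => α.map_vecCons_smul ![] f X }
  { toFun := fun α => mkMV (((ev α).restrictScalars ℝ).compAlternatingMap DD) (by
      intro v i f g
      have : D (Function.update v i (f * g)) =
          f • D (Function.update v i g) + g • D (Function.update v i f) := by
        ext x
        change P.1 _ = f * P.1 _ + g * P.1 _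
        rw [hm, hm, hm]
        exact P.2 _ _ f g
      change ev α (D _) = f * ev α (D _) + g * ev α (D _)
      rw [this, map_add, map_smul, map_smul]; rfl)
    map_add' := fun _ _ => rfl
    map_smul' := fun _ _ => rfl }

theorem contrForm_d {k : ℕ} (P : MultiVector A (k + 1)) (f : A) :
    contrForm P (d 0 (func f)) = contr f P := rfl

/-- For surjectivity, the contractions of `P` with the forms `♭(Y)` come from `k`-forms by
induction; these depend linearly on `Y` and are assembled into a `(k + 1)`-form. -/
theorem IsContactAlg.theta_bijective (hc : IsContactAlg η) (k : ℕ) :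
    Function.Bijective (theta η k) := by
  induction k with
  | zero =>
    refine ⟨hc.theta_injective 0, fun P => ⟨func (P.1 ![]), mv_ext fun v => ?_⟩⟩
    rw [Subsingleton.elim v ![]]; rfl
  | succ k ih =>
    refine ⟨hc.theta_injective _, fun P => ?_⟩
    let T : VField A →ₗ[A] Form A k :=
      (LinearEquiv.ofBijective (theta η k) ih).symm.toLinearMap ∘ₗ contrForm P ∘ₗ flat η
    have hT (Y : VField A) : theta η k (T Y) = contrForm P (flat η Y) :=
      (LinearEquiv.ofBijective (theta η k) ih).apply_symm_apply _
    -- Alternation makes `T` a form; on the fields `X_f` each of its `k + 1` signed terms already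
    -- equals the value of `P`, hence the factor.
    refine ⟨((k + 1 : ℕ) : ℝ)⁻¹ • AlternatingMap.alternatizeUncurryFin T, mv_ext fun v => ?_⟩
    rw [theta_smul_real]
    change ((k + 1 : ℕ) : ℝ)⁻¹ •
      (AlternatingMap.alternatizeUncurryFin T (fun i => flatInvD η (v i))) = P.1 v
    rw [AlternatingMap.alternatizeUncurryFin_apply]
    have h (i : Fin (k + 1)) : (-1 : ℤ) ^ (i : ℕ) • T (flatInvD η (v i))
        (i.removeNth fun i => flatInvD η (v i)) = P.1 v := by
      have h1 : T (flatInvD η (v i)) (i.removeNth fun i => flatInvD η (v i)) =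
        (theta η k (T (flatInvD η (v i)))).1 (i.removeNth v) := rfl
      rw [h1, hT, hc.flat_ham, contrForm_d, contr_apply, ← alt_insertNth, Fin.insertNth_self_removeNth]
    simp only [h, Finset.sum_const, Finset.card_univ, Fintype.card_fin]
    rw [← Nat.cast_smul_eq_nsmul ℝ, smul_smul, inv_mul_cancel₀ (by positivity), one_smul]

end Transport

/-! ### `F̃` and `σ` on the side of forms. -/

section ReebOperators
variable {A : Type*} [CommRing A] [Algebra ℝ A] {η : Form A 1}
theorem wedgeOne_wedgeInt {k : ℕ} (γ : Form A k) (Z : VField A) :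
    wedgeOne η k (wedgeInt η Z k γ) = 0 := by
  match k, γ with
  | 0, γ => rw [wedgeInt_zero, map_zero]
  | k + 1, γ => rw [wedgeInt_succ, wedgeOne_self]

theorem pairD_pairD (k : ℕ) (x : PairForm A k) : pairD (k + 1) (pairD k x) = 0 := by
  obtain ⟨α, β⟩ := x
  refine Prod.ext ?_ ?_
  · change -d (k + 1) (-d k α) = 0
    rw [map_neg, d_d, neg_zero, neg_zero]
  · match k, β with
    | 0, β => exact map_zero (d 0)
    | k + 1, β => exact d_d (A := A) (k := k) β

theorem wedgeInt_d {k : ℕ} (β : Form A k) :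
    d k (wedgeInt η (reeb η) k β) - wedgeTwoInt (d 1 η) (reeb η) k β +
      wedgeOne η k (lieD (reeb η) k β) = wedgeInt η (reeb η) (k + 1) (d k β) := by
  match k, β with
  | 0, β =>
    rw [wedgeInt_zero, wedgeTwoInt_zero, map_zero, sub_zero]
    exact zero_add (wedgeOne η 0 (lieD (reeb η) 0 β))
  | k + 1, β =>
    rw [wedgeInt_succ, wedgeTwoInt_succ, d_wedgeOne, wedgeInt_succ, interior_d, map_sub]
    abel

namespace IsContactAlg
variable (hc : IsContactAlg η)
include hc

theorem interior_reeb_wedgeOne_zero (γ : Form A 0) :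
    interior (reeb η) 0 (wedgeOne η 0 γ) = γ := by
  rw [interior_wedgeOne_zero, hc.eta_reeb, one_smul]

theorem interior_reeb_wedgeOne {k : ℕ} (γ : Form A k) :
    interior (reeb η) k (wedgeOne η k γ) = γ - wedgeInt η (reeb η) k γ := by
  match k, γ with
  | 0, γ => rw [hc.interior_reeb_wedgeOne_zero, wedgeInt_zero, sub_zero]
  | k + 1, γ => rw [interior_wedgeOne, hc.eta_reeb, one_smul, wedgeInt_succ]

theorem interior_reeb_wedgeInt {k : ℕ} (γ : Form A (k + 1)) :
    interior (reeb η) k (wedgeInt η (reeb η) (k + 1) γ) = interior (reeb η) k γ := by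
  have h : wedgeInt η (reeb η) k (interior (reeb η) k γ) = 0 := by
    match k, γ with
    | 0, γ => rfl
    | k + 1, γ => rw [wedgeInt_succ, interior_self, map_zero]
  rw [interior_wedgeInt, hc.eta_reeb, one_smul, h, add_zero]

theorem wedgeInt_wedgeOne {k : ℕ} (γ : Form A k) :
    wedgeInt η (reeb η) (k + 1) (wedgeOne η k γ) = wedgeOne η k γ := by
  rw [wedgeInt_succ, hc.interior_reeb_wedgeOne, map_sub]
  match k, γ with
  | 0, γ => rw [wedgeInt_zero, map_zero, sub_zero]
  | k + 1, γ => rw [wedgeInt_succ, wedgeOne_self, sub_zero]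

theorem lieD_reeb_wedgeOne {k : ℕ} (γ : Form A k) :
    lieD (reeb η) (k + 1) (wedgeOne η k γ) = wedgeOne η k (lieD (reeb η) k γ) := by
  have h0 : wedgeOne (0 : Form A 1) k (lieD (reeb η) k γ) = 0 := by
    simpa using wedgeOne_add 0 0 (lieD (reeb η) k γ)
  have h0' : wedgeOne (0 : Form A 1) k γ = 0 := by
    simpa using wedgeOne_add 0 0 γ
  rw [lieD_wedgeOne, hc.lieD_reeb_eta, h0', zero_add]

/-- The components of `F̃` in positive degree, on the side of forms. -/
theorem tildeF_succ {k : ℕ} (α : Form A (k + 1)) (β : Form A k) :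
    tildeF (contactBivector η) (reeb η) (k + 1) (α, β) =
      (theta η (k + 1) (α - wedgeInt η (reeb η) (k + 1) α + wedgeOne η k β),
        theta η k (wedgeInt η (reeb η) k β - interior (reeb η) k α)) := by
  refine Prod.ext ?_ ?_
  · change sharp (contactBivector η) (k + 1) α + wedgeE (reeb η) k (sharp (contactBivector η) k β) = _
    rw [hc.sharp_eq, hc.sharp_eq, hc.wedgeE_theta, map_sub (wedgeOne η k), wedgeOne_wedgeInt,
      sub_zero, map_add]
  · have h1 : sharp (contactBivector η) k (interior (reeb η) k α) =
        theta η k (interior (reeb η) k α) := by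
      rw [hc.sharp_eq]
      match k, α with
      | 0, α => rw [wedgeInt_zero, sub_zero]
      | k + 1, α => rw [wedgeInt_succ, interior_self, map_zero, sub_zero]
    match k, α, β with
    | 0, α, β =>
      change -sharp (contactBivector η) 0 (interior (reeb η) 0 α) + 0 = _
      rw [h1, wedgeInt_zero, zero_sub, map_neg, add_zero]
    | k + 1, α, β =>
      change -sharp (contactBivector η) (k + 1) (interior (reeb η) (k + 1) α) +
        wedgeE (reeb η) k (sharp (contactBivector η) k (interior (reeb η) k β)) = _
      rw [h1, hc.sharp_eq, hc.wedgeE_theta, map_sub (wedgeOne η k), wedgeOne_wedgeInt, sub_zero,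
        map_sub, wedgeInt_succ, neg_add_eq_sub]
      rfl

theorem tildeF_zero (α : Form A 0) (β : Prev (Form A) 0) :
    tildeF (contactBivector η) (reeb η) 0 (α, β) = (theta η 0 α, PUnit.unit) := by
  refine Prod.ext ?_ rfl
  change sharp (contactBivector η) 0 α + 0 = _
  rw [hc.sharp_eq, wedgeInt_zero, sub_zero, add_zero]

/-- By `tildeF_succ` the map only rearranges the horizontal parts and `η`-parts of `α` and `β`, up
to sign. The inverse sends `(a, b)` to `(a - η ∧ i_E a - η ∧ b, i_E a + η ∧ i_E b)`. -/
theorem tildeF_bijective (k : ℕ) :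
    Function.Bijective (tildeF (contactBivector η) (reeb η) k) := by
  match k with
  | 0 =>
    refine ⟨fun ⟨α, β⟩ ⟨α', β'⟩ h => ?_, fun ⟨P, Q⟩ => ?_⟩
    · rw [hc.tildeF_zero, hc.tildeF_zero] at h
      rw [hc.theta_injective 0 (congrArg Prod.fst h)]; rfl
    · obtain ⟨α, rfl⟩ := (hc.theta_bijective 0).2 P
      exact ⟨(α, PUnit.unit), hc.tildeF_zero α _⟩
  | k + 1 =>
    constructor
    · rintro ⟨α, β⟩ ⟨α', β'⟩ h
      change Form A k at β β'
      rw [hc.tildeF_succ, hc.tildeF_succ] at h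
      have h1 := hc.theta_injective _ (congrArg Prod.fst h)
      have h2 := hc.theta_injective _ (congrArg Prod.snd h)
      -- `rec1` and `rec2` verify the second and first component of the inverse.
      have rec1 (a : Form A (k + 1)) (b : Form A k) :
          interior (reeb η) k (a - wedgeInt η (reeb η) (k + 1) a + wedgeOne η k b) +
            wedgeInt η (reeb η) k (wedgeInt η (reeb η) k b - interior (reeb η) k a) = b := by
        rw [map_add, map_sub, hc.interior_reeb_wedgeInt, sub_self, zero_add,
          hc.interior_reeb_wedgeOne, map_sub]
        match k, a, b with
        | 0, a, b => simp only [wedgeInt_zero, sub_zero, add_zero]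
        | k + 1, a, b =>
          simp only [wedgeInt_succ, hc.interior_reeb_wedgeOne, interior_self, map_zero, sub_zero,
            map_sub, wedgeOne_wedgeInt]
          abel
      have rec2 (a : Form A (k + 1)) (b : Form A k) :
          (a - wedgeInt η (reeb η) (k + 1) a + wedgeOne η k b) - wedgeInt η (reeb η) (k + 1)
            (a - wedgeInt η (reeb η) (k + 1) a + wedgeOne η k b) -
            wedgeOne η k (wedgeInt η (reeb η) k b - interior (reeb η) k a) = a := by
        have e : wedgeInt η (reeb η) (k + 1) (wedgeInt η (reeb η) (k + 1) a) =
            wedgeInt η (reeb η) (k + 1) a := by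
          rw [wedgeInt_succ η (reeb η) a, hc.wedgeInt_wedgeOne]
        rw [map_add, map_sub (wedgeInt η (reeb η) (k + 1)), e, hc.wedgeInt_wedgeOne,
          map_sub, wedgeOne_wedgeInt, ← wedgeInt_succ]
        abel
      have hα : α = α' := by rw [← rec2 α β, ← rec2 α' β', h1, h2]
      have hβ : β = β' := by rw [← rec1 α β, ← rec1 α' β', h1, h2]
      rw [hα, hβ]
    · rintro ⟨P, Q⟩
      obtain ⟨a, rfl⟩ := (hc.theta_bijective (k + 1)).2 P
      obtain ⟨b, rfl⟩ := (hc.theta_bijective k).2 Q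
      refine ⟨(a - wedgeInt η (reeb η) (k + 1) a - wedgeOne η k b,
        (interior (reeb η) k a + wedgeInt η (reeb η) k b : Form A k)), ?_⟩
      rw [hc.tildeF_succ]
      have e1 : wedgeOne η k (interior (reeb η) k a) = wedgeInt η (reeb η) (k + 1) a := rfl
      have e : wedgeInt η (reeb η) (k + 1) (wedgeInt η (reeb η) (k + 1) a) =
            wedgeInt η (reeb η) (k + 1) a := by
          rw [wedgeInt_succ η (reeb η) a, hc.wedgeInt_wedgeOne]
      refine Prod.ext ?_ ?_
      · refine congrArg (theta η (k + 1)) ?_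
        rw [map_sub, map_sub (wedgeInt η (reeb η) (k + 1)), e, hc.wedgeInt_wedgeOne, map_add,
          wedgeOne_wedgeInt, e1]
        abel
      · refine congrArg (theta η k) ?_
        rw [map_sub, map_sub, hc.interior_reeb_wedgeInt, sub_self, zero_sub,
          hc.interior_reeb_wedgeOne, map_add]
        match k, a, b with
        | 0, a, b => simp only [wedgeInt_zero]; abel
        | k + 1, a, b =>
          simp only [wedgeInt_succ, hc.interior_reeb_wedgeOne, interior_self, map_zero, sub_zero,
            map_sub, wedgeOne_wedgeInt]
          abel

theorem wedgeTwoInt_sub {k : ℕ} (α : Form A (k + 1)) (β : Form A k) :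
    wedgeTwoInt (d 1 η) (reeb η) k (wedgeInt η (reeb η) k β - interior (reeb η) k α) =
      wedgeTwoInt (d 1 η) (reeb η) k β := by
  match k, α, β with
  | 0, α, β => rfl
  | k + 1, α, β =>
    rw [wedgeTwoInt_succ, wedgeTwoInt_succ, map_sub, interior_self, sub_zero,
      hc.interior_reeb_wedgeInt]

/-- The coefficients `k` and `k - 1` in `σ` are the degrees of its two arguments, so they cancel the
degree term of `delta`. What remains is an identity between `d`, `L_E`, `i_E` and `η ∧ ·`. -/
theorem sigma_tildeF (k : ℕ) (x : PairForm A k) :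
    sigma (contactBivector η) (reeb η) k (tildeF (contactBivector η) (reeb η) k x) =
      tildeF (contactBivector η) (reeb η) (k + 1) (pairD k x) := by
  match k, x with
  | 0, (α, β) =>
    -- The shifted complex vanishes in degree zero, so `dβ` enters degree one as the zero function.
    refine (congrArg (sigma (contactBivector η) (reeb η) 0) (hc.tildeF_zero α β)).trans
      (Eq.trans ?_ (hc.tildeF_succ (-d 0 α) (0 : Form A 0)).symm)
    refine Prod.ext ?_ ?_
    · change (-schouten _ (contactBivector η) (theta η 0 α) +
        ((0 : ℕ) : ℝ) • wedgeE (reeb η) 0 (theta η 0 α)) + 0 = _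
      rw [hc.schouten_bivector_theta, hc.wedgeE_theta, ← map_neg, ← theta_smul_real, ← map_add,
        add_zero]
      congr 1
      rw [delta, wedgeTwoInt_zero, map_zero, map_neg, wedgeInt_succ, interior_d_zero, Nat.cast_zero]
      module
    · change 0 + schouten _ (ofVField (reeb η)) (theta η 0 α) = _
      rw [hc.schouten_reeb_theta, zero_add]
      refine congrArg (theta η 0) ?_
      rw [map_zero, map_neg, interior_d_zero, zero_sub, neg_neg]
  | k + 1, (α, β) =>
    change Form A k at β
    refine (congrArg (sigma (contactBivector η) (reeb η) (k + 1)) (hc.tildeF_succ α β)).trans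
      (Eq.trans ?_ (hc.tildeF_succ (-d (k + 1) α) (d k β)).symm)
    set P := α - wedgeInt η (reeb η) (k + 1) α + wedgeOne η k β with hP
    set Q := wedgeInt η (reeb η) k β - interior (reeb η) k α with hQ
    have hiP : interior (reeb η) k P = β - wedgeInt η (reeb η) k β := by
      rw [hP, map_add, map_sub, hc.interior_reeb_wedgeInt, sub_self, zero_add,
        hc.interior_reeb_wedgeOne]
    refine Prod.ext ?_ ?_
    · change (-schouten _ (contactBivector η) (theta η (k + 1) P) +
        ((k + 1 : ℕ) : ℝ) • wedgeE (reeb η) (k + 1) (theta η (k + 1) P)) +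
        wedgeMV _ (contactBivector η) (theta η k Q) = _
      rw [hc.schouten_bivector_theta, hc.wedgeE_theta, ← map_neg, ← theta_smul_real, ← map_add,
        ← theta_wedgeTwo, ← map_add]
      congr 1
      -- As `L_E η = 0`, the other terms of `L_E P` contain a factor `η`.
      have hL : wedgeOne η (k + 1) (lieD (reeb η) (k + 1) P) =
          wedgeOne η (k + 1) (lieD (reeb η) (k + 1) α) := by
        rw [hP, map_add, map_sub, wedgeInt_succ, hc.lieD_reeb_wedgeOne, hc.lieD_reeb_wedgeOne,
          map_add, map_sub, wedgeOne_self, wedgeOne_self, sub_zero, add_zero]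
      -- Since `Q + i_E P = β - i_E α`, the terms `dη ∧ Q` of `σ` and `dη ∧ i_E P` of `-δP` add up
      -- to `dη ∧ (β - i_E α)`.
      have hT : wedgeTwo (d 1 η) k Q = wedgeTwo (d 1 η) k β -
          wedgeTwo (d 1 η) k (interior (reeb η) k α) -
          wedgeTwo (d 1 η) k (interior (reeb η) k P) := by
        rw [← map_sub, ← map_sub, hiP, hQ]
        congr 1
        abel
      have hI : wedgeInt η (reeb η) (k + 2) (d (k + 1) α) =
          wedgeOne η (k + 1) (lieD (reeb η) (k + 1) α) -
            wedgeOne η (k + 1) (d k (interior (reeb η) k α)) := by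
        rw [wedgeInt_succ, interior_d, map_sub]
      rw [delta, hL, hT, wedgeTwoInt_succ, map_neg, hI]
      rw [hP, map_add, map_sub, wedgeInt_succ, d_wedgeOne, d_wedgeOne]
      abel
    · change (schouten _ (contactBivector η) (theta η k Q) -
        (k : ℝ) • wedgeE (reeb η) k (theta η k Q)) +
        schouten _ (ofVField (reeb η)) (theta η (k + 1) P) = _
      rw [hc.schouten_bivector_theta, hc.wedgeE_theta, hc.schouten_reeb_theta, ← theta_smul_real,
        ← map_sub, ← map_add]
      congr 1
      have hLQ : wedgeOne η k (lieD (reeb η) k Q) =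
          -wedgeOne η k (lieD (reeb η) k (interior (reeb η) k α)) := by
        have : wedgeOne η k (lieD (reeb η) k (wedgeInt η (reeb η) k β)) = 0 := by
          match k, β with
          | 0, β => rw [wedgeInt_zero, map_zero, map_zero]
          | k + 1, β => rw [wedgeInt_succ, hc.lieD_reeb_wedgeOne, wedgeOne_self]
        rw [hQ, map_sub, map_sub, this, zero_sub]
      have hTQ : wedgeTwoInt (d 1 η) (reeb η) k Q = wedgeTwoInt (d 1 η) (reeb η) k β :=
        hc.wedgeTwoInt_sub α β
      have hLP : lieD (reeb η) (k + 1) P = lieD (reeb η) (k + 1) α -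
          wedgeOne η k (lieD (reeb η) k (interior (reeb η) k α)) +
          wedgeOne η k (lieD (reeb η) k β) := by
        rw [hP, map_add, map_sub, wedgeInt_succ, hc.lieD_reeb_wedgeOne, hc.lieD_reeb_wedgeOne]
      rw [delta, hLQ, hTQ, hLP, hQ, map_sub (d k), ← wedgeInt_d, map_neg, interior_d]
      abel

/-- `F̃` is surjective and carries the square of `(-d, d)` to `σ²`. -/
theorem sigma_sigma (k : ℕ) (x : PairMV A k) :
    sigma (contactBivector η) (reeb η) (k + 1) (sigma (contactBivector η) (reeb η) k x) = 0 := by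
  obtain ⟨y, rfl⟩ := (hc.tildeF_bijective k).2 x
  rw [hc.sigma_tildeF, hc.sigma_tildeF, pairD_pairD, map_zero]

end IsContactAlg
end ReebOperators

/-! ### The induced isomorphism in cohomology. -/

section CohomologyIso
universe u
variable {A : Type u} [CommRing A] [Algebra ℝ A] {η : Form A 1}

namespace IsContactAlg
variable (hc : IsContactAlg η)
include hc

theorem tildeF_smul (k : ℕ) (c : ℝ) (x : PairForm A k) :
    tildeF (contactBivector η) (reeb η) k (c • x) =
      c • tildeF (contactBivector η) (reeb η) k x := by
  match k, x with
  | 0, (α, β) =>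
    refine (hc.tildeF_zero (c • α) (c • β)).trans
      (Eq.trans ?_ (congrArg (c • ·) (hc.tildeF_zero α β)).symm)
    rfl
  | k + 1, (α, β) =>
    change Form A k at β
    refine (hc.tildeF_succ (c • α) (c • β)).trans
      (Eq.trans ?_ (congrArg (c • ·) (hc.tildeF_succ α β)).symm)
    refine Prod.ext ?_ ?_
    · refine Eq.trans (congrArg (theta η (k + 1)) ?_) (theta_smul_real c _)
      rw [LinearMap.map_smul_of_tower, LinearMap.map_smul_of_tower]
      module
    · refine Eq.trans (congrArg (theta η k) ?_) (theta_smul_real c _)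
      rw [LinearMap.map_smul_of_tower, LinearMap.map_smul_of_tower]
      module

theorem sigma_tildeF_eq_zero {k : ℕ} {α : Form A k} {β : Prev (Form A) k} :
    sigma (contactBivector η) (reeb η) k (tildeF (contactBivector η) (reeb η) k (α, β)) = 0 ↔
      d k α = 0 ∧ prevD k β = 0 := by
  rw [hc.sigma_tildeF, ← map_zero (tildeF (contactBivector η) (reeb η) (k + 1)),
    (hc.tildeF_bijective (k + 1)).1.eq_iff]
  change (-d k α, prevD k β) = (0, 0) ↔ _
  rw [Prod.mk.injEq, neg_eq_zero]

/-- Primitives correspond under the bijection `F̃`; the sign in `-d` is absorbed by replacing the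
primitive `a` of `α` by `-a`. -/
theorem tildeF_mem_coboundaries {k : ℕ} {α : Form A k} {β : Prev (Form A) k} :
    tildeF (contactBivector η) (reeb η) k (α, β) ∈
        coboundaries (C := PairMV A) (sigma (contactBivector η) (reeb η)) k ↔
      α ∈ coboundaries (C := Form A) d k ∧ β ∈ coboundaries (C := Prev (Form A)) prevD k := by
  match k, α, β with
  | 0, α, β =>
    simp only [coboundaries, Submodule.mem_bot]
    rw [map_eq_zero_iff _ (hc.tildeF_bijective 0).1, Prod.mk_eq_zero]
  | k + 1, α, β =>
    simp only [coboundaries, LinearMap.mem_range]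
    constructor
    · rintro ⟨y, hy⟩
      obtain ⟨⟨a, b⟩, rfl⟩ := (hc.tildeF_bijective k).2 y
      rw [hc.sigma_tildeF] at hy
      have h := (hc.tildeF_bijective (k + 1)).1 hy
      refine ⟨⟨-a, ?_⟩, ⟨b, congrArg Prod.snd h⟩⟩
      rw [map_neg]
      exact congrArg Prod.fst h
    · rintro ⟨⟨a, rfl⟩, ⟨b, rfl⟩⟩
      refine ⟨tildeF (contactBivector η) (reeb η) k (-a, b), ?_⟩
      rw [hc.sigma_tildeF]
      change tildeF (contactBivector η) (reeb η) (k + 1) (-d k (-a), prevD k b) = _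
      rw [map_neg, neg_neg]

/-- `F̃` as a real linear map from pairs of closed forms to the cohomology classes. -/
noncomputable def toLJ (k : ℕ) :
    (LinearMap.ker (d (A := A) k) × LinearMap.ker (prevD (A := A) k)) →ₗ[ℝ]
      LJ (contactBivector η) (reeb η) k where
  toFun x := cohClass (C := PairMV A) (sigma (contactBivector η) (reeb η))
    (tildeF (contactBivector η) (reeb η) k (x.1.1, x.2.1))
    (hc.sigma_tildeF_eq_zero.2 ⟨x.1.2, x.2.2⟩)
  map_add' x y := by
    refine congrArg Submodule.Quotient.mk (Subtype.ext ?_)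
    exact map_add (tildeF (contactBivector η) (reeb η) k) (x.1.1, x.2.1) (y.1.1, y.2.1)
  map_smul' c x := by
    refine congrArg Submodule.Quotient.mk (Subtype.ext ?_)
    exact hc.tildeF_smul k c (x.1.1, x.2.1)

theorem toLJ_eq_zero {k : ℕ} (x : LinearMap.ker (d (A := A) k) × LinearMap.ker (prevD (A := A) k)) :
    hc.toLJ k x = 0 ↔
      x.1.1 ∈ coboundaries (C := Form A) d k ∧
        x.2.1 ∈ coboundaries (C := Prev (Form A)) prevD k :=
  (Submodule.Quotient.mk_eq_zero _).trans hc.tildeF_mem_coboundaries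

/-- The isomorphism induced by `F̃` in cohomology. -/
noncomputable def cohomologyMap (k : ℕ) :
    (DeRham A k × DeRhamPrev A k) →ₗ[ℝ] LJ (contactBivector η) (reeb η) k :=
  LinearMap.coprod
    (Submodule.liftQ _ (hc.toLJ k ∘ₗ LinearMap.inl ℝ _ _) (fun α hα =>
      (hc.toLJ_eq_zero (α, 0)).2 ⟨hα, Submodule.zero_mem _⟩))
    (Submodule.liftQ _ (hc.toLJ k ∘ₗ LinearMap.inr ℝ _ _) (fun β hβ =>
      (hc.toLJ_eq_zero (0, β)).2 ⟨Submodule.zero_mem _, hβ⟩))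

theorem cohomologyMap_mk {k : ℕ} (α : LinearMap.ker (d (A := A) k))
    (β : LinearMap.ker (prevD (A := A) k)) :
    hc.cohomologyMap k (Submodule.Quotient.mk α, Submodule.Quotient.mk β) = hc.toLJ k (α, β) := by
  refine (map_add (hc.toLJ k) (α, 0) (0, β)).symm.trans ?_
  congr 1
  simp

theorem cohomologyMap_bijective (k : ℕ) : Function.Bijective (hc.cohomologyMap k) := by
  constructor
  · rw [← LinearMap.ker_eq_bot, LinearMap.ker_eq_bot']
    rintro ⟨a, b⟩ h
    obtain ⟨α, rfl⟩ := Submodule.Quotient.mk_surjective _ a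
    obtain ⟨β, rfl⟩ := Submodule.Quotient.mk_surjective _ b
    rw [hc.cohomologyMap_mk, hc.toLJ_eq_zero] at h
    exact Prod.ext ((Submodule.Quotient.mk_eq_zero _).2 h.1) ((Submodule.Quotient.mk_eq_zero _).2 h.2)
  · intro c
    obtain ⟨⟨c, hcc⟩, rfl⟩ := Submodule.Quotient.mk_surjective _ c
    obtain ⟨⟨α, β⟩, rfl⟩ := (hc.tildeF_bijective k).2 c
    obtain ⟨hα, hβ⟩ := hc.sigma_tildeF_eq_zero.1 (LinearMap.mem_ker.1 hcc)
    exact ⟨(Submodule.Quotient.mk ⟨α, hα⟩, Submodule.Quotient.mk ⟨β, hβ⟩),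
      hc.cohomologyMap_mk ⟨α, hα⟩ ⟨β, hβ⟩⟩

/-- `H_LJ^k ≅ H_dR^k ⊕ H_dR^(k-1)`. -/
noncomputable def cohomologyEquiv (k : ℕ) :
    (DeRham A k × DeRhamPrev A k) ≃ₗ[ℝ] LJ (contactBivector η) (reeb η) k :=
  LinearEquiv.ofBijective (hc.cohomologyMap k) (hc.cohomologyMap_bijective k)

end IsContactAlg

instance subsingleton_deRhamPrev_zero : Subsingleton (DeRhamPrev A 0) := by
  have : Subsingleton (LinearMap.ker (prevD (A := A) 0)) :=
    ⟨fun _ _ => Subtype.ext rfl⟩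
  exact Quotient.instSubsingletonQuotient _

/-- In the lowest degree the left side is the range of a map out of the zero space, which agrees
with the convention `⊥`. -/
theorem coboundaries_prevD (k : ℕ) :
    coboundaries (C := Prev (Form A)) prevD (k + 1) = coboundaries (C := Form A) d k := by
  match k with
  | 0 => exact LinearMap.range_zero
  | k + 1 => rfl

theorem deRhamPrev_succ (k : ℕ) : Nonempty (DeRhamPrev A (k + 1) ≃ₗ[ℝ] DeRham A k) :=
  ⟨Submodule.quotEquivOfEq _ _ (congrArg
    (Submodule.comap (LinearMap.ker (d (A := A) k)).subtype) (coboundaries_prevD k))⟩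

theorem IsContactAlg.lJ_zero (hc : IsContactAlg η) :
    Nonempty (LJ (contactBivector η) (reeb η) 0 ≃ₗ[ℝ] DeRham A 0) :=
  have : Unique (DeRhamPrev A 0) := uniqueOfSubsingleton 0
  ⟨(hc.cohomologyEquiv 0).symm.trans LinearEquiv.prodUnique⟩

theorem IsContactAlg.lJ_succ (hc : IsContactAlg η) (k : ℕ) :
    Nonempty (LJ (contactBivector η) (reeb η) (k + 1) ≃ₗ[ℝ] DeRham A (k + 1) × DeRham A k) :=
  (deRhamPrev_succ k).map fun e =>
    (hc.cohomologyEquiv (k + 1)).symm.trans ((LinearEquiv.refl ℝ _).prodCongr e)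

end CohomologyIso

/-! ### Hadamard's lemma. -/

section Hadamard
open MeasureTheory Topology

/-- The integral is the value at `0` of the convolution of the indicator of `(0, 1]` with `s ↦ b(s)
h(p, -s)`. The bump `b` gives compact support and equals `1` on `[-1, 1]`, so it does not change the
integral. -/
theorem contDiff_integral_param {P : Type*} [NormedAddCommGroup P] [NormedSpace ℝ P]
    (h : P × ℝ → ℝ) (hh : ContDiff ℝ ∞ h) :
    ContDiff ℝ ∞ (fun p => ∫ t in (0 : ℝ)..1, h (p, t)) := by
  let b : ContDiffBump (0 : ℝ) := ⟨1, 2, by norm_num, by norm_num⟩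
  have key := contDiffOn_convolution_right_with_param_comp (𝕜 := ℝ) (μ := volume) (n := ⊤)
    (ContinuousLinearMap.mul ℝ ℝ) (s := Set.univ) (v := fun _ : P => (0 : ℝ)) contDiffOn_const
    (f := Set.indicator (Set.Ioc (0 : ℝ) 1) (fun _ => (1 : ℝ)))
    (g := fun p s => b s * h (p, -s)) (k := Metric.closedBall 0 2) isOpen_univ
    (isCompact_closedBall _ _) (fun p x _ hx => by
      have : b x = 0 := by
        by_contra hne
        have hs : x ∈ Function.support b := hne
        rw [b.support_eq] at hs
        exact hx (Metric.ball_subset_closedBall hs)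
      simp [this])
    ((integrable_indicator_iff measurableSet_Ioc).2 (by simp)).locallyIntegrable
    (by
      refine ContDiff.contDiffOn ?_
      exact (b.contDiff.comp contDiff_snd).mul
        (hh.comp (contDiff_fst.prodMk contDiff_snd.neg)))
  rw [contDiffOn_univ] at key
  convert key using 2 with p
  rw [convolution_def, intervalIntegral.integral_of_le zero_le_one,
    ← integral_indicator measurableSet_Ioc]
  congr 1
  ext t
  by_cases ht : t ∈ Set.Ioc (0 : ℝ) 1
  · have hb : b (0 - t) = 1 := b.one_of_mem_closedBall (by
      rw [Metric.mem_closedBall, dist_zero_right, zero_sub, norm_neg, Real.norm_eq_abs,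
        abs_of_pos ht.1]
      exact ht.2)
    simp only [Set.indicator_of_mem ht, hb]
    simp
  · simp [Set.indicator_of_notMem ht]

/-- Hadamard's lemma: a smooth function is its value at `a` plus a combination of the coordinates
centred at `a`, with smooth coefficients. -/
theorem hadamard {n : ℕ} (F : EuclideanSpace ℝ (Fin n) → ℝ) (hF : ContDiff ℝ ∞ F)
    (a : EuclideanSpace ℝ (Fin n)) :
    ∃ g : Fin n → EuclideanSpace ℝ (Fin n) → ℝ, (∀ i, ContDiff ℝ ∞ (g i)) ∧
      (∀ y, F y = F a + ∑ i, (y i - a i) * g i y) ∧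
      ∀ i, g i a = fderiv ℝ F a (EuclideanSpace.single i 1) := by
  have hF' : ContDiff ℝ ∞ (fderiv ℝ F) := hF.fderiv_right (by exact le_rfl)
  have hh (i : Fin n) : ContDiff ℝ ∞ (fun z : EuclideanSpace ℝ (Fin n) × ℝ =>
      fderiv ℝ F (a + z.2 • (z.1 - a)) (EuclideanSpace.single i 1)) := by
    refine ContDiff.clm_apply (hF'.comp ?_) contDiff_const
    exact contDiff_const.add (contDiff_snd.smul (contDiff_fst.sub contDiff_const))
  -- The `i`-th coefficient is the mean of `∂ᵢF` over the segment from `a` to `y`.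
  refine ⟨fun i y => ∫ t in (0 : ℝ)..1,
    fderiv ℝ F (a + t • (y - a)) (EuclideanSpace.single i 1),
    fun i => contDiff_integral_param _ (hh i), fun y => ?_, fun i => ?_⟩
  · have hd (t : ℝ) : HasDerivAt (fun t : ℝ => F (a + t • (y - a)))
        (fderiv ℝ F (a + t • (y - a)) (y - a)) t := by
      have h1 : HasDerivAt (fun t : ℝ => a + t • (y - a)) (y - a) t := by
        simpa using ((hasDerivAt_id t).smul_const (y - a)).const_add a
      exact ((hF.differentiable (by simp)) _).hasFDerivAt.comp_hasDerivAt t h1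
    have hsum (t : ℝ) : fderiv ℝ F (a + t • (y - a)) (y - a) = ∑ i, (y i - a i) *
        fderiv ℝ F (a + t • (y - a)) (EuclideanSpace.single i 1) := by
      have : y - a = ∑ i, (y i - a i) • EuclideanSpace.single i (1 : ℝ) := by
        ext j
        simp [Finset.sum_apply, Pi.single_apply]
      have h2 := congrArg (fderiv ℝ F (a + t • (y - a))) this
      rw [h2, map_sum]
      simp only [map_smul, smul_eq_mul]
    have hc (i : Fin n) : Continuous (fun t : ℝ => (y i - a i) *
        fderiv ℝ F (a + t • (y - a)) (EuclideanSpace.single i 1)) :=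
      continuous_const.mul ((hh i).continuous.comp (continuous_const.prodMk continuous_id))
    have hint := intervalIntegral.integral_eq_sub_of_hasDerivAt (a := 0) (b := 1)
      (fun t _ => hd t) (by
        simp only [hsum]
        exact (continuous_finsetSum _ fun i _ => hc i).intervalIntegrable _ _)
    simp only [hsum] at hint
    rw [intervalIntegral.integral_finsetSum fun i _ => (hc i).intervalIntegrable _ _] at hint
    simp only [intervalIntegral.integral_const_mul, one_smul, zero_smul, add_zero,
      add_sub_cancel] at hint
    linarith
  · simp

end Hadamard

/-! ### Derivations of `C^∞(M)` in local coordinates. -/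

section Frame
open Topology

variable {n : ℕ} {M : Type*} [TopologicalSpace M] [ChartedSpace (EuclideanSpace ℝ (Fin n)) M]

theorem contMDiffOn_partial [IsManifold (𝓡 n) ∞ M] (p : M) (f : Smooth n M) (i : Fin n) :
    ContMDiffOn (𝓡 n) 𝓘(ℝ, ℝ) ∞ (fun q => fderiv ℝ (f ∘ (chartAt (EuclideanSpace ℝ (Fin n)) p).symm)
      (chartAt (EuclideanSpace ℝ (Fin n)) p q) (EuclideanSpace.single i 1))
      (chartAt (EuclideanSpace ℝ (Fin n)) p).source := by
  have h1 : ContMDiffOn (𝓡 n) 𝓘(ℝ, ℝ) ∞ (f ∘ (chartAt (EuclideanSpace ℝ (Fin n)) p).symm)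
      (chartAt (EuclideanSpace ℝ (Fin n)) p).target :=
    f.contMDiff.comp_contMDiffOn contMDiffOn_chart_symm
  rw [contMDiffOn_iff_contDiffOn] at h1
  have h2 := h1.fderiv_of_isOpen (m := ∞) (chartAt (EuclideanSpace ℝ (Fin n)) p).open_target le_rfl
  have h3 : ContDiffOn ℝ ∞ (fun y => fderiv ℝ (f ∘ (chartAt (EuclideanSpace ℝ (Fin n)) p).symm) y
      (EuclideanSpace.single i 1)) (chartAt (EuclideanSpace ℝ (Fin n)) p).target :=
    h2.clm_apply contDiffOn_const
  rw [← contMDiffOn_iff_contDiffOn] at h3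
  exact h3.comp contMDiffOn_chart fun q hq => (chartAt _ p).map_source hq

theorem differentiableAt_chart [IsManifold (𝓡 n) ∞ M] (p : M) (f : Smooth n M) {q : M}
    (hq : q ∈ (chartAt (EuclideanSpace ℝ (Fin n)) p).source) :
    DifferentiableAt ℝ (f ∘ (chartAt (EuclideanSpace ℝ (Fin n)) p).symm)
      (chartAt (EuclideanSpace ℝ (Fin n)) p q) := by
  have h1 : ContMDiffOn (𝓡 n) 𝓘(ℝ, ℝ) ∞ (f ∘ (chartAt (EuclideanSpace ℝ (Fin n)) p).symm)
      (chartAt (EuclideanSpace ℝ (Fin n)) p).target :=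
    f.contMDiff.comp_contMDiffOn contMDiffOn_chart_symm
  rw [contMDiffOn_iff_contDiffOn] at h1
  exact (h1.differentiableOn (by simp)).differentiableAt
    ((chartAt _ p).open_target.mem_nhds ((chartAt _ p).map_source hq))

theorem smooth_algebraMap_apply (c : ℝ) (q : M) : algebraMap ℝ (Smooth n M) c q = c := rfl

theorem smooth_sum_apply {ι : Type*} (s : Finset ι) (f : ι → Smooth n M) (q : M) :
    (∑ i ∈ s, f i) q = ∑ i ∈ s, f i q :=
  map_sum (ContMDiffMap.evalRingHom (R := ℝ) q) f s

theorem contMDiffOn_coord [IsManifold (𝓡 n) ∞ M] (p : M) (i : Fin n) :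
    ContMDiffOn (𝓡 n) 𝓘(ℝ, ℝ) ∞ (fun q => chartAt (EuclideanSpace ℝ (Fin n)) p q i)
      (chartAt (EuclideanSpace ℝ (Fin n)) p).source := by
  have h : ContDiff ℝ ∞ (fun y : EuclideanSpace ℝ (Fin n) => y i) := by fun_prop
  exact h.contMDiff.comp_contMDiffOn contMDiffOn_chart

variable [T2Space M] [IsManifold (𝓡 n) ∞ M]

/-- The product of a bump function and a function that is smooth near the centre. -/
noncomputable def bumpMul {p : M} (r : SmoothBumpFunction (𝓡 n) p) (g : M → ℝ)
    (hg : ContMDiffOn (𝓡 n) 𝓘(ℝ, ℝ) ∞ g (chartAt (EuclideanSpace ℝ (Fin n)) p).source) :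
    Smooth n M :=
  ⟨fun q => r q • g q, r.contMDiff_smul hg⟩

/-- The coordinate vector fields of a chart, cut off by a bump function. -/
noncomputable def coordField {p : M} (r : SmoothBumpFunction (𝓡 n) p) (i : Fin n) :
    VField (Smooth n M) :=
  have hz {q : M} (hq : q ∉ (chartAt (EuclideanSpace ℝ (Fin n)) p).source) : r q = 0 := by
    by_contra h
    exact hq (r.support_subset_source h)
  Derivation.mk'
    { toFun := fun f => bumpMul r _ (contMDiffOn_partial p f i)
      map_add' := fun f g => by
        ext q
        by_cases hq : q ∈ (chartAt (EuclideanSpace ℝ (Fin n)) p).source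
        · change r q * fderiv ℝ (f ∘ _ + g ∘ _) _ _ = r q * _ + r q * _
          rw [fderiv_add (differentiableAt_chart p f hq) (differentiableAt_chart p g hq),
            add_apply, mul_add]
        · change r q * _ = r q * _ + r q * _
          rw [hz hq]; simp
      map_smul' := fun c f => by
        ext q
        change r q * fderiv ℝ (c • (f ∘ _)) _ _ = c * (r q * _)
        rw [fderiv_const_smul_field]
        exact mul_left_comm _ _ _ }
    (fun f g => by
      ext q
      by_cases hq : q ∈ (chartAt (EuclideanSpace ℝ (Fin n)) p).source
      · have hl : (chartAt (EuclideanSpace ℝ (Fin n)) p).symm (chartAt _ p q) = q :=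
          (chartAt _ p).left_inv hq
        change r q * fderiv ℝ ((f ∘ _) * (g ∘ _)) _ _ = f q * (r q * _) + g q * (r q * _)
        rw [fderiv_mul (differentiableAt_chart p f hq) (differentiableAt_chart p g hq)]
        simp only [add_apply, smul_apply,
          Function.comp_apply, hl, smul_eq_mul]
        ring
      · change r q * _ = f q * (r q * _) + g q * (r q * _)
        rw [hz hq]; simp)

theorem coordField_apply {p : M} (r : SmoothBumpFunction (𝓡 n) p) (i : Fin n) (f : Smooth n M)
    (q : M) : coordField r i f q = r q *
      fderiv ℝ (f ∘ (chartAt (EuclideanSpace ℝ (Fin n)) p).symm)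
      (chartAt (EuclideanSpace ℝ (Fin n)) p q) (EuclideanSpace.single i 1) := rfl

/-- For a bump `R` at `q` supported where `h` vanishes, `R h = 0`; the Leibniz rule at `q` then
leaves `Y h`. -/
theorem vfield_eq_zero_of_eventuallyEq (Y : VField (Smooth n M)) {h : Smooth n M} {q : M}
    (hh : ∀ᶠ y in 𝓝 q, h y = 0) : Y h q = 0 := by
  obtain ⟨r, hr, -⟩ := (SmoothBumpFunction.nhds_basis_support (I := 𝓡 n) hh).mem_iff.1 hh
  let R : Smooth n M := ⟨r, r.contMDiff⟩
  have h0 : R * h = 0 := by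
    ext y
    change r y * h y = 0
    by_cases hy : r y = 0
    · rw [hy, zero_mul]
    · rw [hr (subset_tsupport _ hy), mul_zero]
  have := congrArg (fun k : Smooth n M => k q) (Y.leibniz R h)
  simp only [h0, map_zero] at this
  change (0 : ℝ) = r q * Y h q + h q * Y R q at this
  rw [hh.self_of_nhds, r.eq_one] at this
  linarith

theorem vfield_congr (Y : VField (Smooth n M)) {f g : Smooth n M} {q : M}
    (h : ∀ᶠ y in 𝓝 q, f y = g y) : Y f q = Y g q := by
  have := vfield_eq_zero_of_eventuallyEq Y (h := f - g) (q := q)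
    (h.mono fun y hy => sub_eq_zero.2 hy)
  rw [map_sub] at this
  exact sub_eq_zero.1 this

/-- A vector field in coordinates. -/
theorem vfield_apply_eq_sum {p q : M} (r : SmoothBumpFunction (𝓡 n) p)
    (hq : q ∈ (chartAt (EuclideanSpace ℝ (Fin n)) p).source) (hr : ∀ᶠ y in 𝓝 q, r y = 1)
    (Y : VField (Smooth n M)) (f : Smooth n M) :
    Y f q = ∑ i, Y (bumpMul r _ (contMDiffOn_coord p i)) q *
      fderiv ℝ (f ∘ (chartAt (EuclideanSpace ℝ (Fin n)) p).symm)
        (chartAt (EuclideanSpace ℝ (Fin n)) p q) (EuclideanSpace.single i 1) := by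
  set φ := chartAt (EuclideanSpace ℝ (Fin n)) p with hφ
  have hφq : φ q ∈ φ.target := φ.map_source hq
  obtain ⟨ε, hε, hball⟩ := Metric.isOpen_iff.1 φ.open_target _ hφq
  let b : ContDiffBump (φ q) := ⟨ε / 4, ε / 2, by positivity, by linarith⟩
  have hsub : tsupport b ⊆ φ.target := by
    rw [b.tsupport_eq]
    exact (Metric.closedBall_subset_ball (by change ε / 2 < ε; linarith)).trans hball
  -- Cut off so as to be smooth on the whole Euclidean space, as Hadamard's lemma requires.
  let F : EuclideanSpace ℝ (Fin n) → ℝ := fun y => b y * (f ∘ φ.symm) y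
  have h1 : ContMDiffOn (𝓡 n) 𝓘(ℝ, ℝ) ∞ (f ∘ φ.symm) φ.target :=
    f.contMDiff.comp_contMDiffOn contMDiffOn_chart_symm
  rw [contMDiffOn_iff_contDiffOn] at h1
  have hF : ContDiff ℝ ∞ F := by
    rw [← contMDiff_iff_contDiff]
    refine contMDiff_of_tsupport fun y hy => ?_
    have hy' : y ∈ φ.target := hsub (tsupport_mul_subset_left hy)
    exact (b.contDiff.contDiffAt.mul
      (h1.contDiffAt (φ.open_target.mem_nhds hy'))).contMDiffAt
  have hFe : F =ᶠ[𝓝 (φ q)] f ∘ φ.symm := by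
    filter_upwards [b.eventuallyEq_one] with y hy
    change b y * _ = _
    rw [hy]; exact one_mul _
  obtain ⟨g, hg, hFg, hga⟩ := hadamard F hF (φ q)
  have hgM (i : Fin n) : ContMDiffOn (𝓡 n) 𝓘(ℝ, ℝ) ∞ (g i ∘ φ) φ.source :=
    (hg i).contMDiff.comp_contMDiffOn contMDiffOn_chart
  let x (i : Fin n) : Smooth n M := bumpMul r _ (contMDiffOn_coord p i)
  let G (i : Fin n) : Smooth n M := bumpMul r _ (hgM i)
  -- Hadamard's expansion with globally defined factors; it agrees with `f` near `q`, where `r = 1`.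
  let f' : Smooth n M := algebraMap ℝ _ (F (φ q)) +
    ∑ i, (x i - algebraMap ℝ (Smooth n M) (x i q)) * G i
  have hx {y : M} (hy : r y = 1) (i : Fin n) : x i y = φ y i := by
    change r y * _ = _
    rw [hy, one_mul]
  have hG {y : M} (hy : r y = 1) (i : Fin n) : G i y = g i (φ y) := by
    change r y * _ = _
    rw [hy, one_mul]; rfl
  have hrq : r q = 1 := hr.self_of_nhds
  have hff : ∀ᶠ y in 𝓝 q, f y = f' y := by
    filter_upwards [hr, φ.open_source.mem_nhds hq,
      (φ.continuousAt hq).preimage_mem_nhds hFe] with y hy hys hyF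
    have e1 : f y = F (φ y) := by
      rw [show F (φ y) = (f ∘ φ.symm) (φ y) from hyF, Function.comp_apply, φ.left_inv hys]
    have e2 : f' y = F (φ q) + ∑ i, (x i y - x i q) * G i y := by
      change algebraMap ℝ (Smooth n M) (F (φ q)) y +
        (∑ i, (x i - algebraMap ℝ (Smooth n M) (x i q)) * G i : Smooth n M) y = _
      rw [smooth_sum_apply, smooth_algebraMap_apply]; rfl
    rw [e1, e2, hFg]
    simp only [hx hy, hx hrq, hG hy]
  rw [vfield_congr Y hff, map_add, Derivation.map_algebraMap, zero_add, map_sum, smooth_sum_apply]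
  refine Finset.sum_congr rfl fun i _ => ?_
  -- The centred coordinates vanish at `q`, so of each product only `G_i(q) Y(x_i)(q)` is left.
  rw [Derivation.leibniz, map_sub, Derivation.map_algebraMap, sub_zero]
  change (x i q - (algebraMap ℝ (Smooth n M) (x i q)) q) * _ + G i q * Y (x i) q = _
  rw [smooth_algebraMap_apply, sub_self, zero_mul, zero_add, hG hrq, hga, hFe.fderiv_eq, mul_comm]

/-- Near every point, the vector fields have a frame dual to the differentials of functions. -/
theorem exists_frame (p : M) :
    ∃ (x : Fin n → Smooth n M) (D : Fin n → VField (Smooth n M)) (ρ : Smooth n M), ρ p ≠ 0 ∧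
      ∀ Y : VField (Smooth n M), ρ • Y = ∑ i, Y (x i) • D i := by
  let r : SmoothBumpFunction (𝓡 n) p := Classical.arbitrary _
  have hr : ∀ᶠ q in 𝓝 p, ∀ᶠ y in 𝓝 q, r y = 1 :=
    eventually_eventually_nhds.2 r.eventuallyEq_one
  -- Two bumps are needed: `r` makes the coordinates global functions, and `s` is supported where
  -- `r` is locally `1`, so that there they are true coordinates.
  obtain ⟨s, hs, -⟩ := (SmoothBumpFunction.nhds_basis_support (I := 𝓡 n) hr).mem_iff.1 hr
  refine ⟨fun i => bumpMul r _ (contMDiffOn_coord p i), coordField s, ⟨s, s.contMDiff⟩, ?_,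
    fun Y => ?_⟩
  · change s p ≠ 0
    rw [s.eq_one]; exact one_ne_zero
  · ext f q
    have e : (∑ i, Y (bumpMul r _ (contMDiffOn_coord p i)) • coordField s i) f =
        ∑ i, Y (bumpMul r _ (contMDiffOn_coord p i)) * coordField s i f := by
      rw [← Derivation.coeFnAddMonoidHom_apply, map_sum, Finset.sum_apply]
      rfl
    rw [e, smooth_sum_apply]
    change s q * Y f q = ∑ i, Y (bumpMul r _ (contMDiffOn_coord p i)) q * coordField s i f q
    simp only [coordField_apply]
    by_cases hq : s q = 0
    · simp [hq]
    · rw [vfield_apply_eq_sum r (s.support_subset_source hq) (hs (subset_tsupport _ hq)),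
        Finset.mul_sum]
      exact Finset.sum_congr rfl fun i _ => by ring

end Frame

/-! ### Inverting `♭` in a frame. -/

section LocalFrame
open Matrix

variable {A : Type*} [CommRing A] [Algebra ℝ A] {n : ℕ}

theorem one_form_smul (α : Form A 1) (f : A) (Y : VField A) : α ![f • Y] = f * α ![Y] :=
  α.map_vecCons_smul ![] f Y

theorem one_form_sum (α : Form A 1) (c : Fin n → A) (D : Fin n → VField A) :
    α ![∑ i, c i • D i] = ∑ i, c i * α ![D i] := by
  have h := α.map_update_sum Finset.univ 0 (fun i => c i • D i) ![0]
  have hu (Y : VField A) : Function.update ![0] 0 Y = ![Y] := by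
    ext i; fin_cases i; rfl
  simpa only [hu, one_form_smul] using h

theorem form_sum_apply {k : ℕ} (α : Fin n → Form A k) (v : Fin k → VField A) :
    (∑ i, α i) v = ∑ i, α i v :=
  map_sum ({ toFun := fun β : Form A k => β v
             map_zero' := rfl
             map_add' := fun _ _ => rfl } : Form A k →+ A) α Finset.univ

theorem one_form_ext {α β : Form A 1} (h : ∀ Y, α ![Y] = β ![Y]) : α = β :=
  form_ext fun X => form_zero_ext (h X)

/-- The matrix of the bilinear form `(X, Y) ↦ ♭(X)(Y)`. -/
noncomputable def flatMatrix (η : Form A 1) (D : Fin n → VField A) : Matrix (Fin n) (Fin n) A :=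
  of fun i j => flat η (D i) ![D j]

theorem flat_sum_apply (η : Form A 1) (D : Fin n → VField A) (c : Fin n → A) (j : Fin n) :
    flat η (∑ i, c i • D i) ![D j] = (c ᵥ* flatMatrix η D) j := by
  simp only [map_sum, map_smul, form_sum_apply]
  rfl

variable {η : Form A 1} {x : Fin n → A} {D : Fin n → VField A} {ρ : A}

theorem one_form_frame (hD : ∀ Y : VField A, ρ • Y = ∑ i, Y (x i) • D i) (α : Form A 1)
    (Y : VField A) : ρ * α ![Y] = ∑ i, Y (x i) * α ![D i] := by
  rw [← one_form_smul, hD, one_form_sum]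

/-- Cramer's rule: the adjugate matrix solves the equation up to the determinant, and `ρ` accounts
for the frame being only local. -/
theorem exists_flat_eq_smul (hD : ∀ Y : VField A, ρ • Y = ∑ i, Y (x i) • D i) (α : Form A 1) :
    ∃ Z, flat η Z = (ρ * (flatMatrix η D).det) • α := by
  let c : Fin n → A := (fun j => α ![D j]) ᵥ* (flatMatrix η D).adjugate
  refine ⟨ρ • ∑ i, c i • D i, one_form_ext fun Y => ?_⟩
  rw [map_smul]
  change ρ * flat η _ ![Y] = ρ * (flatMatrix η D).det * α ![Y]
  rw [one_form_frame hD, mul_right_comm, one_form_frame hD, Finset.sum_mul]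
  refine Finset.sum_congr rfl fun j _ => ?_
  rw [flat_sum_apply, vecMul_vecMul, adjugate_mul, vecMul_smul, vecMul_one]
  simp only [Pi.smul_apply, smul_eq_mul]
  ring

theorem smul_eq_zero_of_flat_eq_zero (hD : ∀ Y : VField A, ρ • Y = ∑ i, Y (x i) • D i)
    {Z : VField A} (hZ : flat η Z = 0) : (ρ * (flatMatrix η D).det) • Z = 0 := by
  have h1 : (fun i => Z (x i)) ᵥ* flatMatrix η D = 0 := by
    ext j
    rw [← flat_sum_apply, ← hD, map_smul, hZ, smul_zero]
    rfl
  have h2 : (flatMatrix η D).det • (fun i => Z (x i)) = 0 := by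
    have := congrArg (· ᵥ* (flatMatrix η D).adjugate) h1
    simpa only [vecMul_vecMul, mul_adjugate, vecMul_smul, vecMul_one, zero_vecMul] using this
  rw [mul_comm, mul_smul, hD, Finset.smul_sum]
  refine Finset.sum_eq_zero fun i _ => ?_
  rw [smul_smul, show (flatMatrix η D).det * Z (x i) = 0 from congrFun h2 i, zero_smul]

/-- Apply `♭⁻¹` to the expansion of `ρ ♭(Y)` in the differentials `dx_i`. -/
theorem smul_eq_sum_flatInvD (hη : Function.Bijective (flat η))
    (hD : ∀ Y : VField A, ρ • Y = ∑ i, Y (x i) • D i) (Y : VField A) :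
    ρ • Y = ∑ i, flat η Y ![D i] • flatInvD η (x i) := by
  have hf (f : A) : flat η (flatInvD η f) = d 0 (func f) := by
    change flat η (flatInv η _) = _
    rw [flatInv, dif_pos hη]
    exact (LinearEquiv.ofBijective (flat η) hη).apply_symm_apply _
  refine hη.1 (one_form_ext fun Z => ?_)
  simp only [map_sum, map_smul, form_sum_apply, AlternatingMap.smul_apply, hf, smul_eq_mul]
  rw [one_form_frame hD]
  exact Finset.sum_congr rfl fun i _ => mul_comm _ _

end LocalFrame

/-! ### From local to global statements. -/

section Glue
variable {n : ℕ} {M : Type*} [TopologicalSpace M] [ChartedSpace (EuclideanSpace ℝ (Fin n)) M]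
  {η : Form (Smooth n M) 1}

/-- The local solutions `X p / χ p` agree on overlaps by injectivity. Their common value at each
point is smooth, hence defines a derivation. -/
theorem flat_bijective_of_locally (h : ∀ p : M, ∃ χ : Smooth n M, χ p ≠ 0 ∧
      (∀ α, ∃ Z, flat η Z = χ • α) ∧ ∀ Z, flat η Z = 0 → χ • Z = 0) :
    Function.Bijective (flat η) := by
  choose χ hχ hs hi using h
  have inj : Function.Injective (flat η) := by
    refine (injective_iff_map_eq_zero _).2 fun Z hZ => ?_
    ext f p
    have := congrArg (fun Y : VField (Smooth n M) => Y f p) (hi p Z hZ)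
    exact (mul_eq_zero.1 this).resolve_left (hχ p)
  refine ⟨inj, fun α => ?_⟩
  choose X hX using fun p => hs p α
  have hXX (p q : M) : χ q • X p = χ p • X q := by
    refine inj ?_
    rw [map_smul, map_smul, hX, hX, smul_smul, smul_smul, mul_comm]
  have hXXf (p q : M) (f : Smooth n M) : χ q q * X p f q = χ p q * X q f q :=
    congrArg (fun Y : VField (Smooth n M) => Y f q) (hXX p q)
  have smooth (f : Smooth n M) : ContMDiff (𝓡 n) 𝓘(ℝ, ℝ) ∞ (fun q => X q f q / χ q q) := by
    intro p
    have h1 : ContMDiffAt (𝓡 n) 𝓘(ℝ, ℝ) ∞ (fun q => X p f q / χ p q) p :=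
      (X p f).contMDiff.contMDiffAt.div₀ (χ p).contMDiff.contMDiffAt (hχ p)
    refine h1.congr_of_eventuallyEq ?_
    filter_upwards [(χ p).contMDiff.continuous.continuousAt.eventually_ne (hχ p)] with q hq
    rw [div_eq_div_iff (hχ q) hq]
    linarith [hXXf p q f]
  let Y : VField (Smooth n M) := Derivation.mk'
    { toFun := fun f => ⟨fun q => X q f q / χ q q, smooth f⟩
      map_add' := fun f g => by
        ext q
        change X q (f + g) q / _ = X q f q / _ + X q g q / _
        rw [map_add, ← add_div]; rfl
      map_smul' := fun c f => by
        ext q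
        change X q (c • f) q / _ = c * (X q f q / _)
        rw [Derivation.map_smul, ← mul_div_assoc]; rfl }
    (fun f g => by
      ext q
      change X q (f * g) q / _ = f q * (X q g q / _) + g q * (X q f q / _)
      rw [Derivation.leibniz]
      change (f q * X q g q + g q * X q f q) / _ = _
      ring)
  have hY (p : M) : χ p • Y = X p := by
    ext f q
    change χ p q * (X q f q / χ q q) = X p f q
    rw [← mul_div_assoc, ← hXXf, mul_div_cancel_left₀ _ (hχ q)]
  refine ⟨Y, ?_⟩
  ext Z p
  have := congrArg (fun β : Form (Smooth n M) 1 => β Z p) ((hX p).symm.trans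
    ((congrArg (flat η) (hY p).symm).trans (map_smul _ _ _)))
  exact (mul_left_cancel₀ (hχ p) this).symm

/-- Near each point every field is, up to a factor `ρ`, a combination of fields `X_f`, so the
arguments of `γ` can be replaced by these one at a time. -/
theorem form_eq_zero_of_locally (hη : Function.Bijective (flat η))
    (h : ∀ p : M, ∃ (x : Fin n → Smooth n M) (D : Fin n → VField (Smooth n M)) (ρ : Smooth n M),
      ρ p ≠ 0 ∧ ∀ Y : VField (Smooth n M), ρ • Y = ∑ i, Y (x i) • D i)
    {k : ℕ} (γ : Form (Smooth n M) k)
    (hγ : ∀ f : Fin k → Smooth n M, γ (fun i => flatInvD η (f i)) = 0) : γ = 0 := by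
  induction k with
  | zero =>
    refine form_zero_ext (Eq.trans ?_ (hγ ![]))
    congr 1
    exact Subsingleton.elim _ _
  | succ k ih =>
    have h0 (f : Smooth n M) : interior (flatInvD η f) k γ = 0 := by
      refine ih _ fun g => ?_
      rw [← hγ (Fin.cons f g), interior_apply]
      congr 1
      ext1 i
      refine Fin.cases ?_ (fun i => ?_) i <;> rfl
    refine form_ext fun Y => ?_
    ext v p
    obtain ⟨x, D, ρ, hρ, hD⟩ := h p
    have h1 : ρ • γ.curryLeft Y = 0 := by
      rw [← map_smul, smul_eq_sum_flatInvD hη hD, map_sum]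
      refine Finset.sum_eq_zero fun i _ => ?_
      rw [map_smul]
      exact (congrArg _ (h0 (x i))).trans (smul_zero _)
    have h2 := congrArg (fun β : Form (Smooth n M) k => β v p) h1
    exact (mul_eq_zero.1 h2).resolve_left hρ

end Glue

/-! ### Values of forms at a point. -/

section Pointwise
variable {n : ℕ} {M : Type*} [TopologicalSpace M] [ChartedSpace (EuclideanSpace ℝ (Fin n)) M]

theorem wedge_apply_eq_zero {k l r : ℕ} (h : k + l = r) {a : Form (Smooth n M) k}
    {b : Form (Smooth n M) l} {V : VField (Smooth n M)} {p : M}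
    (ha : ∀ w, (∃ i, w i = V) → a w p = 0) (hb : ∀ w, (∃ i, w i = V) → b w p = 0)
    (w : Fin r → VField (Smooth n M)) (hw : ∃ i, w i = V) : wedge h a b w p = 0 := by
  obtain ⟨i, hi⟩ := hw
  rw [wedge_apply]
  refine mul_eq_zero_of_right _ ?_
  rw [smooth_sum_apply]
  refine Finset.sum_eq_zero fun s _ => ?_
  have hs : (a (fun i => w (s (blocks h (.inl i)))) * b (fun j => w (s (blocks h (.inr j))))) p
      = 0 := by
    change a _ p * b _ p = 0
    obtain ⟨j, hj⟩ : ∃ j, s (blocks h j) = i := ((blocks h).trans s).surjective i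
    rcases j with j | j
    · rw [ha _ ⟨j, by rw [hj, hi]⟩, zero_mul]
    · rw [hb _ ⟨j, by rw [hj, hi]⟩, mul_zero]
  rcases Int.units_eq_one_or (Equiv.Perm.sign s) with e | e
  · rw [e, one_smul, hs]
  · rw [e, Units.neg_smul, one_smul]
    exact (congrArg Neg.neg hs).trans neg_zero

theorem wedgePow_apply_eq_zero {b : Form (Smooth n M) 2} {V : VField (Smooth n M)} {p : M}
    (hb : ∀ w, (∃ i, w i = V) → b w p = 0) :
    ∀ (m : ℕ) (w : Fin (2 * m) → VField (Smooth n M)), (∃ i, w i = V) → wedgePow b m w p = 0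
  | 0, _, ⟨i, _⟩ => i.elim0
  | m + 1, w, hw => wedge_apply_eq_zero _ (wedgePow_apply_eq_zero hb m) hb w hw

/-- Testing `♭(V)` on `V` itself gives `η(V)² = 0` at `p`. Hence both `η(V)` and `dη(V, ·)` vanish
at `p`, and `V` is an argument of some factor in each term of the wedge product. -/
theorem volume_apply_eq_zero {η : Form (Smooth n M) 1} {V : VField (Smooth n M)} {p : M}
    (hV : ∀ Y, flat η V ![Y] p = 0) {m r : ℕ} (h : 1 + 2 * m = r)
    (w : Fin r → VField (Smooth n M)) (hw : ∃ i, w i = V) :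
    wedge h η (wedgePow (d 1 η) m) w p = 0 := by
  have h1 : η ![V] p = 0 := by
    have := hV V
    rw [flat_apply, two_form_self, zero_add] at this
    exact mul_self_eq_zero.1 this
  have h2 (Y : VField (Smooth n M)) : d 1 η ![V, Y] p = 0 := by
    have := hV Y
    rw [flat_apply] at this
    change d 1 η ![V, Y] p + η ![V] p * η ![Y] p = 0 at this
    rwa [h1, zero_mul, add_zero] at this
  refine wedge_apply_eq_zero h (fun w ⟨i, hi⟩ => ?_)
    (wedgePow_apply_eq_zero (fun w ⟨i, hi⟩ => ?_) m) w hw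
  · have : w = ![V] := by
      ext1 j
      rw [← hi, Subsingleton.elim j i, Subsingleton.elim i 0]; rfl
    rw [this, h1]
  · have hw : w = ![w 0, w 1] := by ext1 j; fin_cases j <;> rfl
    fin_cases i
    · rw [hw, show w 0 = V from hi, h2]
    · rw [hw, show w 1 = V from hi, two_form_swap]
      exact (congrArg Neg.neg (h2 _)).trans neg_zero

variable {x : Fin n → Smooth n M} {D : Fin n → VField (Smooth n M)} {ρ : Smooth n M} {p : M}

/-- Expanding `ρ^n μ(X)` in the frame, only index maps that are permutations contribute, and these
give `±μ(D)`. -/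
theorem apply_frame_ne_zero (hρ : ρ p ≠ 0)
    (hD : ∀ Y : VField (Smooth n M), ρ • Y = ∑ i, Y (x i) • D i) {μ : Form (Smooth n M) n}
    (hμ : ∃ X, μ X p ≠ 0) : μ D p ≠ 0 := by
  obtain ⟨X, hX⟩ := hμ
  contrapose! hX
  have e : (ρ ^ n) • μ X = ∑ r : Fin n → Fin n, (∏ i, X i (x (r i))) • μ (fun i => D (r i)) := by
    have h1 := μ.map_smul_univ (fun _ => ρ) X
    simp only [hD, Finset.prod_const, Finset.card_univ, Fintype.card_fin] at h1
    rw [← h1]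
    refine (MultilinearMap.map_sum μ.toMultilinearMap (fun i j => X i (x j) • D j)).trans ?_
    exact Finset.sum_congr rfl fun r _ =>
      μ.map_smul_univ (fun i => X i (x (r i))) fun i => D (r i)
  have e' := congrArg (fun f : Smooth n M => f p) e
  change (ρ ^ n) p * μ X p = _ at e'
  have hn : (ρ ^ n) p = ρ p ^ n := map_pow (ContMDiffMap.evalRingHom (R := ℝ) p) ρ n
  have h0 : (ρ ^ n) p ≠ 0 := by rw [hn]; exact pow_ne_zero _ hρ
  refine (mul_eq_zero.1 (e'.trans ?_)).resolve_left h0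
  refine (smooth_sum_apply _ _ _).trans (Finset.sum_eq_zero fun r _ => ?_)
  refine mul_eq_zero_of_right _ ?_
  by_cases hr : Function.Injective r
  · have hp := μ.map_perm D (Equiv.ofBijective r (Finite.injective_iff_bijective.1 hr))
    change μ (fun i => D (r i)) = _ at hp
    rw [hp]
    rcases Int.units_eq_one_or (Equiv.Perm.sign (Equiv.ofBijective r
      (Finite.injective_iff_bijective.1 hr))) with e | e
    · rw [e, one_smul, hX]
    · rw [e, Units.neg_smul, one_smul]
      exact (congrArg Neg.neg hX).trans neg_zero
  · obtain ⟨i, j, hij, hne⟩ := Function.not_injective_iff.1 hr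
    rw [μ.map_eq_zero_of_eq (fun i => D (r i)) (congrArg D hij) hne]
    rfl

theorem apply_update_sum {μ : Form (Smooth n M) n} (c : Fin n → ℝ) (i : Fin n) :
    μ (Function.update D i (∑ j, algebraMap ℝ (Smooth n M) (c j) • D j)) p = c i * μ D p := by
  rw [μ.map_update_sum, smooth_sum_apply, Finset.sum_eq_single i]
  · rw [μ.map_update_smul, Function.update_eq_self]; rfl
  · intro j _ hj
    rw [μ.map_update_smul, μ.map_update_self _ hj.symm, smul_zero]
    rfl
  · simp

end Pointwise

/-! ### Contact forms on manifolds. -/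

section ContactManifold
open Matrix

variable {m : ℕ} {M : Type*} [TopologicalSpace M]
  [ChartedSpace (EuclideanSpace ℝ (Fin (2 * m + 1))) M] {η : Form (Smooth (2 * m + 1) M) 1}
  {x : Fin (2 * m + 1) → Smooth (2 * m + 1) M} {D : Fin (2 * m + 1) → VField (Smooth (2 * m + 1) M)}
  {ρ : Smooth (2 * m + 1) M} {p : M}

namespace IsContactForm

/-- For a vector `v` in the kernel, `♭` of `V = ∑ v_j D_j` vanishes at `p`. Replacing `D_i` by `V`,
where `v_i ≠ 0`, multiplies the nonzero value of the volume form by `v_i`, yet makes it zero. -/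
theorem vecMul_flatMatrix_ne_zero (hη : IsContactForm η) (hρ : ρ p ≠ 0)
    (hD : ∀ Y : VField (Smooth (2 * m + 1) M), ρ • Y = ∑ i, Y (x i) • D i)
    {v : Fin (2 * m + 1) → ℝ} (hv : v ≠ 0) :
    v ᵥ* (flatMatrix η D).map (fun f => f p) ≠ 0 := by
  intro h
  obtain ⟨i, hi⟩ := Function.ne_iff.1 hv
  let V := ∑ j, algebraMap ℝ (Smooth (2 * m + 1) M) (v j) • D j
  have hVD (j) : flat η V ![D j] p = 0 := by
    rw [flat_sum_apply]
    exact (smooth_sum_apply _ _ _).trans (congrFun h j)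
  have hV (Y) : flat η V ![Y] p = 0 := by
    have e := congrArg (fun f : Smooth (2 * m + 1) M => f p) (one_form_frame hD (flat η V) Y)
    refine (mul_eq_zero.1 (e.trans ?_)).resolve_left hρ
    refine (smooth_sum_apply _ _ _).trans (Finset.sum_eq_zero fun j _ => ?_)
    exact mul_eq_zero_of_right _ (hVD j)
  have h1 := volume_apply_eq_zero hV (show 1 + 2 * m = 2 * m + 1 by omega)
    (Function.update D i V) ⟨i, Function.update_self ..⟩
  rw [apply_update_sum] at h1
  exact (mul_ne_zero hi (apply_frame_ne_zero hρ hD (hη p))) h1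

theorem det_flatMatrix_ne_zero (hη : IsContactForm η) (hρ : ρ p ≠ 0)
    (hD : ∀ Y : VField (Smooth (2 * m + 1) M), ρ • Y = ∑ i, Y (x i) • D i) :
    (flatMatrix η D).det p ≠ 0 := by
  intro h
  have e := RingHom.map_det (ContMDiffMap.evalRingHom (R := ℝ) p) (flatMatrix η D)
  obtain ⟨v, hv, hv'⟩ := exists_vecMul_eq_zero_iff.2 (e.symm.trans h)
  exact hη.vecMul_flatMatrix_ne_zero hρ hD hv hv'

variable [T2Space M] [IsManifold (𝓡 (2 * m + 1)) ∞ M]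

theorem flat_bijective (hη : IsContactForm η) : Function.Bijective (flat η) := by
  refine flat_bijective_of_locally fun p => ?_
  obtain ⟨x, D, ρ, hρ, hD⟩ := exists_frame (n := 2 * m + 1) p
  exact ⟨ρ * (flatMatrix η D).det, mul_ne_zero hρ (hη.det_flatMatrix_ne_zero hρ hD),
    exists_flat_eq_smul hD, fun Z => smul_eq_zero_of_flat_eq_zero hD⟩

/-- At `p` there is a `V ≠ 0` with `dη(V, ·) = 0`, so `♭(V) = η(V) η` there and `η(V) ≠ 0`.
Evaluating `♭(E) = η` on `V` gives `η(E) η(V) = η(V)`. -/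
theorem eta_reeb (hη : IsContactForm η) : η ![reeb η] = 1 := by
  have hE : flat η (reeb η) = η := by
    change flat η (flatInv η _) = _
    rw [flatInv, dif_pos hη.flat_bijective]
    exact (LinearEquiv.ofBijective (flat η) hη.flat_bijective).apply_symm_apply _
  ext p
  obtain ⟨x, D, ρ, hρ, hD⟩ := exists_frame (n := 2 * m + 1) p
  let C : Matrix (Fin (2 * m + 1)) (Fin (2 * m + 1)) ℝ := of fun i j => d 1 η ![D i, D j] p
  -- A skew-symmetric real matrix of odd size is singular.
  have hC : C.det = 0 := by
    have h1 : Cᵀ = -C := by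
      ext i j
      exact congrArg (fun f : Smooth (2 * m + 1) M => f p) (two_form_swap (d 1 η) (D i) (D j))
    have h2 := C.det_transpose
    rw [h1, det_neg, Fintype.card_fin, pow_succ, pow_mul, neg_one_sq, one_pow] at h2
    linarith
  obtain ⟨v, hv, hv'⟩ := exists_vecMul_eq_zero_iff.2 hC
  let V := ∑ j, algebraMap ℝ (Smooth (2 * m + 1) M) (v j) • D j
  have hflat (j) : flat η V ![D j] p = η ![V] p * η ![D j] p := by
    have h1 : d 1 η ![V, D j] p = (v ᵥ* C) j := by
      have h := one_form_sum (-interior (D j) 1 (d 1 η)) (fun j => algebraMap ℝ _ (v j)) D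
      have h' (Y : VField (Smooth (2 * m + 1) M)) :
          (-interior (D j) 1 (d 1 η)) ![Y] = d 1 η ![Y, D j] :=
        (two_form_swap (d 1 η) (D j) Y).symm
      simp only [h'] at h
      rw [h]
      exact smooth_sum_apply _ _ _
    rw [flat_apply]
    change d 1 η ![V, D j] p + _ = _
    rw [h1, hv']
    exact zero_add _
  have hVp : η ![V] p ≠ 0 := by
    intro h0
    refine hη.vecMul_flatMatrix_ne_zero hρ hD hv ?_
    ext j
    have h1 := hflat j
    rw [h0, zero_mul, flat_sum_apply] at h1
    exact (smooth_sum_apply _ _ _).symm.trans h1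
  have hEV : d 1 η ![V, reeb η] p = 0 := by
    have h1 := congrArg (fun f : Smooth (2 * m + 1) M => f p)
      (one_form_frame hD (interior V 1 (d 1 η)) (reeb η))
    refine (mul_eq_zero.1 (h1.trans ?_)).resolve_left hρ
    refine (smooth_sum_apply _ _ _).trans (Finset.sum_eq_zero fun j _ => ?_)
    refine mul_eq_zero_of_right _ ?_
    have h2 := hflat j
    rw [flat_apply] at h2
    exact add_eq_right.1 h2
  have h1 : (flat η (reeb η)) ![V] p = η ![V] p := by rw [hE]
  rw [flat_apply, two_form_swap] at h1
  change -(d 1 η ![V, reeb η] p) + η ![reeb η] p * η ![V] p = _ at h1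
  rw [hEV, neg_zero, zero_add] at h1
  exact (mul_eq_right₀ hVp).1 h1

theorem isContactAlg (hη : IsContactForm η) : IsContactAlg η where
  flat_bijective := hη.flat_bijective
  eta_reeb := hη.eta_reeb
  form_eq_zero := form_eq_zero_of_locally hη.flat_bijective exists_frame

end IsContactForm
end ContactManifold

end LichJac

theorem theorem3p5 (m : ℕ) {M : Type*} [TopologicalSpace M] [T2Space M] [SigmaCompactSpace M]
    [ChartedSpace (EuclideanSpace ℝ (Fin (2 * m + 1))) M] [IsManifold (𝓡 (2 * m + 1)) ∞ M]
    (η : LichJac.Form (LichJac.Smooth (2 * m + 1) M) 1) (hη : LichJac.IsContactForm η) :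
    let A := LichJac.Smooth (2 * m + 1) M
    let P : LichJac.MultiVector A 2 := LichJac.contactBivector η
    let E : LichJac.VField A := LichJac.reeb η
    -- the Jacobi structure of `η` and the two complexes are well defined
    Function.Bijective (LichJac.flat η) ∧
    LichJac.IsJacobi P E ∧
    (∀ (k : ℕ) (α : LichJac.Form A k), LichJac.d (k + 1) (LichJac.d k α) = 0) ∧
    (∀ (k : ℕ) (x : LichJac.PairMV A k),
      LichJac.sigma P E (k + 1) (LichJac.sigma P E k x) = 0) ∧
    -- `F̃` is an isomorphism of complexes
    (∀ k : ℕ, Function.Bijective (LichJac.tildeF P E k)) ∧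
    (∀ (k : ℕ) (x : LichJac.PairForm A k),
      LichJac.sigma P E k (LichJac.tildeF P E k x) =
        LichJac.tildeF P E (k + 1) (LichJac.pairD k x)) ∧
    -- the map induced by `F̃` in cohomology is an isomorphism
    (∀ k : ℕ, ∃ Φ : (LichJac.DeRham A k × LichJac.DeRhamPrev A k) ≃ₗ[ℝ] LichJac.LJ P E k,
      ∀ (α : LichJac.Form A k) (β : LichJac.Prev (LichJac.Form A) k)
        (hα : LichJac.d k α = 0) (hβ : LichJac.prevD k β = 0),
        ∃ h : LichJac.sigma P E k (LichJac.tildeF P E k (α, β)) = 0,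
          Φ (LichJac.cohClass (C := LichJac.Form A) LichJac.d α hα,
              LichJac.cohClass (C := LichJac.Prev (LichJac.Form A)) LichJac.prevD β hβ) =
            LichJac.cohClass (C := LichJac.PairMV A) (LichJac.sigma P E)
              (LichJac.tildeF P E k (α, β)) h) ∧
    Nonempty (LichJac.LJ P E 0 ≃ₗ[ℝ] LichJac.DeRham A 0) ∧
    (∀ k : ℕ, Nonempty
      (LichJac.LJ P E (k + 1) ≃ₗ[ℝ] LichJac.DeRham A (k + 1) × LichJac.DeRham A k)) := by
  intro A P E
  have hc : LichJac.IsContactAlg η := LichJac.IsContactForm.isContactAlg hη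
  exact ⟨hc.flat_bijective, hc.isJacobi, fun k α => LichJac.d_d α, hc.sigma_sigma,
    hc.tildeF_bijective, hc.sigma_tildeF,
    fun k => ⟨hc.cohomologyEquiv k, fun α β hα hβ =>
      ⟨hc.sigma_tildeF_eq_zero.2 ⟨hα, hβ⟩, hc.cohomologyMap_mk ⟨α, hα⟩ ⟨β, hβ⟩⟩⟩,
    hc.lJ_zero, hc.lJ_succ⟩
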